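/- Let $R$ be a commutative ring with unit, $n\ge 1$ an integer and $\delta\in R$. The Brauer algebra $\mathrm{Br}_n(\delta)$ is the free $R$-module on the partitions of $\{1,\dots,n,1',\dots,n'\}$ into two-element parts (diagrams), with product given by concatenation of diagrams, each closed loop being replaced by a factor $\delta$. The Jones annular algebra $\mathrm{J}_n(\delta)$ is the subalgebra of $\mathrm{Br}_n(\delta)$ spanned by the annular diagrams, that is, those which can be drawn on the cylinder without crossings. Let $I_0$ be the two-sided ideal of $\mathrm{J}_n(\delta)$ spanned by the annular diagrams no part of which contains both a primed and an unprimed element. Let $\mathbb{1}$ denote the trivial (left and right) module: over $\mathrm{J}_n(\delta)$, and over its quotient $\mathrm{J}_n(\delta)/I_0$, it is $R$ with diagrams having $n$ left-to-right connections acting by $1$ and all other diagrams acting by $0$; over the group algebra $RC_n$ of the cyclic group $C_n$ of order $n$, it is $R$ with every group element acting by $1$. Then there are isomorphisms of $R$-modules $$\mathrm{Tor}_q^{\mathrm{J}_n(\delta)/I_0}(\mathbb{1},\mathbb{1})\cong \mathrm{Tor}_q^{RC_n}(\mathbb{1},\mathbb{1})\qquad\text{for all } q\ge 0,$$ and, if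 $\delta$ is invertible in $R$ or $n$ is odd, then additionally $$\mathrm{Tor}_q^{\mathrm{J}_n(\delta)}(\mathbb{1},\mathbb{1})\cong \mathrm{Tor}_q^{\mathrm{J}_n(\delta)/I_0}(\mathbb{1},\mathbb{1})\qquad\text{for all } q\ge 0.$$ -/

import Mathlib

theorem card_eq_fixed_add_two_mul {V : Type*} [LinearOrder V] (τ : V → V)
    (hτ : Function.Involutive τ) (K : Finset V) (hK : ∀ v ∈ K, τ v ∈ K) :
    K.card = (K.filter fun v => τ v = v).card + 2 * (K.filter fun v => v < τ v).card := by
  have h1 : (K.filter fun v => τ v < v).card = (K.filter fun v => v < τ v).card := by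
    refine Finset.card_bij' (fun v _ => τ v) (fun v _ => τ v) ?_ ?_ ?_ ?_ <;>
      intro v hv <;> simp only [Finset.mem_filter] at hv ⊢ <;> simp [hτ v, hv, hK v]
  have h2 := Finset.card_filter_add_card_filter_not (s := K) (fun v => τ v = v)
  have h3 := Finset.card_filter_add_card_filter_not
    (s := K.filter fun v => ¬ τ v = v) (fun v => v < τ v)
  rw [Finset.filter_filter, Finset.filter_filter] at h3
  have e1 : (K.filter fun v => ¬ τ v = v ∧ v < τ v) = K.filter fun v => v < τ v := by
    ext v; simp only [Finset.mem_filter]; grind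
  have e2 : (K.filter fun v => ¬ τ v = v ∧ ¬ v < τ v) = K.filter fun v => τ v < v := by
    ext v; simp only [Finset.mem_filter]; grind
  rw [e1, e2] at h3
  omega

theorem ncard_fixed_eq_two {V : Type*} [Finite V] (τ₁ τ₂ : V → V)
    (h₁ : Function.Involutive τ₁) (h₂ : Function.Involutive τ₂)
    (hne : ∀ v, ¬ (τ₁ v = v ∧ τ₂ v = v)) (x : V) (hx : τ₁ x = x ∨ τ₂ x = x) :
    {y | Relation.EqvGen (fun v w => w = τ₁ v ∨ w = τ₂ v) x y ∧ (τ₁ y = y ∨ τ₂ y = y)}.ncard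
      = 2 := by
  classical
  have := Fintype.ofFinite V
  let _ : LinearOrder V := LinearOrder.lift' (Fintype.equivFin V) (Fintype.equivFin V).injective
  let G : SimpleGraph V := SimpleGraph.fromRel fun v w => w = τ₁ v ∨ w = τ₂ v
  let C := G.connectedComponentMk x
  have hr : ∀ v w, Relation.EqvGen (fun v w => w = τ₁ v ∨ w = τ₂ v) v w ↔ G.Reachable v w := by
    intro v w
    constructor
    · intro h
      induction h with
      | rel a b h =>
        by_cases hab : a = b
        · subst hab; rfl
        · exact SimpleGraph.Adj.reachable ⟨hab, Or.inl h⟩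
      | refl a => rfl
      | symm a b _ ih => exact ih.symm
      | trans a b c _ _ i1 i2 => exact i1.trans i2
    · intro h
      rw [SimpleGraph.reachable_iff_reflTransGen] at h
      induction h with
      | refl => exact .refl _
      | tail _ h ih =>
        refine ih.trans _ _ _ ?_
        rcases h.2 with h | h
        · exact .rel _ _ h
        · exact .symm _ _ (.rel _ _ h)
  let K : Finset V := Finset.univ.filter fun v => G.Reachable x v
  have hmem : ∀ v, v ∈ K ↔ G.Reachable x v := by simp [K]
  have hK₁ : ∀ v ∈ K, τ₁ v ∈ K := fun v hv => by
    rw [hmem] at *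
    exact hv.trans ((hr _ _).1 (.rel _ _ (Or.inl rfl)))
  have hK₂ : ∀ v ∈ K, τ₂ v ∈ K := fun v hv => by
    rw [hmem] at *
    exact hv.trans ((hr _ _).1 (.rel _ _ (Or.inr rfl)))
  have c1 := card_eq_fixed_add_two_mul τ₁ h₁ K hK₁
  have c2 := card_eq_fixed_add_two_mul τ₂ h₂ K hK₂
  have c3 := (C.connected_toSimpleGraph).card_vert_le_card_edgeSet_add_one
  have hC : ∀ v, v ∈ C ↔ v ∈ K := by
    intro v
    rw [hmem, SimpleGraph.reachable_comm]
    exact SimpleGraph.ConnectedComponent.eq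
  have c4 : Nat.card C = K.card := by
    rw [← Nat.card_eq_finsetCard]
    exact Nat.card_congr (Equiv.subtypeEquivRight hC)
  have c5 : Nat.card C.toSimpleGraph.edgeSet ≤
      (K.filter fun v => v < τ₁ v).card + (K.filter fun v => v < τ₂ v).card := by
    let E : Finset (Sym2 V) := (K.filter fun v => v < τ₁ v).image (fun v => s(v, τ₁ v)) ∪
      (K.filter fun v => v < τ₂ v).image (fun v => s(v, τ₂ v))
    have hE : E.card ≤ _ := (Finset.card_union_le _ _).trans
      (add_le_add Finset.card_image_le Finset.card_image_le)
    refine le_trans ?_ hE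
    rw [← Nat.card_eq_finsetCard]
    have key : ∀ v w, v ∈ K → w ∈ K → v ≠ w → (w = τ₁ v ∨ w = τ₂ v) → s(v, w) ∈ E := by
      intro v w hv hw hvw h
      simp only [E, Finset.mem_union, Finset.mem_image, Finset.mem_filter]
      rcases h with rfl | rfl
      · left
        rcases lt_or_gt_of_ne hvw with h | h
        · exact ⟨v, ⟨hv, h⟩, rfl⟩
        · exact ⟨τ₁ v, ⟨hw, by rwa [h₁ v]⟩, by rw [h₁ v, Sym2.eq_swap]⟩
      · right
        rcases lt_or_gt_of_ne hvw with h | h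
        · exact ⟨v, ⟨hv, h⟩, rfl⟩
        · exact ⟨τ₂ v, ⟨hw, by rwa [h₂ v]⟩, by rw [h₂ v, Sym2.eq_swap]⟩
    have hmap : ∀ e ∈ C.toSimpleGraph.edgeSet, Sym2.map Subtype.val e ∈ E := by
      intro e
      induction e using Sym2.ind with
      | _ v w =>
        intro h
        have h' : G.Adj v.1 w.1 := h
        rw [Sym2.map_mk]
        have hv := (hC _).1 v.2
        have hw := (hC _).1 w.2
        rcases h'.2 with h2 | h2
        · exact key _ _ hv hw h'.1 h2
        · rw [Sym2.eq_swap]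
          exact key _ _ hw hv h'.1.symm h2
    refine Nat.card_le_card_of_injective (fun e => (⟨_, hmap e.1 e.2⟩ : E)) ?_
    intro e e' h
    exact Subtype.ext (Sym2.map.injective Subtype.val_injective (congrArg Subtype.val h))
  have hset : {y | Relation.EqvGen (fun v w => w = τ₁ v ∨ w = τ₂ v) x y ∧
      (τ₁ y = y ∨ τ₂ y = y)} =
      (((K.filter fun v => τ₁ v = v) ∪ (K.filter fun v => τ₂ v = v) : Finset V) : Set V) := by
    ext y
    simp only [Set.mem_ofPred_eq, hr, Finset.coe_union, Finset.coe_filter, Set.mem_union, hmem]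
    tauto
  have hdis : Disjoint (K.filter fun v => τ₁ v = v) (K.filter fun v => τ₂ v = v) := by
    rw [Finset.disjoint_filter]
    exact fun v _ a b => hne v ⟨a, b⟩
  have hpos : 0 < ((K.filter fun v => τ₁ v = v) ∪ (K.filter fun v => τ₂ v = v)).card := by
    refine Finset.card_pos.2 ⟨x, ?_⟩
    have : x ∈ K := (hmem x).2 (SimpleGraph.Reachable.refl x)
    simp only [Finset.mem_union, Finset.mem_filter]
    tauto
  rw [hset, Set.ncard_coe_finset]
  rw [Finset.card_union_of_disjoint hdis] at *
  omega

/-- A Brauer diagram on `n` strands: a partition of the set of `2 n` vertices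
`1, …, n` (`Sum.inl`) and `1', …, n'` (`Sum.inr`) all of whose parts have exactly two elements. -/
@[ext]
structure BrauerDiagram (n : ℕ) where
  parts : Setoid (Fin n ⊕ Fin n)
  ncard_part : ∀ x, {y | parts x y}.ncard = 2

namespace BrauerDiagram

variable {n : ℕ}

/-- The vertices of the first diagram inside the concatenation: its unprimed vertices form the left
column and its primed vertices form the middle column. -/
def leftIncl : Fin n ⊕ Fin n → Fin n ⊕ (Fin n ⊕ Fin n) := Sum.map id Sum.inl

/-- The vertices of the second diagram inside the concatenation: its unprimed vertices form the
middle column and its primed vertices form the right column. -/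
def rightIncl : Fin n ⊕ Fin n → Fin n ⊕ (Fin n ⊕ Fin n) := Sum.inr

/-- The vertices of the left and of the right column of the concatenation. -/
def outerIncl : Fin n ⊕ Fin n → Fin n ⊕ (Fin n ⊕ Fin n) := Sum.map id Sum.inr

/-- The partition of the vertices of the concatenation of two diagrams into the connected
components of the graph obtained by placing the diagrams side by side. -/
def stack (d e : BrauerDiagram n) : Setoid (Fin n ⊕ (Fin n ⊕ Fin n)) :=
  d.parts.map leftIncl ⊔ e.parts.map rightIncl

/-- The number of loops of the concatenation: connected components that meet neither the left nor
the right column. -/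
noncomputable def loops (d e : BrauerDiagram n) : ℕ :=
  Nat.card {c : Quotient (stack d e) // ∀ x : Fin n ⊕ Fin n, Quotient.mk _ (outerIncl x) ≠ c}

theorem map_le {α β : Type*} {r : Setoid α} {f : α → β} {s : Setoid β}
    (h : ∀ x y, r x y → s (f x) (f y)) : r.map f ≤ s := by
  refine Setoid.eqvGen_le ?_
  rintro _ _ ⟨x, y, hxy, rfl, rfl⟩
  exact h x y hxy

theorem stack_left {d e : BrauerDiagram n} {x y : Fin n ⊕ Fin n} (h : d.parts x y) :
    stack d e (leftIncl x) (leftIncl y) :=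
  (le_sup_left : d.parts.map leftIncl ≤ stack d e) (.rel _ _ ⟨x, y, h, rfl, rfl⟩)

theorem stack_right {d e : BrauerDiagram n} {x y : Fin n ⊕ Fin n} (h : e.parts x y) :
    stack d e (rightIncl x) (rightIncl y) :=
  (le_sup_right : e.parts.map rightIncl ≤ stack d e) (.rel _ _ ⟨x, y, h, rfl, rfl⟩)

theorem stack_le {d e : BrauerDiagram n} {s : Setoid (Fin n ⊕ (Fin n ⊕ Fin n))}
    (h₁ : ∀ x y, d.parts x y → s (leftIncl x) (leftIncl y))
    (h₂ : ∀ x y, e.parts x y → s (rightIncl x) (rightIncl y)) : stack d e ≤ s :=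
  sup_le (map_le h₁) (map_le h₂)

theorem exists_partner (d : BrauerDiagram n) : ∃ τ : Fin n ⊕ Fin n → Fin n ⊕ Fin n,
    Function.Involutive τ ∧ (∀ x, τ x ≠ x) ∧ ∀ x y, d.parts x y ↔ y = x ∨ y = τ x := by
  have h : ∀ x, ∃ z, z ≠ x ∧ ∀ y, d.parts x y ↔ y = x ∨ y = z := by
    intro x
    obtain ⟨a, b, hab, he⟩ := Set.ncard_eq_two.1 (d.ncard_part x)
    have hy : ∀ y, d.parts x y ↔ y = a ∨ y = b := fun y => by
      have : y ∈ {y | d.parts x y} ↔ y ∈ ({a, b} : Set _) := by rw [he]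
      simpa using this
    rcases (hy x).1 (d.parts.refl x) with rfl | rfl
    · exact ⟨b, hab.symm, hy⟩
    · exact ⟨a, hab, fun y => (hy y).trans or_comm⟩
  choose τ h1 h2 using h
  refine ⟨τ, fun x => ?_, h1, h2⟩
  have h3 : d.parts x (τ x) := (h2 _ _).2 (Or.inr rfl)
  rcases (h2 _ _).1 (d.parts.symm h3) with h | h
  · exact absurd h.symm (h1 x)
  · exact h.symm

theorem eq_of_parts (d : BrauerDiagram n) {x y z : Fin n ⊕ Fin n} (hy : d.parts x y)
    (hz : d.parts x z) (hxy : y ≠ x) (hxz : z ≠ x) : y = z := by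
  obtain ⟨τ, _, _, h⟩ := d.exists_partner
  rcases (h _ _).1 hy with h1 | h1
  · exact absurd h1 hxy
  rcases (h _ _).1 hz with h2 | h2
  · exact absurd h2 hxz
  rw [h1, h2]

theorem ncard_outer (d e : BrauerDiagram n) (x : Fin n ⊕ Fin n) :
    {y | (stack d e).comap outerIncl x y}.ncard = 2 := by
  obtain ⟨τ, t1, t2, t3⟩ := d.exists_partner
  obtain ⟨υ, u1, u2, u3⟩ := e.exists_partner
  let τ₁ : Fin n ⊕ (Fin n ⊕ Fin n) → Fin n ⊕ (Fin n ⊕ Fin n)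
    | .inl i => leftIncl (τ (.inl i))
    | .inr (.inl j) => leftIncl (τ (.inr j))
    | .inr (.inr k) => .inr (.inr k)
  let τ₂ : Fin n ⊕ (Fin n ⊕ Fin n) → Fin n ⊕ (Fin n ⊕ Fin n)
    | .inl i => .inl i
    | .inr y => .inr (υ y)
  have a1 : ∀ y, τ₁ (leftIncl y) = leftIncl (τ y) := by rintro (i | j) <;> rfl
  have a2 : ∀ y, τ₂ (rightIncl y) = rightIncl (υ y) := fun y => rfl
  have b : Function.Injective (leftIncl (n := n)) := by
    rintro (i | j) (i' | j') h <;> simp_all [leftIncl]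
  have bo : Function.Injective (outerIncl (n := n)) := by
    rintro (i | j) (i' | j') h <;> simp_all [outerIncl]
  have i1 : Function.Involutive τ₁ := by
    have : ∀ y, τ₁ (τ₁ (leftIncl y)) = leftIncl y := fun y => by rw [a1, a1, t1]
    rintro (i | j | k)
    · exact this (.inl i)
    · exact this (.inr j)
    · rfl
  have i2 : Function.Involutive τ₂ := by
    rintro (i | y)
    · rfl
    · change rightIncl (υ (υ y)) = _
      rw [u1]; rfl
  have n1 : ∀ y, τ₁ (leftIncl y) ≠ leftIncl y := fun y h => t2 y (b (by rw [← a1, h]))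
  have n2 : ∀ y, τ₂ (rightIncl y) ≠ rightIncl y := fun y h => u2 y (Sum.inr_injective h)
  have hfix : ∀ v, (τ₁ v = v ∨ τ₂ v = v) ↔ ∃ y, v = outerIncl y := by
    rintro (i | j | k)
    · exact ⟨fun _ => ⟨.inl i, rfl⟩, fun _ => Or.inr rfl⟩
    · constructor
      · rintro (h | h)
        · exact absurd h (n1 (.inr j))
        · exact absurd h (n2 (.inl j))
      · rintro ⟨y | y, h⟩ <;> simp [outerIncl] at h
    · exact ⟨fun _ => ⟨.inr k, rfl⟩, fun _ => Or.inl rfl⟩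
  have hne : ∀ v, ¬ (τ₁ v = v ∧ τ₂ v = v) := by
    rintro (i | y) ⟨h1, h2⟩
    · exact n1 (.inl i) h1
    · exact n2 y h2
  have hst : ∀ v w, stack d e v w ↔ Relation.EqvGen (fun v w => w = τ₁ v ∨ w = τ₂ v) v w := by
    intro v w
    constructor
    · intro h
      refine (stack_le (s := Relation.EqvGen.setoid fun v w => w = τ₁ v ∨ w = τ₂ v) ?_ ?_) h
      · intro x y hxy
        rcases (t3 _ _).1 hxy with rfl | rfl
        · exact .refl _
        · exact .rel _ _ (Or.inl (a1 _).symm)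
      · intro x y hxy
        rcases (u3 _ _).1 hxy with rfl | rfl
        · exact .refl _
        · exact .rel _ _ (Or.inr (a2 _).symm)
    · intro h
      induction h with
      | rel a c h =>
        have l1 : ∀ y, stack d e (leftIncl y) (τ₁ (leftIncl y)) := fun y => by
          rw [a1]; exact stack_left ((t3 _ _).2 (Or.inr rfl))
        rcases h with rfl | rfl
        · rcases a with i | j | k
          · exact l1 (.inl i)
          · exact l1 (.inr j)
          · exact (stack d e).refl _
        · rcases a with i | y
          · exact (stack d e).refl _
          · exact stack_right ((u3 _ _).2 (Or.inr rfl))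
      | refl a => exact (stack d e).refl _
      | symm a c _ ih => exact (stack d e).symm ih
      | trans a c f _ _ h1 h2 => exact (stack d e).trans h1 h2
  have key := ncard_fixed_eq_two τ₁ τ₂ i1 i2 hne (outerIncl x) ((hfix _).2 ⟨x, rfl⟩)
  rw [← key, ← Set.ncard_image_of_injective _ bo]
  congr 1
  ext v
  simp only [Set.mem_image, Set.mem_ofPred_eq, Setoid.comap_rel, ← hst, hfix]
  constructor
  · rintro ⟨y, h, rfl⟩
    exact ⟨h, y, rfl⟩
  · rintro ⟨h, y, rfl⟩
    exact ⟨y, h, rfl⟩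

/-- The concatenation of two diagrams, with the loops removed. -/
def comp (d e : BrauerDiagram n) : BrauerDiagram n where
  parts := (stack d e).comap outerIncl
  ncard_part := ncard_outer d e

/-- The identity diagram, whose parts are the sets `{i, i'}`. -/
def idDiagram (n : ℕ) : BrauerDiagram n where
  parts := Setoid.ker (Sum.elim id id)
  ncard_part x := by
    rw [Set.ncard_eq_two]
    refine ⟨.inl (Sum.elim id id x), .inr (Sum.elim id id x), by simp, ?_⟩
    ext y
    rcases x with x | x <;> rcases y with y | y <;> simp [Setoid.ker_def, eq_comm]

section Matrices

open scoped Classical in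
/-- The matrix through which a diagram acts on the colourings of `n` points with two colours. -/
noncomputable def mat (d : BrauerDiagram n) : Matrix (Fin n → Bool) (Fin n → Bool) ℕ :=
  fun x y => if d.parts ≤ Setoid.ker (Sum.elim x y) then 1 else 0

theorem mat_mul (d e : BrauerDiagram n) : mat d * mat e = 2 ^ loops d e • mat (comp d e) := by
  classical
  ext x y
  rw [Matrix.mul_apply, Matrix.smul_apply]
  simp only [mat]
  simp_rw [ite_mul, one_mul, zero_mul, ← ite_and]
  rw [Finset.sum_boole]
  have hW : ∀ w : Fin n → Bool, (d.parts ≤ Setoid.ker (Sum.elim x w) ∧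
      e.parts ≤ Setoid.ker (Sum.elim w y)) ↔
      stack d e ≤ Setoid.ker (Sum.elim x (Sum.elim w y)) := by
    intro w
    constructor
    · rintro ⟨h1, h2⟩
      refine stack_le (fun a b h => ?_) (fun a b h => ?_)
      · have := h1 h
        rcases a with a | a <;> rcases b with b | b <;> exact this
      · exact h2 h
    · intro h
      refine ⟨fun a b hab => ?_, fun a b hab => ?_⟩
      · have := h (stack_left hab)
        rcases a with a | a <;> rcases b with b | b <;> exact this
      · exact h (stack_right hab)
  have hz : ∀ (w : Fin n → Bool) (a : Fin n ⊕ Fin n),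
      Sum.elim x (Sum.elim w y) (outerIncl a) = Sum.elim x y a := by
    rintro w (a | a) <;> rfl
  split_ifs with hc
  · rw [smul_eq_mul, mul_one, Nat.cast_id]
    have : (2 : ℕ) ^ loops d e = Nat.card ({c : Quotient (stack d e) //
        ∀ x : Fin n ⊕ Fin n, Quotient.mk _ (outerIncl x) ≠ c} → Bool) := by
      rw [Nat.card_fun, loops]; simp
    rw [this, ← Fintype.card_subtype, ← Nat.card_eq_fintype_card]
    let g (W : {c : Quotient (stack d e) //
        ∀ x : Fin n ⊕ Fin n, Quotient.mk _ (outerIncl x) ≠ c} → Bool) :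
        Quotient (stack d e) → Bool := fun c =>
      if h : ∃ a : Fin n ⊕ Fin n, Quotient.mk _ (outerIncl a) = c then Sum.elim x y h.choose
      else W ⟨c, not_exists.1 h⟩
    have hg : ∀ W a, g W (Quotient.mk _ (outerIncl a)) = Sum.elim x y a := by
      intro W a
      have h : ∃ b : Fin n ⊕ Fin n, (Quotient.mk (stack d e) (outerIncl b)) =
        Quotient.mk _ (outerIncl a) := ⟨a, rfl⟩
      simp only [g, dif_pos h]
      have hs : stack d e (outerIncl h.choose) (outerIncl a) := Quotient.exact h.choose_spec
      exact hc hs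
    have hg' : ∀ W c, g W c.1 = W c := by
      intro W c
      simp only [g, dif_neg (not_exists.2 c.2)]
    have hgs : ∀ W, Sum.elim x (Sum.elim (fun j => g W (Quotient.mk _ (.inr (.inl j)))) y) =
        fun v => g W (Quotient.mk _ v) := by
      intro W
      ext (i | j | k)
      · exact (hg W (.inl i)).symm
      · rfl
      · exact (hg W (.inr k)).symm
    refine Nat.card_congr
      { toFun := fun w c => Quotient.lift (s := stack d e) (Sum.elim x (Sum.elim w.1 y))
          (fun a b h => ((hW w.1).1 w.2) h) c.1
        invFun := fun W => ⟨fun j => g W (Quotient.mk _ (.inr (.inl j))), ?_⟩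
        left_inv := ?_
        right_inv := ?_ }
    · rw [hW, hgs]
      intro a b h
      exact congrArg (g W) (Quotient.sound h)
    · intro w
      apply Subtype.ext
      funext j
      let W : {c : Quotient (stack d e) //
          ∀ x : Fin n ⊕ Fin n, Quotient.mk _ (outerIncl x) ≠ c} → Bool := fun c =>
        Quotient.lift (s := stack d e) (Sum.elim x (Sum.elim w.1 y))
          (fun a b h => ((hW w.1).1 w.2) h) c.1
      change g W (Quotient.mk _ (.inr (.inl j))) = w.1 j
      by_cases h : ∃ a : Fin n ⊕ Fin n,
          Quotient.mk (stack d e) (outerIncl a) = Quotient.mk _ (.inr (.inl j))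
      · obtain ⟨a, ha⟩ := h
        rw [← ha, hg]
        have := ((hW w.1).1 w.2) (Quotient.exact ha)
        rw [Setoid.ker_def, hz] at this
        exact this
      · exact hg' W ⟨_, not_exists.1 h⟩
    · intro W
      funext c
      obtain ⟨c, hcc⟩ := c
      induction c using Quotient.ind with
      | _ v =>
        change Sum.elim x (Sum.elim (fun j => g W (Quotient.mk _ (.inr (.inl j)))) y) v = _
        rw [hgs]
        exact hg' W ⟨_, hcc⟩
  · rw [smul_zero, Nat.cast_eq_zero, Finset.card_eq_zero, Finset.filter_eq_empty_iff]
    intro w _ h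
    refine hc fun a b hab => ?_
    have := (hW w).1 h hab
    rw [Setoid.ker_def, hz, hz] at this
    exact this

theorem mat_one : mat (idDiagram n) = 1 := by
  classical
  ext x y
  rw [mat, Matrix.one_apply]
  refine if_congr ⟨fun h => ?_, fun h => ?_⟩ rfl rfl
  · funext i
    exact @h (.inl i) (.inr i) rfl
  · subst h
    rintro (a | a) (b | b) (h : a = b) <;> subst h <;> rfl

theorem eq_of_smul_mat {d e : BrauerDiagram n} {k l : ℕ} (h : 2 ^ k • mat d = 2 ^ l • mat e) :
    k = l ∧ d = e := by
  classical
  have h' : ∀ x y, 2 ^ k • mat d x y = 2 ^ l • mat e x y := fun x y => by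
    simpa using congrFun (congrFun h x) y
  have hkl : k = l := by
    have h0 := h' (fun _ => true) (fun _ => true)
    have ht : ∀ s : Setoid (Fin n ⊕ Fin n), s ≤ Setoid.ker
        (Sum.elim (fun _ : Fin n => true) fun _ : Fin n => true) := by
      rintro s (a | a) (b | b) _ <;> rfl
    simp only [mat, if_pos (ht _), smul_eq_mul, mul_one] at h0
    exact Nat.pow_right_injective le_rfl h0
  subst hkl
  refine ⟨rfl, ?_⟩
  have hs : ∀ z : Fin n ⊕ Fin n → Bool, d.parts ≤ Setoid.ker z ↔ e.parts ≤ Setoid.ker z := by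
    intro z
    have h0 := h' (z ∘ Sum.inl) (z ∘ Sum.inr)
    simp only [mat, Sum.elim_comp_inl_inr, smul_eq_mul] at h0
    split_ifs at h0 with h1 h2 h2
    · exact iff_of_true h1 h2
    · simp at h0
    · exact absurd h0.symm (by simp)
    · exact iff_of_false h1 h2
  have hle : ∀ s t : Setoid (Fin n ⊕ Fin n),
      (∀ z : Fin n ⊕ Fin n → Bool, t ≤ Setoid.ker z → s ≤ Setoid.ker z) → s ≤ t := by
    intro s t hst a b hab
    have := hst (fun c => decide (t a c)) (fun c c' hc => by
      simp only [Setoid.ker_def, decide_eq_decide]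
      exact ⟨fun h => t.trans h hc, fun h => t.trans h (t.symm hc)⟩) hab
    simpa [Setoid.ker_def] using this
  ext1
  exact le_antisymm (hle _ _ fun z => (hs z).2) (hle _ _ fun z => (hs z).1)

end Matrices

theorem comp_assoc (d e f : BrauerDiagram n) :
    loops d e + loops (comp d e) f = loops e f + loops d (comp e f) ∧
      comp (comp d e) f = comp d (comp e f) := by
  apply eq_of_smul_mat
  have h := mul_assoc (mat d) (mat e) (mat f)
  rw [mat_mul, mat_mul, smul_mul_assoc, mul_smul_comm, mat_mul, mat_mul, smul_smul, smul_smul,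
    ← pow_add, ← pow_add] at h
  exact h

theorem id_comp (d : BrauerDiagram n) : loops (idDiagram n) d = 0 ∧ comp (idDiagram n) d = d := by
  apply eq_of_smul_mat
  rw [← mat_mul, mat_one, one_mul, pow_zero, one_smul]

theorem comp_id (d : BrauerDiagram n) : loops d (idDiagram n) = 0 ∧ comp d (idDiagram n) = d := by
  apply eq_of_smul_mat
  rw [← mat_mul, mat_one, mul_one, pow_zero, one_smul]

/-- Every unprimed vertex lies in a part with a primed one, that is, the diagram has the maximal
number `n` of left-to-right connections. -/
def IsThrough (d : BrauerDiagram n) : Prop := ∀ i, ∃ j, d.parts (.inl i) (.inr j)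

theorem IsThrough.exists_left {d : BrauerDiagram n} (h : d.IsThrough) (j : Fin n) :
    ∃ i, d.parts (.inl i) (.inr j) := by
  choose f hf using h
  have hinj : Function.Injective f := by
    intro a b hab
    have h1 := d.parts.symm (hf a)
    have h2 := d.parts.symm (hf b)
    rw [hab] at h1
    exact Sum.inl_injective (d.eq_of_parts h1 h2 (by simp) (by simp))
  obtain ⟨i, hi⟩ := Finite.surjective_of_injective hinj j
  exact ⟨i, hi ▸ hf i⟩

theorem isThrough_of_left {d : BrauerDiagram n} (h : ∀ j, ∃ i, d.parts (.inl i) (.inr j)) :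
    d.IsThrough := by
  choose f hf using h
  have hinj : Function.Injective f := by
    intro a b hab
    have h1 := hf a
    rw [hab] at h1
    exact Sum.inr_injective (d.eq_of_parts h1 (hf b) (by simp) (by simp))
  intro i
  obtain ⟨j, hj⟩ := Finite.surjective_of_injective hinj i
  exact ⟨j, hj ▸ hf j⟩

theorem isThrough_comp (d e : BrauerDiagram n) :
    (comp d e).IsThrough ↔ d.IsThrough ∧ e.IsThrough := by
  constructor
  · intro h
    constructor
    · intro i
      obtain ⟨τ, _, t2, t3⟩ := d.exists_partner
      have hp : d.parts (.inl i) (τ (.inl i)) := (t3 _ _).2 (Or.inr rfl)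
      rcases hq : τ (.inl i) with i' | j
      · exfalso
        rw [hq] at hp
        obtain ⟨k, hk⟩ := h i
        have h1 : (comp d e).parts (.inl i) (.inl i') := stack_left (e := e) hp
        have := (comp d e).eq_of_parts h1 hk (fun h => t2 _ (hq.trans h)) (by simp)
        simp at this
      · exact ⟨j, hq ▸ hp⟩
    · apply isThrough_of_left
      intro j
      obtain ⟨τ, _, t2, t3⟩ := e.exists_partner
      have hp : e.parts (.inr j) (τ (.inr j)) := (t3 _ _).2 (Or.inr rfl)
      rcases hq : τ (.inr j) with i | j'
      · exact ⟨i, e.parts.symm (hq ▸ hp)⟩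
      · exfalso
        rw [hq] at hp
        obtain ⟨i, hi⟩ := h.exists_left j
        have h1 : (comp d e).parts (.inr j) (.inr j') := stack_right (d := d) hp
        have := (comp d e).eq_of_parts h1 ((comp d e).parts.symm hi)
          (fun h => t2 _ (hq.trans h)) (by simp)
        simp at this
  · rintro ⟨h1, h2⟩ i
    obtain ⟨j, hj⟩ := h1 i
    obtain ⟨k, hk⟩ := h2 j
    exact ⟨k, (stack d e).trans (stack_left hj) (stack_right hk)⟩

theorem loops_eq_zero {d : BrauerDiagram n} (e : BrauerDiagram n) (hd : d.IsThrough)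
    (_he : e.IsThrough) : loops d e = 0 := by
  rw [loops, Nat.card_eq_zero]
  left
  constructor
  rintro ⟨c, hc⟩
  induction c using Quotient.ind with
  | _ v =>
    rcases v with i | j | k
    · exact hc (.inl i) rfl
    · obtain ⟨i, hi⟩ := hd.exists_left j
      exact hc (.inl i) (Quotient.sound (stack_left hi))
    · exact hc (.inr k) rfl

end BrauerDiagram

/-- The Brauer algebra `Br_n(δ)`: the free `R`-module on the Brauer diagrams, in which the product
of two diagrams is their concatenation, each loop being replaced by a factor `δ`. -/
def BrauerAlgebra (R : Type*) [CommRing R] (n : ℕ) (_δ : R) : Type _ := BrauerDiagram n →₀ R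

namespace BrauerAlgebra

variable {R : Type*} [CommRing R] {n : ℕ} {δ : R}

noncomputable instance : AddCommGroup (BrauerAlgebra R n δ) :=
  inferInstanceAs (AddCommGroup (BrauerDiagram n →₀ R))

noncomputable instance : Module R (BrauerAlgebra R n δ) :=
  inferInstanceAs (Module R (BrauerDiagram n →₀ R))

variable (R δ) in
/-- The basis of the Brauer algebra given by the diagrams. -/
noncomputable def basis : Module.Basis (BrauerDiagram n) R (BrauerAlgebra R n δ) :=
  Module.Basis.ofRepr (LinearEquiv.refl R (BrauerDiagram n →₀ R))

variable (R δ) in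
/-- A diagram, as an element of the Brauer algebra. -/
noncomputable def diagram (d : BrauerDiagram n) : BrauerAlgebra R n δ := basis R δ d

/-- The bilinear multiplication of the Brauer algebra. -/
noncomputable def mulMap :
    BrauerAlgebra R n δ →ₗ[R] BrauerAlgebra R n δ →ₗ[R] BrauerAlgebra R n δ :=
  (basis R δ).constr R fun d => (basis R δ).constr R fun e =>
    δ ^ BrauerDiagram.loops d e • diagram R δ (BrauerDiagram.comp d e)

noncomputable instance : Mul (BrauerAlgebra R n δ) := ⟨fun a b => mulMap a b⟩

noncomputable instance : One (BrauerAlgebra R n δ) := ⟨diagram R δ (BrauerDiagram.idDiagram n)⟩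

theorem mul_def (a b : BrauerAlgebra R n δ) : a * b = mulMap a b := rfl

theorem one_def : (1 : BrauerAlgebra R n δ) = diagram R δ (BrauerDiagram.idDiagram n) := rfl

theorem mulMap_diagram (d e : BrauerDiagram n) : mulMap (diagram R δ d) (diagram R δ e) =
    δ ^ BrauerDiagram.loops d e • diagram R δ (BrauerDiagram.comp d e) := by
  rw [mulMap, diagram, diagram, Module.Basis.constr_basis, Module.Basis.constr_basis]

theorem diagram_mul_diagram (d e : BrauerDiagram n) : diagram R δ d * diagram R δ e =
    δ ^ BrauerDiagram.loops d e • diagram R δ (BrauerDiagram.comp d e) :=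
  mulMap_diagram d e

theorem diagram_induction {p : BrauerAlgebra R n δ → Prop} (a : BrauerAlgebra R n δ)
    (hd : ∀ d, p (diagram R δ d)) (ha : ∀ a b, p a → p b → p (a + b))
    (hs : ∀ (r : R) a, p a → p (r • a)) : p a := by
  have h0 : p 0 := by simpa using hs 0 _ (hd (BrauerDiagram.idDiagram n))
  have := (basis R δ).mem_span a
  induction this using Submodule.span_induction with
  | mem x hx => obtain ⟨d, rfl⟩ := hx; exact hd d
  | zero => exact h0
  | add x y _ _ h1 h2 => exact ha x y h1 h2
  | smul r x _ h => exact hs r x h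

theorem mulMap_assoc (a b c : BrauerAlgebra R n δ) :
    mulMap (mulMap a b) c = mulMap a (mulMap b c) := by
  induction a using diagram_induction with
  | ha x y h1 h2 => simp only [map_add, LinearMap.add_apply, h1, h2]
  | hs r x h => simp only [map_smul, LinearMap.smul_apply, h]
  | hd d =>
    induction b using diagram_induction with
    | ha x y h1 h2 => simp only [map_add, LinearMap.add_apply, h1, h2]
    | hs r x h => simp only [map_smul, LinearMap.smul_apply, h]
    | hd e =>
      induction c using diagram_induction with
      | ha x y h1 h2 => simp only [map_add, h1, h2]
      | hs r x h => simp only [map_smul, h]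
      | hd f =>
        obtain ⟨h1, h2⟩ := BrauerDiagram.comp_assoc d e f
        simp only [mulMap_diagram, map_smul, LinearMap.smul_apply, smul_smul, ← pow_add, h1, h2]

theorem mulMap_one_left (a : BrauerAlgebra R n δ) : mulMap 1 a = a := by
  induction a using diagram_induction with
  | ha x y h1 h2 => rw [map_add, h1, h2]
  | hs r x h => rw [map_smul, h]
  | hd d =>
    obtain ⟨h1, h2⟩ := BrauerDiagram.id_comp d
    rw [one_def, mulMap_diagram, h1, h2, pow_zero, one_smul]

theorem mulMap_one_right (a : BrauerAlgebra R n δ) : mulMap a 1 = a := by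
  induction a using diagram_induction with
  | ha x y h1 h2 => rw [map_add, LinearMap.add_apply, h1, h2]
  | hs r x h => rw [map_smul, LinearMap.smul_apply, h]
  | hd d =>
    obtain ⟨h1, h2⟩ := BrauerDiagram.comp_id d
    rw [one_def, mulMap_diagram, h1, h2, pow_zero, one_smul]

noncomputable instance : Ring (BrauerAlgebra R n δ) :=
  { (inferInstance : AddCommGroup (BrauerAlgebra R n δ)) with
    mul := fun a b => a * b
    one := 1
    left_distrib := fun a b c => map_add (mulMap a) b c
    right_distrib := fun a b c => by
      change mulMap (a + b) c = mulMap a c + mulMap b c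
      rw [map_add, LinearMap.add_apply]
    zero_mul := fun a => by
      change mulMap 0 a = 0
      rw [map_zero, LinearMap.zero_apply]
    mul_zero := fun a => map_zero (mulMap a)
    mul_assoc := mulMap_assoc
    one_mul := mulMap_one_left
    mul_one := mulMap_one_right }

noncomputable instance : Algebra R (BrauerAlgebra R n δ) :=
  Algebra.ofModule
    (fun r a b => by
      change mulMap (r • a) b = r • mulMap a b
      rw [map_smul, LinearMap.smul_apply])
    (fun r a b => map_smul (mulMap a) r b)

open scoped Classical in
/-- The linear map underlying the augmentation of the Brauer algebra: a diagram with `n`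
left-to-right connections goes to `1` and every other diagram goes to `0`. -/
noncomputable def augmentationMap : BrauerAlgebra R n δ →ₗ[R] R :=
  (basis R δ).constr R fun d => if d.IsThrough then 1 else 0

theorem augmentationMap_diagram_of_isThrough {d : BrauerDiagram n} (h : d.IsThrough) :
    augmentationMap (diagram R δ d) = 1 := by
  rw [augmentationMap, diagram, Module.Basis.constr_basis, if_pos h]

theorem augmentationMap_diagram_of_not_isThrough {d : BrauerDiagram n} (h : ¬ d.IsThrough) :
    augmentationMap (diagram R δ d) = 0 := by
  rw [augmentationMap, diagram, Module.Basis.constr_basis, if_neg h]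

theorem augmentationMap_one : augmentationMap (1 : BrauerAlgebra R n δ) = 1 :=
  augmentationMap_diagram_of_isThrough fun i => ⟨i, rfl⟩

theorem augmentationMap_mul (a b : BrauerAlgebra R n δ) :
    augmentationMap (a * b) = augmentationMap a * augmentationMap b := by
  induction a using diagram_induction with
  | ha x y h1 h2 => rw [add_mul, map_add, map_add, h1, h2, add_mul]
  | hs r x h => rw [smul_mul_assoc, map_smul, map_smul, h, smul_mul_assoc]
  | hd d =>
    induction b using diagram_induction with
    | ha x y h1 h2 => rw [mul_add, map_add, map_add, h1, h2, mul_add]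
    | hs r x h => rw [mul_smul_comm, map_smul, map_smul, h, mul_smul_comm]
    | hd e =>
      rw [diagram_mul_diagram, map_smul]
      by_cases hd : d.IsThrough
      · by_cases he : e.IsThrough
        · rw [BrauerDiagram.loops_eq_zero e hd he,
            augmentationMap_diagram_of_isThrough ((BrauerDiagram.isThrough_comp d e).2 ⟨hd, he⟩),
            augmentationMap_diagram_of_isThrough hd, augmentationMap_diagram_of_isThrough he,
            pow_zero, one_smul, one_mul]
        · rw [augmentationMap_diagram_of_not_isThrough
              fun h => he ((BrauerDiagram.isThrough_comp d e).1 h).2,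
            augmentationMap_diagram_of_not_isThrough he, smul_zero, mul_zero]
      · rw [augmentationMap_diagram_of_not_isThrough
            fun h => hd ((BrauerDiagram.isThrough_comp d e).1 h).1,
          augmentationMap_diagram_of_not_isThrough hd, smul_zero, zero_mul]

variable (R n δ) in
/-- The augmentation of the Brauer algebra, through which it acts on its trivial module. -/
noncomputable def augmentation : BrauerAlgebra R n δ →ₐ[R] R :=
  AlgHom.ofLinearMap augmentationMap augmentationMap_one augmentationMap_mul

end BrauerAlgebra

/-- The defects of a partition of `{1, …, n}`: the elements that form a part on their own. -/
noncomputable def Setoid.defects {n : ℕ} (p : Setoid (Fin n)) : Finset (Fin n) :=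
  {i : Fin n | ∀ j, p i j → j = i}.toFinite.toFinset

/-- The annularity condition on a link state `p`: for every edge `{i, j}` of `p`, no edge of `p`
joins the open cyclic intervals `(i, j)` and `(j, i)`, and all the defects of `p` lie in one of
these two intervals. -/
def Setoid.IsAnnular {n : ℕ} (p : Setoid (Fin n)) : Prop :=
  ∀ i j, i ≠ j → p i j →
    (∀ k ∈ Set.cIoo i j, ∀ l ∈ Set.cIoo j i, ¬ p k l) ∧
    ((p.defects : Set (Fin n)) ⊆ Set.cIoo i j ∨ (p.defects : Set (Fin n)) ⊆ Set.cIoo j i)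

namespace BrauerDiagram

variable {n : ℕ}

/-- The link state induced on the unprimed vertices. -/
def leftState (d : BrauerDiagram n) : Setoid (Fin n) := d.parts.comap Sum.inl

/-- The link state induced on the primed vertices. -/
def rightState (d : BrauerDiagram n) : Setoid (Fin n) := d.parts.comap Sum.inr

/-- A Brauer diagram is annular (it can be drawn on the cylinder without crossings) if both of its
link states are annular and, for some `σ` in the cyclic group generated by the `t`-cycle
`i ↦ i + 1`, where `t` is the number of defects of each of the two link states, it joins the `i`-th
defect on the primed side to the `σ i`-th defect on the unprimed side. -/
def IsAnnular (d : BrauerDiagram n) : Prop :=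
  d.leftState.IsAnnular ∧ d.rightState.IsAnnular ∧
    ∃ (t : ℕ) (hl : d.leftState.defects.card = t) (hr : d.rightState.defects.card = t),
      ∃ σ ∈ Subgroup.zpowers (finRotate t), ∀ i : Fin t,
        d.parts (.inr (d.rightState.defects.orderEmbOfFin hr i))
          (.inl (d.leftState.defects.orderEmbOfFin hl (σ i)))

/-- No part of the diagram contains both a primed and an unprimed vertex. -/
def HasNoThrough (d : BrauerDiagram n) : Prop := ∀ i j, ¬ d.parts (.inl i) (.inr j)

end BrauerDiagram

section Jones

variable (R : Type*) [CommRing R] (n : ℕ) (δ : R)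

/-- The Jones annular algebra `J_n(δ)`: the subalgebra of the Brauer algebra `Br_n(δ)` generated by
the annular diagrams. (Up to powers of `δ`, annular diagrams are closed under multiplication, so
this is the same as their linear span.) -/
noncomputable def JonesAnnularAlgebra : Subalgebra R (BrauerAlgebra R n δ) :=
  Algebra.adjoin R {x | ∃ d : BrauerDiagram n, d.IsAnnular ∧ x = BrauerAlgebra.diagram R δ d}

/-- The augmentation of `J_n(δ)`: a diagram with `n` left-to-right connections goes to `1` and every
other diagram goes to `0`. -/
noncomputable def jonesAugmentation : JonesAnnularAlgebra R n δ →ₐ[R] R :=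
  (BrauerAlgebra.augmentation R n δ).comp (JonesAnnularAlgebra R n δ).val

/-- The two-sided ideal `I_0` of `J_n(δ)` generated by the annular diagrams in which no part
contains both primed and unprimed vertices. -/
noncomputable def jonesIdeal : Ideal (JonesAnnularAlgebra R n δ) :=
  (TwoSidedIdeal.span {x : JonesAnnularAlgebra R n δ | ∃ d : BrauerDiagram n,
    d.IsAnnular ∧ d.HasNoThrough ∧
      (x : BrauerAlgebra R n δ) = BrauerAlgebra.diagram R δ d}).asIdeal

instance : (jonesIdeal R n δ).IsTwoSided :=
  inferInstanceAs (TwoSidedIdeal.asIdeal _).IsTwoSided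

theorem jonesAugmentation_eq_zero [NeZero n] (x : JonesAnnularAlgebra R n δ)
    (hx : x ∈ jonesIdeal R n δ) : jonesAugmentation R n δ x = 0 := by
  have h : TwoSidedIdeal.span {x : JonesAnnularAlgebra R n δ | ∃ d : BrauerDiagram n,
      d.IsAnnular ∧ d.HasNoThrough ∧ (x : BrauerAlgebra R n δ) = BrauerAlgebra.diagram R δ d} ≤
      TwoSidedIdeal.ker (jonesAugmentation R n δ) := by
    rw [TwoSidedIdeal.span_le]
    rintro x ⟨d, -, hd, hx⟩
    rw [SetLike.mem_coe, TwoSidedIdeal.mem_ker]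
    change BrauerAlgebra.augmentationMap (x : BrauerAlgebra R n δ) = 0
    rw [hx]
    refine BrauerAlgebra.augmentationMap_diagram_of_not_isThrough fun h => ?_
    obtain ⟨j, hj⟩ := h 0
    exact hd 0 j hj
  exact (TwoSidedIdeal.mem_ker _).1 (h (TwoSidedIdeal.mem_asIdeal.1 hx))

/-- The augmentation of `J_n(δ) / I_0` induced by the augmentation of `J_n(δ)`. -/
noncomputable def jonesQuotientAugmentation [NeZero n] :
    (JonesAnnularAlgebra R n δ ⧸ jonesIdeal R n δ) →ₐ[R] R :=
  Ideal.Quotient.liftₐ (jonesIdeal R n δ) (jonesAugmentation R n δ)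
    (jonesAugmentation_eq_zero R n δ)

/-- The augmentation of a group algebra, under which every group element goes to `1`. -/
noncomputable def groupAugmentation (G : Type*) [Group G] : MonoidAlgebra R G →ₐ[R] R :=
  MonoidAlgebra.lift R R G 1

end Jones

section Tor

open CategoryTheory TensorProduct

universe u v

variable (R : Type u) [CommRing R] (A : Type u) [Ring A] [Algebra R A]

section Balanced

variable (M N : Type*) [AddCommGroup M] [AddCommGroup N] [Module R M] [Module R N]
  [Module Aᵐᵒᵖ M] [Module A N]

/-- The relations `m a ⊗ n = m ⊗ a n` for a right `A`-module `M` and a left `A`-module `N`. -/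
def balancingRelations : Submodule R (M ⊗[R] N) :=
  Submodule.span R {z | ∃ (m : M) (a : A) (n : N),
    z = (MulOpposite.op a • m) ⊗ₜ[R] n - m ⊗ₜ[R] (a • n)}

/-- The tensor product `M ⊗_A N` of a right `A`-module and a left `A`-module over a possibly
noncommutative `R`-algebra `A`, as an `R`-module. -/
abbrev BalancedTensor := (M ⊗[R] N) ⧸ balancingRelations R A M N

variable {N} {N' : Type*} [AddCommGroup N'] [Module R N'] [Module A N']
  [IsScalarTower R A N] [IsScalarTower R A N']

/-- The map `M ⊗_A N → M ⊗_A N'` induced by an `A`-linear map `N → N'`. -/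
noncomputable def balancedMap (f : N →ₗ[A] N') :
    BalancedTensor R A M N →ₗ[R] BalancedTensor R A M N' :=
  Submodule.mapQ _ _ ((f.restrictScalars R).lTensor M) <| by
    rw [balancingRelations, Submodule.span_le]
    rintro _ ⟨m, a, x, rfl⟩
    refine Submodule.subset_span ⟨m, a, f x, ?_⟩
    simp

end Balanced

/-- A left module over an `R`-algebra, regarded as an `R`-module. -/
@[reducible] noncomputable def algebraModule (B : Type u) [Ring B] [Algebra R B]
    (M : ModuleCat.{v} B) : Module R M :=
  Module.restrictScalars R B M

attribute [local instance] algebraModule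

theorem algebraModule_isScalarTower (B : Type u) [Ring B] [Algebra R B] (M : ModuleCat.{v} B) :
    IsScalarTower R B M :=
  IsScalarTower.restrictScalars R B M

attribute [local instance] algebraModule_isScalarTower

variable {A}

/-- The functor `M ⊗_A -` from left `A`-modules to `R`-modules, for a right `A`-module `M`. -/
noncomputable def tensorFunctor (M : ModuleCat.{u} Aᵐᵒᵖ) : ModuleCat.{u} A ⥤ ModuleCat.{u} R where
  obj N := ModuleCat.of R (BalancedTensor R A M N)
  map f := ModuleCat.ofHom (balancedMap R A M f.hom)
  map_id N := by
    refine ModuleCat.hom_ext (Submodule.linearMap_qext _ (TensorProduct.ext' fun m x => ?_))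
    rfl
  map_comp f g := by
    refine ModuleCat.hom_ext (Submodule.linearMap_qext _ (TensorProduct.ext' fun m x => ?_))
    rfl

instance (M : ModuleCat.{u} Aᵐᵒᵖ) : (tensorFunctor R M).Additive where
  map_add {N N' f g} := by
    refine ModuleCat.hom_ext (Submodule.linearMap_qext _ (TensorProduct.ext' fun m x => ?_))
    exact congrArg (Submodule.Quotient.mk) (TensorProduct.tmul_add m (f.hom x) (g.hom x))

/-- `Tor_q^A(M, N)` for a right `A`-module `M` and a left `A`-module `N` over an `R`-algebra `A`, as
an `R`-module: the `q`-th left derived functor of `M ⊗_A -`, evaluated at `N`. -/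
noncomputable def algebraTor (q : ℕ) (M : ModuleCat.{u} Aᵐᵒᵖ) (N : ModuleCat.{u} A) :
    ModuleCat.{u} R :=
  ((tensorFunctor R M).leftDerived q).obj N

variable {R}

/-- The trivial left module of an augmented algebra: `R` with `a • r = ε(a) r`. -/
noncomputable def trivialLeft (ε : A →ₐ[R] R) : ModuleCat.{u} A :=
  (ModuleCat.restrictScalars ε.toRingHom).obj (ModuleCat.of R R)

/-- The trivial right module of an augmented algebra: `R` with `r • a = r ε(a)`. -/
noncomputable def trivialRight (ε : A →ₐ[R] R) : ModuleCat.{u} Aᵐᵒᵖ :=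
  (ModuleCat.restrictScalars (ε.fromOpposite fun _ _ => Commute.all _ _).toRingHom).obj
    (ModuleCat.of R R)

/-- The homology `Tor_q^A(𝟙, 𝟙)` of an augmented `R`-algebra with trivial module `𝟙`. -/
noncomputable def algebraHomology (ε : A →ₐ[R] R) (q : ℕ) : ModuleCat.{u} R :=
  algebraTor R q (trivialRight ε) (trivialLeft ε)

end Tor

-- The homology of each algebra is compared with that of `R C_n` by excision. A right ideal `X` of
-- an augmented algebra `A` is excisive if multiplying augmented projective resolutions by `X`
-- preserves exactness. Suppose the kernel `K` of a surjection `A → C` of augmented algebras is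
-- excisive, and let `P` be a projective resolution of `𝟙` over `A`. Then `P / K P` is a projective
-- resolution of `𝟙` over `C`. Since `𝟙 ⊗ -` takes coinvariants, and coinvariants can be taken in
-- two steps, `P` and `P / K P` give the same complex, so the Tor groups agree
-- (`nonempty_algebraHomology_iso`).
--
-- Excisive ideals come from two sources. A right ideal with a left unit is excisive
-- (`IsExcisive.of_idempotent`). There is also a Mayer–Vietoris rule: if `X`, `Y` and `X ⊓ Y` are
-- excisive and `X` lies in the augmentation ideal, then `X ⊔ Y` is excisive (`IsExcisive.sup`).
--
-- An annular diagram is a rotation or has a cup joining neighbouring unprimed vertices `a`, `a +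
-- 1`. Hence `J_n(δ) → R C_n` has as kernel the sum over `a` of the right ideals spanned by diagrams
-- with a cup at `a`. Their intersections prescribe a set `S` of cups, so an inclusion–exclusion
-- induction (`isExcisive_cups`) reduces the claim to finding a left unit for every `S`. Write `U_a`
-- for `cupCap a (a + 1)`. If `δ` is invertible, products of the elements `δ⁻¹ U_a` are left units.
-- Over `J_n(δ) / I_0` nothing is needed of `δ`: if some diagram with the cups `S` has a through
-- strand, then for some `a ∈ S` the vertex `a + 2` is on no cup of `S`, and the zigzag identity
-- `U_a U_{a+1} x = x` supplies the unit; otherwise the right ideal is zero in the quotient. If `n`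
-- is odd, every diagram has a through strand, so `I_0 = 0`.
--
-- It remains to see that `I_0`, defined by annular generators, contains every element of `J_n(δ)`
-- supported on diagrams without through strands. Annularity of composites is awkward to check
-- directly; it is replaced by the invariance of a crossing number modulo two (`IsParityPlanar`),
-- which composes easily and is equivalent to annularity in the absence of through strands.

universe u v

/-! ### Excisive right ideals -/

section Excision

variable {R : Type u} [CommRing R] {A : Type u} [Ring A] [Algebra R A]

/-- The additive subgroup `X M` of a left module `M`, for a right ideal `X`. -/
def rightIdealSMul (X : Submodule Aᵐᵒᵖ A) (M : Type v) [AddCommGroup M] [Module A M] :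
    AddSubgroup M :=
  AddSubgroup.closure {z | ∃ x ∈ X, ∃ m : M, z = x • m}

section

variable {M N : Type*} [AddCommGroup M] [Module A M] [AddCommGroup N] [Module A N]

theorem smul_mem_rightIdealSMul {X : Submodule Aᵐᵒᵖ A} {x : A} (hx : x ∈ X) (m : M) :
    x • m ∈ rightIdealSMul X M :=
  AddSubgroup.subset_closure ⟨x, hx, m, rfl⟩

theorem rightIdealSMul_le {X : Submodule Aᵐᵒᵖ A} {G : AddSubgroup M}
    (h : ∀ x ∈ X, ∀ m : M, x • m ∈ G) : rightIdealSMul X M ≤ G :=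
  (AddSubgroup.closure_le _).2 fun _ ⟨x, hx, m, hz⟩ => hz ▸ h x hx m

theorem rightIdealSMul_mono {X Y : Submodule Aᵐᵒᵖ A} (h : X ≤ Y) :
    rightIdealSMul X M ≤ rightIdealSMul Y M :=
  rightIdealSMul_le fun _ hx m => smul_mem_rightIdealSMul (h hx) m

theorem map_mem_rightIdealSMul {X : Submodule Aᵐᵒᵖ A} (f : M →ₗ[A] N) {z : M}
    (hz : z ∈ rightIdealSMul X M) : f z ∈ rightIdealSMul X N :=
  (rightIdealSMul_le (G := (rightIdealSMul X N).comap f.toAddMonoidHom) fun x hx m => by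
    change f (x • m) ∈ rightIdealSMul X N
    rw [map_smul]
    exact smul_mem_rightIdealSMul hx _) hz

theorem rightIdealSMul_sup (X Y : Submodule Aᵐᵒᵖ A) :
    rightIdealSMul (X ⊔ Y) M ≤ rightIdealSMul X M ⊔ rightIdealSMul Y M := by
  refine rightIdealSMul_le fun x hx m => ?_
  obtain ⟨a, ha, b, hb, rfl⟩ := Submodule.mem_sup.1 hx
  rw [add_smul]
  exact add_mem (AddSubgroup.mem_sup_left (smul_mem_rightIdealSMul ha m))
    (AddSubgroup.mem_sup_right (smul_mem_rightIdealSMul hb m))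

theorem smul_mem_of_mem_rightIdealSMul {X : Submodule Aᵐᵒᵖ A} {b : A}
    (hb : ∀ x ∈ X, b * x ∈ X) {z : M} (hz : z ∈ rightIdealSMul X M) :
    b • z ∈ rightIdealSMul X M :=
  (rightIdealSMul_le (G := (rightIdealSMul X M).comap (DistribSMul.toAddMonoidHom M b))
    fun x hx m => by
      change b • x • m ∈ rightIdealSMul X M
      rw [smul_smul]
      exact smul_mem_rightIdealSMul (hb x hx) _) hz

/-- A projective module is a retract of a free one, and in a free module the elements of `X M` are
those with all coordinates in `X`. One section serves all `X` at once, which is what intersections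
require. -/
theorem exists_section_mem_rightIdealSMul_iff [Module.Projective A M] :
    ∃ s : M →ₗ[A] M →₀ A, ∀ (X : Submodule Aᵐᵒᵖ A) (z : M),
      z ∈ rightIdealSMul X M ↔ ∀ j, s z j ∈ X := by
  obtain ⟨s, hs⟩ := (Module.projective_def (R := A) (P := M)).1 inferInstance
  refine ⟨s, fun X z => ⟨fun hz j => ?_, fun h => ?_⟩⟩
  · refine (rightIdealSMul_le (G := (X.toAddSubgroup).comap
      ((Finsupp.lapply j ∘ₗ s).toAddMonoidHom)) fun x hx m => ?_) hz
    change s (x • m) j ∈ X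
    rw [map_smul, Finsupp.smul_apply, smul_eq_mul]
    exact X.smul_mem (MulOpposite.op _) hx
  · rw [← hs z, Finsupp.linearCombination_apply]
    exact sum_mem fun j _ => smul_mem_rightIdealSMul (h j) _

theorem rightIdealSMul_inf [Module.Projective A M] (X Y : Submodule Aᵐᵒᵖ A) :
    rightIdealSMul X M ⊓ rightIdealSMul Y M ≤ rightIdealSMul (X ⊓ Y) M := by
  obtain ⟨s, hs⟩ := exists_section_mem_rightIdealSMul_iff (A := A) (M := M)
  rintro z ⟨hx, hy⟩
  exact (hs _ _).2 fun j => ⟨(hs _ _).1 hx j, (hs _ _).1 hy j⟩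

end

/-- A right ideal `X` of an augmented algebra is excisive if multiplication by `X` preserves the
exactness of augmented projective resolutions of modules killed by the augmentation ideal. -/
def IsExcisive (ε : A →ₐ[R] R) (X : Submodule Aᵐᵒᵖ A) : Prop :=
  ∀ (M : ℕ → ModuleCat.{u} A) (d : ∀ q, M (q + 1) →ₗ[A] M q), (∀ q z, d q (d (q + 1) z) = 0) →
    (∀ q z, d q z = 0 → ∃ w, d (q + 1) w = z) → (∀ q, Module.Projective A (M (q + 1))) →
    (∀ a, ε a = 0 → ∀ m : M 0, a • m = 0) →
    ∀ q, ∀ z ∈ rightIdealSMul X (M (q + 1)), d q z = 0 →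
      ∃ w ∈ rightIdealSMul X (M (q + 2)), d (q + 1) w = z

variable {ε : A →ₐ[R] R}

theorem IsExcisive.bot : IsExcisive ε (⊥ : Submodule Aᵐᵒᵖ A) := by
  intro M d _ _ _ _ q z hz _
  have h : rightIdealSMul (⊥ : Submodule Aᵐᵒᵖ A) (M (q + 1)) ≤ ⊥ := rightIdealSMul_le (by simp)
  obtain rfl : z = 0 := h hz
  exact ⟨0, zero_mem _, map_zero _⟩

/-- Multiplication by `e` commutes with the differentials, maps everything into `X M` and fixes `X
M`. So if `z = d w` lies in `X M`, then `z = e z = d (e w)`. -/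
theorem IsExcisive.of_idempotent {X : Submodule Aᵐᵒᵖ A} (e : A) (he : e ∈ X)
    (h : ∀ x ∈ X, e * x = x) : IsExcisive ε X := by
  intro M d _ hex _ _ q z hz hdz
  obtain ⟨w, rfl⟩ := hex q z hdz
  refine ⟨e • w, smul_mem_rightIdealSMul he w, ?_⟩
  rw [map_smul]
  have : rightIdealSMul X (M (q + 1)) ≤
      (DistribSMul.toAddMonoidHom (M (q + 1)) e).eqLocus (AddMonoidHom.id _) :=
    rightIdealSMul_le fun x hx m => by
      change e • x • m = x • m
      rw [smul_smul, h x hx]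
  exact this hz

/-- Mayer–Vietoris: split a cycle as `x + y`. Then `d x = -d y` is a cycle in `X M ∩ Y M = (X ∩ Y)
M`, hence equals `d v` with `v ∈ (X ∩ Y) M`. Now `x - v` and `y + v` are cycles to which the
hypotheses on `X` and `Y` apply. -/
theorem IsExcisive.sup {X Y : Submodule Aᵐᵒᵖ A} (hX : IsExcisive ε X) (hY : IsExcisive ε Y)
    (hXY : IsExcisive ε (X ⊓ Y)) (hεX : ∀ x ∈ X, ε x = 0) : IsExcisive ε (X ⊔ Y) := by
  intro M d hd hex hproj h0 q z hz hdz
  obtain ⟨x, hx, y, hy, rfl⟩ := AddSubgroup.mem_sup.1 (rightIdealSMul_sup X Y hz)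
  obtain ⟨v, hv, hdv⟩ : ∃ v ∈ rightIdealSMul (X ⊓ Y) (M (q + 1)), d q v = d q x := by
    have h1 := map_mem_rightIdealSMul (d q) hx
    have h2 : d q x ∈ rightIdealSMul Y (M q) := by
      rw [map_add] at hdz
      rw [eq_neg_of_add_eq_zero_left hdz]
      exact neg_mem (map_mem_rightIdealSMul (d q) hy)
    -- The bottom module is not projective, so the intersection formula is unavailable there;
    -- instead `X` lies in the augmentation ideal and kills it, so `v = 0` works.
    cases q with
    | zero =>
      have : rightIdealSMul X (M 0) ≤ ⊥ := rightIdealSMul_le fun x hx m => h0 x (hεX x hx) m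
      have h3 : d 0 x = 0 := this h1
      exact ⟨0, zero_mem _, by rw [map_zero, h3]⟩
    | succ q =>
      have := hproj q
      exact hXY M d hd hex hproj h0 q _ (rightIdealSMul_inf X Y ⟨h1, h2⟩) (hd _ _)
  obtain ⟨w₁, hw₁, h₁⟩ := hX M d hd hex hproj h0 q (x - v)
    (sub_mem hx (rightIdealSMul_mono inf_le_left hv)) (by rw [map_sub, hdv, sub_self])
  obtain ⟨w₂, hw₂, h₂⟩ := hY M d hd hex hproj h0 q (y + v)
    (add_mem hy (rightIdealSMul_mono inf_le_right hv))
    (by rw [map_add, hdv, add_comm, ← map_add, hdz])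
  exact ⟨w₁ + w₂, add_mem (rightIdealSMul_mono le_sup_left hw₁)
    (rightIdealSMul_mono le_sup_right hw₂), by rw [map_add, h₁, h₂]; abel⟩

end Excision

/-! ### Reduction of modules along a surjection of algebras -/

section QuotientFunctor

open CategoryTheory

variable {R : Type u} [CommRing R] {A C : Type u} [Ring A] [Algebra R A] [Ring C] [Algebra R C]

/-- The kernel of an algebra homomorphism, as a right ideal. -/
def rightKer (π : A →ₐ[R] C) : Submodule Aᵐᵒᵖ A where
  carrier := {a | π a = 0}
  add_mem' ha hb := by simp_all
  zero_mem' := map_zero π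
  smul_mem' c x hx := by
    change π (x * c.unop) = 0
    rw [map_mul, show π x = 0 from hx, zero_mul]

theorem mem_rightKer {π : A →ₐ[R] C} {a : A} : a ∈ rightKer π ↔ π a = 0 := Iff.rfl

/-- The submodule `K N`, where `K` is the kernel of `π`. -/
def kerSMul (π : A →ₐ[R] C) (N : Type v) [AddCommGroup N] [Module A N] : Submodule A N :=
  { rightIdealSMul (rightKer π) N with
    smul_mem' := fun b _ hz => smul_mem_of_mem_rightIdealSMul (X := rightKer π)
      (fun x hx => by rw [mem_rightKer, map_mul, mem_rightKer.1 hx, mul_zero]) hz }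

theorem smul_mem_kerSMul {π : A →ₐ[R] C} {N : Type v} [AddCommGroup N] [Module A N] {a : A}
    (ha : π a = 0) (m : N) : a • m ∈ kerSMul π N :=
  smul_mem_rightIdealSMul (X := rightKer π) ha m

variable {π : A →ₐ[R] C} (hπ : Function.Surjective π)

theorem smul_quotient_congr {a b : A} (h : π a = π b) {N : Type v} [AddCommGroup N] [Module A N]
    (x : N ⧸ kerSMul π N) : a • x = b • x := by
  induction x using Submodule.Quotient.induction_on with
  | H m =>
    rw [← Submodule.Quotient.mk_smul, ← Submodule.Quotient.mk_smul, Submodule.Quotient.eq,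
      ← sub_smul]
    exact smul_mem_kerSMul (by rw [map_sub, h, sub_self]) m

/-- The action of the target of a surjection `π` on `N / K N`, where `K` is the kernel of `π`. -/
@[reducible] noncomputable def quotientModule (N : Type v) [AddCommGroup N] [Module A N] :
    Module C (N ⧸ kerSMul π N) :=
  letI : SMul C (N ⧸ kerSMul π N) := ⟨fun c x => Function.surjInv hπ c • x⟩
  Function.Surjective.moduleLeft (π : A →+* C) hπ fun _ x =>
    smul_quotient_congr (Function.surjInv_eq hπ _) x

/-- The `C`-module `N / K N`. -/
noncomputable def quotientObj (N : ModuleCat.{u} A) : ModuleCat.{u} C :=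
  letI := quotientModule hπ N
  ModuleCat.of C (N ⧸ kerSMul π N)

/-- The projection `N → N / K N`. -/
noncomputable def toQuotientObj (N : ModuleCat.{u} A) : N →+ quotientObj hπ N :=
  (kerSMul π N).mkQ.toAddMonoidHom

theorem toQuotientObj_surjective (N : ModuleCat.{u} A) :
    Function.Surjective (toQuotientObj hπ N) :=
  Submodule.mkQ_surjective _

theorem toQuotientObj_eq_zero {N : ModuleCat.{u} A} {x : N} :
    toQuotientObj hπ N x = 0 ↔ x ∈ kerSMul π N :=
  Submodule.Quotient.mk_eq_zero _

theorem toQuotientObj_smul {N : ModuleCat.{u} A} (a : A) (x : N) :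
    toQuotientObj hπ N (a • x) = π a • toQuotientObj hπ N x :=
  smul_quotient_congr (a := a) (Function.surjInv_eq hπ _).symm
    (Submodule.Quotient.mk x : N ⧸ kerSMul π N)

/-- The additive map out of `N / K N` induced by an additive map that kills `K N`. -/
noncomputable def quotientObjLift {N : ModuleCat.{u} A} {B : Type*} [AddCommGroup B] (f : N →+ B)
    (h : ∀ a, π a = 0 → ∀ m : N, f (a • m) = 0) : quotientObj hπ N →+ B :=
  QuotientAddGroup.lift (kerSMul π N).toAddSubgroup f
    (rightIdealSMul_le (G := f.ker) h)

theorem quotientObjLift_apply {N : ModuleCat.{u} A} {B : Type*} [AddCommGroup B] (f : N →+ B)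
    (h : ∀ a, π a = 0 → ∀ m : N, f (a • m) = 0) (x : N) :
    quotientObjLift hπ f h (toQuotientObj hπ N x) = f x := rfl

/-- A `C`-linear map out of `N / K N`, given by a semilinear map out of `N`. -/
noncomputable def quotientObjDesc {N : ModuleCat.{u} A} {B : ModuleCat.{u} C} (f : N →+ B)
    (h : ∀ (a : A) (m : N), f (a • m) = π a • f m) : quotientObj hπ N ⟶ B :=
  ModuleCat.ofHom (X := quotientObj hπ N) (Y := B)
    { toFun := quotientObjLift hπ f fun a ha m => by rw [h, ha, zero_smul]
      map_add' := map_add _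
      map_smul' := fun c x => by
        obtain ⟨a, rfl⟩ := hπ c
        obtain ⟨x, rfl⟩ := toQuotientObj_surjective hπ N x
        change quotientObjLift hπ f _ (π a • _) = π a • quotientObjLift hπ f _ _
        rw [← toQuotientObj_smul, quotientObjLift_apply, quotientObjLift_apply, h] }

theorem quotientObj_hom_ext {N : ModuleCat.{u} A} {B : ModuleCat.{u} C}
    {f g : quotientObj hπ N ⟶ B}
    (h : ∀ x, f.hom (toQuotientObj hπ N x) = g.hom (toQuotientObj hπ N x)) : f = g := by
  refine ModuleCat.hom_ext (LinearMap.ext fun x => ?_)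
  obtain ⟨x, rfl⟩ := toQuotientObj_surjective hπ N x
  exact h x

/-- The functor `N ↦ N / K N` from `A`-modules to `C`-modules. -/
noncomputable def quotientFunctor : ModuleCat.{u} A ⥤ ModuleCat.{u} C where
  obj N := quotientObj hπ N
  map {N N'} f := quotientObjDesc hπ ((toQuotientObj hπ N').comp f.hom.toAddMonoidHom)
    fun a m => by
      change toQuotientObj hπ N' (f.hom (a • m)) = π a • toQuotientObj hπ N' (f.hom m)
      rw [map_smul, toQuotientObj_smul]
  map_id N := quotientObj_hom_ext hπ fun x => rfl
  map_comp f g := quotientObj_hom_ext hπ fun x => rfl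

theorem quotientFunctor_map_apply {N N' : ModuleCat.{u} A} (f : N ⟶ N') (x : N) :
    ((quotientFunctor hπ).map f).hom (toQuotientObj hπ N x) = toQuotientObj hπ N' (f.hom x) :=
  rfl

instance : (quotientFunctor hπ).Additive where
  map_add {_ N' f g} := quotientObj_hom_ext hπ fun x =>
    map_add (toQuotientObj hπ N') (f.hom x) (g.hom x)

/-- Maps of `C`-modules out of `N / K N` are maps of `A`-modules out of `N` into the restriction
along `π`, and restriction preserves surjections; so lifting problems transfer to `N`. -/
theorem projective_quotientObj {N : ModuleCat.{u} A} (hN : Projective N) :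
    Projective (quotientObj hπ N) := by
  constructor
  intro E X f e he
  have hs : Function.Surjective e.hom := (ModuleCat.epi_iff_surjective e).1 he
  let resE := (ModuleCat.restrictScalars (π : A →+* C)).map e
  have : Epi resE := (ModuleCat.epi_iff_surjective resE).2 hs
  let f' : N ⟶ (ModuleCat.restrictScalars (π : A →+* C)).obj X :=
    ModuleCat.ofHom (Y := (ModuleCat.restrictScalars (π : A →+* C)).obj X)
      { toFun := fun m => f.hom (toQuotientObj hπ N m)
        map_add' := fun x y => by rw [map_add, map_add]; rfl
        map_smul' := fun a x => by
          rw [toQuotientObj_smul, map_smul]; rfl }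
  obtain ⟨g, hg⟩ := hN.factors f' resE
  refine ⟨quotientObjDesc hπ (B := E) g.hom.toAddMonoidHom fun a m => g.hom.map_smul a m,
    quotientObj_hom_ext hπ fun x => ?_⟩
  exact congrArg (fun k => k.hom x) hg

end QuotientFunctor

/-! ### Tensoring with the trivial module as coinvariants -/

section Coinvariants

open CategoryTheory TensorProduct

section Generic

variable {R : Type u} [CommRing R] {A : Type u} [Ring A] {T N : Type u} [AddCommGroup T]
  [Module R T] [Module Aᵐᵒᵖ T] [AddCommGroup N] [Module R N] [Module A N] (τ : T ≃ₗ[R] R)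

/-- The map `x ↦ 1 ⊗ x`. -/
noncomputable def coinvariantsMk : N →+ BalancedTensor R A T N :=
  ((balancingRelations R A T N).mkQ ∘ₗ TensorProduct.mk R T N (τ.symm 1)).toAddMonoidHom

theorem coinvariantsMk_apply (x : N) : coinvariantsMk (A := A) τ x =
    Submodule.Quotient.mk (τ.symm 1 ⊗ₜ[R] x) := rfl

theorem coinvariantsMk_smul [Algebra R A] {ε : A →ₐ[R] R}
    (hτ : ∀ a t, τ (MulOpposite.op a • t) = ε a * τ t) (a : A) (x : N) :
    coinvariantsMk (A := A) τ (a • x) = ε a • coinvariantsMk (A := A) τ x := by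
  have h : ε a • τ.symm 1 = MulOpposite.op a • τ.symm 1 := τ.injective (by
    rw [hτ, map_smul, smul_eq_mul])
  rw [coinvariantsMk_apply, coinvariantsMk_apply, ← Submodule.Quotient.mk_smul,
    TensorProduct.smul_tmul', h]
  refine ((Submodule.Quotient.eq (balancingRelations R A T N)).2 ?_).symm
  exact Submodule.subset_span ⟨_, a, x, rfl⟩

theorem smul_coinvariantsMk (t : T) (x : N) :
    τ t • coinvariantsMk (A := A) τ x = Submodule.Quotient.mk (t ⊗ₜ[R] x) := by
  rw [coinvariantsMk_apply, ← Submodule.Quotient.mk_smul, TensorProduct.smul_tmul', ← map_smul,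
    smul_eq_mul, mul_one, LinearEquiv.symm_apply_apply]

end Generic

variable {R : Type u} [CommRing R] {A C : Type u} [Ring A] [Algebra R A] [Ring C] [Algebra R C]
  (ε : A →ₐ[R] R)

theorem augmentation_surjective : Function.Surjective ε := fun r =>
  ⟨algebraMap R A r, ε.commutes r⟩

/-- A linear map into an object of `ModuleCat`, as a morphism. -/
noncomputable def linearMapToHom {X : Type u} [AddCommGroup X] [Module R X] {B : ModuleCat.{u} R}
    (f : X →ₗ[R] B) : ModuleCat.of R X ⟶ B :=
  ModuleCat.ofHom (Y := B) f

section Generic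

variable {ε} {T N B : Type u} [AddCommGroup T] [Module R T] [Module Aᵐᵒᵖ T] [AddCommGroup N]
  [Module R N] [Module A N] [IsScalarTower R A N] [AddCommGroup B] [Module R B]
  (τ : T ≃ₗ[R] R) (hτ : ∀ a t, τ (MulOpposite.op a • t) = ε a * τ t)

/-- The linear map out of `𝟙 ⊗_A N` induced by a map that factors through the coinvariants. -/
noncomputable def coinvariantsLift (φ : N →+ B) (hφ : ∀ a x, φ (a • x) = ε a • φ x) :
    BalancedTensor R A T N →ₗ[R] B :=
  Submodule.liftQ _ (TensorProduct.lift (LinearMap.mk₂ R (fun t x => τ t • φ x)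
    (fun s t x => by rw [map_add, add_smul])
    (fun r t x => by rw [map_smul, smul_eq_mul, mul_smul])
    (fun t x y => by rw [map_add, smul_add])
    (fun r t x => by
      rw [← algebraMap_smul A r x, hφ, AlgHom.commutes, Algebra.algebraMap_self_apply, smul_comm])))
  (by
    rw [balancingRelations, Submodule.span_le]
    rintro _ ⟨t, a, x, rfl⟩
    rw [SetLike.mem_coe, LinearMap.mem_ker, map_sub, TensorProduct.lift.tmul,
      TensorProduct.lift.tmul, sub_eq_zero, LinearMap.mk₂_apply, LinearMap.mk₂_apply, hτ, hφ,
      smul_smul, mul_comm])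

end Generic

section

attribute [local instance] algebraModule algebraModule_isScalarTower

/-- The trivial right module is free of rank one over `R`. -/
noncomputable def trivialRightEquiv : trivialRight ε ≃ₗ[R] R :=
  { AddEquiv.refl R with
    map_smul' := fun r t => by
      change (ε.fromOpposite fun _ _ => Commute.all _ _) (algebraMap R Aᵐᵒᵖ r) * _ = r * _
      rw [AlgHom.commutes]; rfl }

theorem trivialRightEquiv_smul (a : A) (t : trivialRight ε) :
    trivialRightEquiv ε (MulOpposite.op a • t) = ε a * trivialRightEquiv ε t := rfl

/-- The map `𝟙 ⊗_A N → N / I N`, where `I` is the augmentation ideal. -/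
noncomputable def coinvariantsHom (N : ModuleCat.{u} A) :
    (tensorFunctor R (trivialRight ε)).obj N ⟶ quotientObj (augmentation_surjective ε) N :=
  linearMapToHom (B := quotientObj (augmentation_surjective ε) N)
    -- The target is a module over `R` itself, so the local instance `algebraModule` offers a second
    -- `R`-structure on it; the explicit arguments select its own structure.
    (@coinvariantsLift R _ A _ _ ε (trivialRight ε) N
    (quotientObj (augmentation_surjective ε) N) _ _ _ _ _ _ _ _
    (quotientObj (augmentation_surjective ε) N).isModule (trivialRightEquiv ε)
    (trivialRightEquiv_smul ε) (toQuotientObj (augmentation_surjective ε) N)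
    (toQuotientObj_smul (augmentation_surjective ε)))

/-- The map `N / I N → 𝟙 ⊗_A N`, where `I` is the augmentation ideal. -/
noncomputable def coinvariantsInv (N : ModuleCat.{u} A) :
    quotientObj (augmentation_surjective ε) N ⟶ (tensorFunctor R (trivialRight ε)).obj N :=
  quotientObjDesc (B := (tensorFunctor R (trivialRight ε)).obj N) (augmentation_surjective ε)
    (coinvariantsMk (A := A) (N := N) (trivialRightEquiv ε))
    (coinvariantsMk_smul (trivialRightEquiv ε) (trivialRightEquiv_smul ε))

/-- The functor `𝟙 ⊗_A -` takes the coinvariants of a module. -/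
noncomputable def coinvariantsIso :
    tensorFunctor R (trivialRight ε) ≅ quotientFunctor (augmentation_surjective ε) :=
  NatIso.ofComponents
    (fun N =>
      { hom := coinvariantsHom ε N
        inv := coinvariantsInv ε N
        hom_inv_id := by
          refine ModuleCat.hom_ext (Submodule.linearMap_qext _ (TensorProduct.ext' fun t x => ?_))
          exact ((coinvariantsInv ε N).hom.map_smul (trivialRightEquiv ε t)
            (toQuotientObj (augmentation_surjective ε) N x)).trans
            (smul_coinvariantsMk (A := A) (N := N) (trivialRightEquiv ε) t x)
        inv_hom_id := quotientObj_hom_ext _ fun x =>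
          one_smul R (toQuotientObj (augmentation_surjective ε) N x) })
    (fun {N N'} f => by
      refine ModuleCat.hom_ext (Submodule.linearMap_qext _ (TensorProduct.ext' fun t x => ?_))
      exact (((quotientFunctor (augmentation_surjective ε)).map f).hom.map_smul
        (trivialRightEquiv ε t) (toQuotientObj (augmentation_surjective ε) N x)).symm)

end

variable {ε} {π : A →ₐ[R] C} (hπ : Function.Surjective π) {ε' : C →ₐ[R] R}

/-- Coinvariants can be computed in two steps. -/
noncomputable def quotientFunctorComp (hε : ε'.comp π = ε) :
    quotientFunctor hπ ⋙ quotientFunctor (augmentation_surjective ε') ≅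
      quotientFunctor (augmentation_surjective ε) :=
  have h (a : A) : ε' (π a) = ε a := DFunLike.congr_fun hε a
  NatIso.ofComponents
    (fun N =>
      { hom := quotientObjDesc (N := quotientObj hπ N)
          (B := quotientObj (augmentation_surjective ε) N) _
          (quotientObjLift hπ (toQuotientObj (augmentation_surjective ε) N) fun a ha m => by
            rw [toQuotientObj_smul, ← h, ha, map_zero, zero_smul]) fun c x => by
            obtain ⟨a, rfl⟩ := hπ c
            obtain ⟨x, rfl⟩ := toQuotientObj_surjective hπ N x
            rw [← toQuotientObj_smul, quotientObjLift_apply, quotientObjLift_apply,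
              toQuotientObj_smul, h]
        inv := quotientObjDesc
          (B := quotientObj (augmentation_surjective ε') (quotientObj hπ N)) _
          ((toQuotientObj (augmentation_surjective ε') (quotientObj hπ N)).comp
            (toQuotientObj hπ N)) fun a x => by
            rw [AddMonoidHom.comp_apply, toQuotientObj_smul, toQuotientObj_smul, h]; rfl
        hom_inv_id := quotientObj_hom_ext (N := quotientObj hπ N)
            (B := quotientObj (augmentation_surjective ε') (quotientObj hπ N)) _ fun x => by
          obtain ⟨x, rfl⟩ := toQuotientObj_surjective hπ N x
          rfl
        inv_hom_id := quotientObj_hom_ext _ fun x => rfl })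
    (fun {N N'} f => quotientObj_hom_ext (N := quotientObj hπ N)
        (B := quotientObj (augmentation_surjective ε) N') _ fun x => by
      obtain ⟨x, rfl⟩ := toQuotientObj_surjective hπ N x
      rfl)

end Coinvariants

/-! ### Comparison of Tor along an excisive surjection -/

section ExcisionTheorem

open CategoryTheory

variable {R : Type u} [CommRing R] {A C : Type u} [Ring A] [Algebra R A] [Ring C] [Algebra R C]
  {ε : A →ₐ[R] R} {ε' : C →ₐ[R] R} {π : A →ₐ[R] C} (hπ : Function.Surjective π)

section

variable (P : ProjectiveResolution (trivialLeft ε))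

/-- The augmentation of a resolution of the trivial module. -/
noncomputable def resolutionAugmentation : P.complex.X 0 ⟶ trivialLeft ε :=
  (ChainComplex.toSingle₀Equiv _ _ P.π).1

theorem d_resolutionAugmentation : P.complex.d 1 0 ≫ resolutionAugmentation P = 0 :=
  (ChainComplex.toSingle₀Equiv _ _ P.π).2

theorem resolutionAugmentation_surjective :
    Function.Surjective (resolutionAugmentation P).hom :=
  (ModuleCat.epi_iff_surjective _).1 (inferInstanceAs (Epi (P.π.f 0)))

theorem exists_of_resolutionAugmentation_eq_zero (z : P.complex.X 0)
    (hz : (resolutionAugmentation P).hom z = 0) : ∃ w, (P.complex.d 1 0).hom w = z :=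
  (ShortComplex.moduleCat_exact_iff _).1 P.exact₀ z hz

theorem exists_of_d_eq_zero (q : ℕ) (z : P.complex.X (q + 1))
    (hz : (P.complex.d (q + 1) q).hom z = 0) : ∃ w, (P.complex.d (q + 2) (q + 1)).hom w = z :=
  (ShortComplex.moduleCat_exact_iff _).1 (P.exact_succ q) z hz

/-- The terms of the augmented resolution. -/
noncomputable def augmentedX : ℕ → ModuleCat.{u} A
  | 0 => trivialLeft ε
  | q + 1 => P.complex.X q

/-- The differentials of the augmented resolution. -/
noncomputable def augmentedD : ∀ q, augmentedX P (q + 1) →ₗ[A] augmentedX P q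
  | 0 => (resolutionAugmentation P).hom
  | q + 1 => (P.complex.d (q + 1) q).hom

theorem IsExcisive.augmented {X : Submodule Aᵐᵒᵖ A} (hX : IsExcisive ε X) (q : ℕ)
    (z : augmentedX P (q + 1)) (hz : z ∈ rightIdealSMul X (augmentedX P (q + 1)))
    (hdz : augmentedD P q z = 0) :
    ∃ w ∈ rightIdealSMul X (augmentedX P (q + 2)), augmentedD P (q + 1) w = z := by
  refine hX (augmentedX P) (augmentedD P) ?_ ?_ ?_ ?_ q z hz hdz
  · rintro (_ | q) z
    · exact congrArg (fun f => f.hom z) (d_resolutionAugmentation P)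
    · exact congrArg (fun f => f.hom z) (P.complex.d_comp_d (q + 2) (q + 1) q)
  · rintro (_ | q) z hz
    · exact exists_of_resolutionAugmentation_eq_zero P z hz
    · exact exists_of_d_eq_zero P q z hz
  · exact fun q => (IsProjective.iff_projective (P.complex.X q)).2 (P.projective q)
  · intro a ha m
    change ε a * (show R from m) = (0 : R)
    rw [ha, zero_mul]

/-- The augmentation of the quotient of a resolution. -/
noncomputable def quotientAugmentation (hε : ε'.comp π = ε) :
    quotientObj hπ (P.complex.X 0) ⟶ trivialLeft ε' :=
  quotientObjDesc hπ (B := trivialLeft ε') (resolutionAugmentation P).hom.toAddMonoidHom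
    fun a m => by
      change (resolutionAugmentation P).hom (a • m) = _
      rw [map_smul]
      exact congrArg (fun r : R => r * (show R from (resolutionAugmentation P).hom m))
        (DFunLike.congr_fun hε a).symm

end

/-- Excision plays no role here: the trivial module is already killed by `K`, so a representative of
a cycle is itself a cycle in the original resolution. -/
theorem quotient_exact_zero (hε : ε'.comp π = ε)
    (P : ProjectiveResolution (trivialLeft ε)) (z : quotientObj hπ (P.complex.X 0))
    (hz : (quotientAugmentation hπ P hε).hom z = 0) :
    ∃ w, ((quotientFunctor hπ).map (P.complex.d 1 0)).hom w = z := by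
  obtain ⟨z, rfl⟩ := toQuotientObj_surjective hπ _ z
  obtain ⟨w, hw⟩ := exists_of_resolutionAugmentation_eq_zero P z hz
  exact ⟨toQuotientObj hπ _ w, by rw [quotientFunctor_map_apply, hw]⟩

/-- A cycle modulo `K` has a representative `z` with `d z` in `K P`. By excision `d z = d k` with
`k` in `K P`, so `z - k` is a genuine cycle, hence a boundary, and it represents the same class. -/
theorem quotient_exact_succ (hK : IsExcisive ε (rightKer π))
    (P : ProjectiveResolution (trivialLeft ε)) (q : ℕ) (z : quotientObj hπ (P.complex.X (q + 1)))
    (hz : ((quotientFunctor hπ).map (P.complex.d (q + 1) q)).hom z = 0) :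
    ∃ w, ((quotientFunctor hπ).map (P.complex.d (q + 2) (q + 1))).hom w = z := by
  obtain ⟨z, rfl⟩ := toQuotientObj_surjective hπ _ z
  have h1 : (P.complex.d (q + 1) q).hom z ∈ kerSMul π (P.complex.X q) :=
    (toQuotientObj_eq_zero hπ).1 hz
  -- The term `P.complex.X q` has degree `q + 1` in the augmented complex; for `q = 0` the boundary
  -- `d z` is a cycle there because the augmentation kills it.
  obtain ⟨k, hk, hdk⟩ : ∃ k ∈ kerSMul π (P.complex.X (q + 1)),
      (P.complex.d (q + 1) q).hom k = (P.complex.d (q + 1) q).hom z :=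
      hK.augmented P q ((P.complex.d (q + 1) q).hom z) h1 (by
    cases q with
    | zero => exact congrArg (fun f => f.hom z) (d_resolutionAugmentation P)
    | succ q => exact congrArg (fun f => f.hom z) (P.complex.d_comp_d (q + 2) (q + 1) q))
  obtain ⟨w, hw⟩ := exists_of_d_eq_zero P q (z - k) (by rw [map_sub, hdk, sub_self])
  refine ⟨toQuotientObj hπ _ w, ?_⟩
  rw [quotientFunctor_map_apply, hw, map_sub, (toQuotientObj_eq_zero hπ).2 hk]
  exact sub_zero (toQuotientObj hπ (P.complex.X (q + 1)) z)

/-- The augmentation of the quotient of a resolution, as a quasi-isomorphism. -/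
noncomputable def quotientResolutionπ (hε : ε'.comp π = ε)
    (P : ProjectiveResolution (trivialLeft ε)) :
    ((quotientFunctor hπ).mapHomologicalComplex _).obj P.complex ⟶
      (ChainComplex.single₀ _).obj (trivialLeft ε') :=
  (ChainComplex.toSingle₀Equiv _ _).symm ⟨quotientAugmentation hπ P hε,
    quotientObj_hom_ext hπ fun x => congrArg (fun f => f.hom x) (d_resolutionAugmentation P)⟩

theorem quotientResolutionπ_f_zero (hε : ε'.comp π = ε)
    (P : ProjectiveResolution (trivialLeft ε)) :
    (quotientResolutionπ hπ hε P).f 0 = quotientAugmentation hπ P hε :=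
  ChainComplex.toSingle₀Equiv_symm_apply_f_zero _ _

theorem quotientResolutionπ_f_zero_apply (hε : ε'.comp π = ε)
    (P : ProjectiveResolution (trivialLeft ε)) (x : quotientObj hπ (P.complex.X 0)) :
    ((quotientResolutionπ hπ hε P).f 0).hom x = (quotientAugmentation hπ P hε).hom x :=
  congrArg (fun f : quotientObj hπ (P.complex.X 0) ⟶ trivialLeft ε' => f.hom x)
    (quotientResolutionπ_f_zero hπ hε P)

theorem quasiIso_quotientResolutionπ (hε : ε'.comp π = ε) (hK : IsExcisive ε (rightKer π))
    (P : ProjectiveResolution (trivialLeft ε)) : QuasiIso (quotientResolutionπ hπ hε P) :=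
  ⟨fun q => by
    cases q with
    | zero =>
      have h0 : ¬ (ComplexShape.down ℕ).Rel 0 0 := by simp
      rw [ChainComplex.quasiIsoAt₀_iff, ShortComplex.quasiIso_iff_of_zeros'
        (hg₁ := HomologicalComplex.shape
          (((quotientFunctor hπ).mapHomologicalComplex (ComplexShape.down ℕ)).obj P.complex) 0 0 h0)
        (hf₂ := HomologicalComplex.single_obj_d (c := ComplexShape.down ℕ) ..)
        (hg₂ := HomologicalComplex.single_obj_d (c := ComplexShape.down ℕ) ..)]
      constructor
      · rw [ShortComplex.moduleCat_exact_iff]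
        exact fun z hz => quotient_exact_zero hπ hε P z
          ((quotientResolutionπ_f_zero_apply hπ hε P z).symm.trans hz)
      · refine (ModuleCat.epi_iff_surjective _).2 fun r => ?_
        obtain ⟨x, hx⟩ := resolutionAugmentation_surjective P r
        exact ⟨toQuotientObj hπ _ x, (quotientResolutionπ_f_zero_apply hπ hε P _).trans hx⟩
    | succ q =>
      rw [quasiIsoAt_iff_exactAt' _ _ (ChainComplex.exactAt_succ_single_obj _ _),
        HomologicalComplex.exactAt_iff' _ (q + 2) (q + 1) q (by simp) (by simp),
        ShortComplex.moduleCat_exact_iff]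
      exact fun z hz => quotient_exact_succ hπ hK P q z hz⟩

/-- The quotient of a projective resolution of the trivial module by an excisive ideal. -/
noncomputable def quotientResolution (hε : ε'.comp π = ε) (hK : IsExcisive ε (rightKer π))
    (P : ProjectiveResolution (trivialLeft ε)) : ProjectiveResolution (trivialLeft ε') where
  complex := ((quotientFunctor hπ).mapHomologicalComplex _).obj P.complex
  projective q := projective_quotientObj hπ (P.projective q)
  π := quotientResolutionπ hπ hε P
  quasiIso := quasiIso_quotientResolutionπ hπ hε hK P

-- The complexes `𝟙 ⊗_A P` and `𝟙 ⊗_C (P / K P)` are isomorphic, and the latter computes Tor over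
-- `C` because `P / K P` is again a projective resolution.
include hπ in
theorem nonempty_algebraHomology_iso (hε : ε'.comp π = ε) (hK : IsExcisive ε (rightKer π))
    (q : ℕ) : Nonempty (algebraHomology ε q ≅ algebraHomology ε' q) := by
  let P : ProjectiveResolution (trivialLeft ε) := ProjectiveResolution.of _
  let F := tensorFunctor R (trivialRight ε')
  let e : tensorFunctor R (trivialRight ε) ≅ quotientFunctor hπ ⋙ F :=
    coinvariantsIso ε ≪≫ (quotientFunctorComp hπ hε).symm ≪≫
      Functor.isoWhiskerLeft (quotientFunctor hπ) (coinvariantsIso ε').symm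
  let i₁ := P.isoLeftDerivedObj (tensorFunctor R (trivialRight ε)) q
  let i₂ := (HomologicalComplex.homologyFunctor _ _ q).mapIso
      ((NatIso.mapHomologicalComplex e (ComplexShape.down ℕ)).app P.complex)
  let i₃ := (quotientResolution hπ hε hK P).isoLeftDerivedObj F q
  let i₄ : (F.mapHomologicalComplex (ComplexShape.down ℕ)).obj
        (quotientResolution hπ hε hK P).complex ≅
      ((quotientFunctor hπ ⋙ F).mapHomologicalComplex (ComplexShape.down ℕ)).obj P.complex :=
    Iso.refl _
  exact ⟨i₁ ≪≫ i₂ ≪≫ ((HomologicalComplex.homologyFunctor _ _ q).mapIso i₄).symm ≪≫ i₃.symm⟩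

end ExcisionTheorem

/-! ### Composition of diagrams, cup-caps and zigzags -/

namespace BrauerDiagram

variable {n : ℕ}

/-- All parts have two elements, so an inclusion between parts is an equality. This halves the work
in every identification of a composite. -/
theorem eq_of_le {d e : BrauerDiagram n} (h : d.parts ≤ e.parts) : d = e := by
  ext x y
  have : {y | d.parts x y} = {y | e.parts x y} :=
    Set.eq_of_subset_of_ncard_le (fun y hy => h hy) (by rw [d.ncard_part, e.ncard_part])
      (Set.toFinite _)
  exact Set.ext_iff.1 this y

theorem comp_left {d : BrauerDiagram n} (e : BrauerDiagram n) {i j : Fin n}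
    (h : d.parts (.inl i) (.inl j)) : (comp d e).parts (.inl i) (.inl j) :=
  stack_left (e := e) h

theorem comp_right (d : BrauerDiagram n) {e : BrauerDiagram n} {i j : Fin n}
    (h : e.parts (.inr i) (.inr j)) : (comp d e).parts (.inr i) (.inr j) :=
  stack_right (d := d) h

theorem comp_through {d e : BrauerDiagram n} {i j k : Fin n} (hd : d.parts (.inl i) (.inr j))
    (he : e.parts (.inl j) (.inr k)) : (comp d e).parts (.inl i) (.inr k) :=
  (stack d e).trans (stack_left hd) (stack_right he)

theorem comp_left_of_through {d e : BrauerDiagram n} {i j a b : Fin n}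
    (hi : d.parts (.inl i) (.inr a)) (hj : d.parts (.inl j) (.inr b))
    (he : e.parts (.inl a) (.inl b)) : (comp d e).parts (.inl i) (.inl j) :=
  (stack d e).trans (stack_left hi)
    ((stack d e).trans (stack_right he) ((stack d e).symm (stack_left hj)))

theorem loops_eq_zero_of_forall {d e : BrauerDiagram n}
    (h : ∀ j : Fin n, ∃ x, stack d e (outerIncl x) (.inr (.inl j))) : loops d e = 0 := by
  rw [loops, Nat.card_eq_zero]
  left
  constructor
  rintro ⟨c, hc⟩
  induction c using Quotient.ind with
  | _ v =>
    rcases v with i | j | k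
    · exact hc (.inl i) rfl
    · obtain ⟨x, hx⟩ := h j
      exact hc x (Quotient.sound hx)
    · exact hc (.inr k) rfl

/-- The partner in `d` of an unprimed vertex is again unprimed, and such parts survive in the
composite. -/
theorem HasNoThrough.comp_left {d : BrauerDiagram n} (hd : d.HasNoThrough) (e : BrauerDiagram n) :
    (comp d e).HasNoThrough := by
  intro i k hk
  obtain ⟨τ, _, t2, t3⟩ := d.exists_partner
  have hp : d.parts (.inl i) (τ (.inl i)) := (t3 _ _).2 (Or.inr rfl)
  rcases hq : τ (.inl i) with i' | j
  · rw [hq] at hp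
    have := (comp d e).eq_of_parts (BrauerDiagram.comp_left e hp) hk
      (fun h => t2 _ (hq.trans h)) (by simp)
    simp at this
  · exact hd i j (hq ▸ hp)

theorem HasNoThrough.comp_right (d : BrauerDiagram n) {e : BrauerDiagram n}
    (he : e.HasNoThrough) : (comp d e).HasNoThrough := by
  intro i k hk
  obtain ⟨τ, _, t2, t3⟩ := e.exists_partner
  have hp : e.parts (.inr k) (τ (.inr k)) := (t3 _ _).2 (Or.inr rfl)
  rcases hq : τ (.inr k) with j | k'
  · exact he j k (e.parts.symm (hq ▸ hp))
  · rw [hq] at hp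
    have := (comp d e).eq_of_parts (BrauerDiagram.comp_right d hp) ((comp d e).parts.symm hk)
      (fun h => t2 _ (hq.trans h)) (by simp)
    simp at this

/-- The diagram whose parts are the orbits of a fixed-point free involution. -/
def ofInvolutive (τ : Fin n ⊕ Fin n → Fin n ⊕ Fin n) (h₁ : Function.Involutive τ)
    (h₂ : ∀ x, τ x ≠ x) : BrauerDiagram n where
  parts :=
    { r := fun x y => y = x ∨ y = τ x
      iseqv :=
        { refl := fun _ => Or.inl rfl
          symm := by
            rintro x y (rfl | rfl)
            · exact Or.inl rfl
            · exact Or.inr (h₁ x).symm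
          trans := by
            rintro x y z (rfl | rfl) (rfl | rfl)
            · exact Or.inl rfl
            · exact Or.inr rfl
            · exact Or.inr rfl
            · exact Or.inl (h₁ x) } }
  ncard_part x := Set.ncard_pair (h₂ x).symm

/-- The involution of the cup-cap diagram joining `a` and `b` on both sides. -/
def cupCapInvolution (a b : Fin n) : Fin n ⊕ Fin n → Fin n ⊕ Fin n
  | .inl i => if Equiv.swap a b i = i then .inr i else .inl (Equiv.swap a b i)
  | .inr i => if Equiv.swap a b i = i then .inl i else .inr (Equiv.swap a b i)

/-- The diagram that joins `a` and `b` on both sides and every other vertex to its opposite. -/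
def cupCap (a b : Fin n) : BrauerDiagram n :=
  ofInvolutive (cupCapInvolution a b)
    (by
      rintro (i | i) <;> by_cases h : Equiv.swap a b i = i <;> simp [cupCapInvolution, h]
      all_goals exact fun h' => h h'.symm)
    (by rintro (i | i) <;> by_cases h : Equiv.swap a b i = i <;> simp [cupCapInvolution, h])

theorem cupCap_left {a b : Fin n} (h : a ≠ b) : (cupCap a b).parts (.inl a) (.inl b) :=
  Or.inr (by simp [cupCapInvolution, h.symm])

theorem cupCap_right {a b : Fin n} (h : a ≠ b) : (cupCap a b).parts (.inr a) (.inr b) :=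
  Or.inr (by simp [cupCapInvolution, h.symm])

theorem cupCap_through {a b i : Fin n} (ha : i ≠ a) (hb : i ≠ b) :
    (cupCap a b).parts (.inl i) (.inr i) :=
  Or.inr (by simp [cupCapInvolution, Equiv.swap_apply_of_ne_of_ne ha hb])

theorem cupCap_comp_left {a b i j : Fin n} {x : BrauerDiagram n} (h : x.parts (.inl i) (.inl j))
    (hi : i ≠ a ∧ i ≠ b) (hj : j ≠ a ∧ j ≠ b) : (comp (cupCap a b) x).parts (.inl i) (.inl j) :=
  comp_left_of_through (cupCap_through hi.1 hi.2) (cupCap_through hj.1 hj.2) h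

/-- The part `{a, b}` is supplied by `d` itself; every other vertex of the composite is connected to
its copy in `x`, so the remaining parts are those of `x`. -/
theorem comp_eq_self_of {d x : BrauerDiagram n} {a b : Fin n} (hx : x.parts (.inl a) (.inl b))
    (hab : a ≠ b) (hd : d.parts (.inl a) (.inl b))
    (h : ∀ i, i ≠ a → i ≠ b → stack d x (outerIncl (.inl i)) (rightIncl (.inl i))) :
    comp d x = x := by
  symm
  apply eq_of_le
  have h' : ∀ p, p ≠ .inl a → p ≠ .inl b → stack d x (outerIncl p) (rightIncl p) := by
    rintro (i | k) h1 h2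
    · exact h i (by simpa using h1) (by simpa using h2)
    · exact (stack d x).refl _
  have key : ∀ p q, x.parts p q → p ≠ .inl a → p ≠ .inl b → (comp d x).parts p q := by
    intro p q hpq h1 h2
    have h3 : q ≠ .inl a := by
      rintro rfl
      exact h2 (x.eq_of_parts (x.parts.symm hpq) hx h1 (by simpa using hab.symm))
    have h4 : q ≠ .inl b := by
      rintro rfl
      exact h1 (x.eq_of_parts (x.parts.symm hpq) (x.parts.symm hx) h2 (by simpa using hab))
    exact (stack d x).trans (h' p h1 h2)
      ((stack d x).trans (stack_right hpq) ((stack d x).symm (h' q h3 h4)))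
  intro p q hpq
  by_cases h1 : p = .inl a
  · subst h1
    by_cases h2 : q = .inl a
    · subst h2; exact (comp d x).parts.refl _
    · obtain rfl := x.eq_of_parts hpq hx h2 (by simpa using hab.symm)
      exact comp_left x hd
  · by_cases h2 : p = .inl b
    · subst h2
      by_cases h3 : q = .inl b
      · subst h3; exact (comp d x).parts.refl _
      · obtain rfl := x.eq_of_parts hpq (x.parts.symm hx) h3 (by simpa using hab)
        exact (comp d x).parts.symm (comp_left x hd)
    · exact key p q hpq h1 h2

theorem cupCap_comp_self {a b : Fin n} (hab : a ≠ b) {x : BrauerDiagram n}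
    (hx : x.parts (.inl a) (.inl b)) : comp (cupCap a b) x = x :=
  comp_eq_self_of hx hab (cupCap_left hab) fun _ h1 h2 => stack_left (cupCap_through h1 h2)

/-- The middle vertices `a` and `b` close up to a single loop, while all other middle vertices are
joined to the left column. -/
theorem loops_cupCap_self {a b : Fin n} (hab : a ≠ b) {x : BrauerDiagram n}
    (hx : x.parts (.inl a) (.inl b)) : loops (cupCap a b) x = 1 := by
  -- The candidate loop; being constant on the parts of both diagrams makes this set a union of
  -- components, so it is disconnected from the outer columns.
  let I : Fin n ⊕ (Fin n ⊕ Fin n) → Prop := fun v => v = .inr (.inl a) ∨ v = .inr (.inl b)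
  have hI : stack (cupCap a b) x ≤ Setoid.ker I := by
    apply stack_le
    · rintro p q (rfl | rfl)
      · exact (Setoid.ker I).refl _
      · apply propext
        rcases p with i | i <;> by_cases h : Equiv.swap a b i = i
        · have : i ≠ a ∧ i ≠ b := ⟨fun h' => hab (by simpa [h'] using h.symm),
            fun h' => hab (by simpa [h'] using h)⟩
          simp [I, leftIncl, cupCapInvolution, h, this]
        · simp [I, leftIncl, cupCapInvolution, h]
        · have : i ≠ a ∧ i ≠ b := ⟨fun h' => hab (by simpa [h'] using h.symm),
            fun h' => hab (by simpa [h'] using h)⟩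
          simp [I, leftIncl, cupCapInvolution, h, this]
        · have : i = a ∨ i = b := by
            by_contra! h'
            exact h (Equiv.swap_apply_of_ne_of_ne h'.1 h'.2)
          rcases this with rfl | rfl <;> simp [I, leftIncl, cupCapInvolution, hab, hab.symm]
    · intro p q hpq
      have key : ∀ p q, x.parts p q → I (rightIncl p) → I (rightIncl q) := by
        rintro p q hpq (h | h)
        · obtain rfl : p = .inl a := Sum.inr_injective h
          by_cases h' : q = .inl a
          · subst h'; exact Or.inl rfl
          · obtain rfl := x.eq_of_parts hpq hx h' (by simpa using hab.symm)
            exact Or.inr rfl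
        · obtain rfl : p = .inl b := Sum.inr_injective h
          by_cases h' : q = .inl b
          · subst h'; exact Or.inr rfl
          · obtain rfl := x.eq_of_parts hpq (x.parts.symm hx) h' (by simpa using hab)
            exact Or.inl rfl
      exact propext ⟨key p q hpq, key q p (x.parts.symm hpq)⟩
  have hout : ∀ p, ¬ I (outerIncl p) := by rintro (i | i) <;> simp [I, outerIncl]
  rw [loops, Nat.card_eq_one_iff_unique]
  constructor
  · constructor
    have key : ∀ c : Quotient (stack (cupCap a b) x), (∀ p, Quotient.mk _ (outerIncl p) ≠ c) →
        c = Quotient.mk _ (.inr (.inl a)) := by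
      intro c hc
      induction c using Quotient.ind with
      | _ v =>
        rcases v with i | j | k
        · exact absurd rfl (hc (.inl i))
        · by_cases h1 : j = a
          · rw [h1]
          · by_cases h2 : j = b
            · subst h2
              exact Quotient.sound ((stack (cupCap a j) x).symm (stack_left (cupCap_right hab)))
            · exact absurd (Quotient.sound (stack_left (cupCap_through h1 h2))) (hc (.inl j))
        · exact absurd rfl (hc (.inr k))
    rintro ⟨c, hc⟩ ⟨c', hc'⟩
    exact Subtype.ext ((key c hc).trans (key c' hc').symm)
  · refine ⟨⟨Quotient.mk _ (.inr (.inl a)), fun p h => hout p ?_⟩⟩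
    have : I (outerIncl p) = I (.inr (.inl a)) := hI (Quotient.exact h)
    rw [this]
    exact Or.inl rfl

section Zigzag

variable {a b c : Fin n} (hab : a ≠ b) (hbc : b ≠ c) (hac : a ≠ c)

include hab hbc hac

theorem loops_cupCap_cupCap : loops (cupCap a b) (cupCap b c) = 0 := by
  have ha : stack (cupCap a b) (cupCap b c) (outerIncl (.inr a)) (.inr (.inl a)) :=
    stack_right ((cupCap b c).parts.symm (cupCap_through hab hac))
  refine loops_eq_zero_of_forall fun j => ?_
  by_cases h1 : j = a
  · subst h1; exact ⟨_, ha⟩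
  · by_cases h2 : j = b
    · subst h2; exact ⟨_, (stack _ _).trans ha (stack_left (cupCap_right hab))⟩
    · exact ⟨.inl j, stack_left (cupCap_through h1 h2)⟩

/-- The strand runs from `c` on the left to the middle vertex `c`, turns to `b` along the second
diagram, turns to `a` along the first, and leaves at `a` on the right. -/
theorem cupCap_comp_cupCap_through :
    (comp (cupCap a b) (cupCap b c)).parts (.inl c) (.inr a) := by
  refine (stack _ _).trans (stack_left (cupCap_through hac.symm hbc.symm)) ?_
  refine (stack _ _).trans (stack_right ((cupCap b c).parts.symm (cupCap_left hbc))) ?_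
  exact (stack _ _).trans (stack_left ((cupCap a b).parts.symm (cupCap_right hab)))
    (stack_right (cupCap_through hab hac))

variable {x : BrauerDiagram n} (hx : x.parts (.inl a) (.inl b))

include hx

theorem zigzag_stack (i : Fin n) (h1 : i ≠ a) (h2 : i ≠ b) :
    stack (comp (cupCap a b) (cupCap b c)) x (outerIncl (.inl i)) (rightIncl (.inl i)) := by
  by_cases h3 : i = c
  · subst h3
    refine (stack _ _).trans (stack_left (cupCap_comp_cupCap_through hab hbc hac)) ?_
    refine (stack _ _).trans (stack_right hx) ?_
    exact stack_left (comp_right _ (cupCap_right hbc))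
  · exact stack_left (comp_through (cupCap_through h1 h2) (cupCap_through h2 h3))

theorem zigzag_comp : comp (comp (cupCap a b) (cupCap b c)) x = x :=
  comp_eq_self_of hx hab (comp_left _ (cupCap_left hab)) (zigzag_stack hab hbc hac hx)

theorem loops_zigzag : loops (comp (cupCap a b) (cupCap b c)) x = 0 := by
  have ha : stack (comp (cupCap a b) (cupCap b c)) x (outerIncl (.inl c)) (.inr (.inl a)) :=
    stack_left (cupCap_comp_cupCap_through hab hbc hac)
  refine loops_eq_zero_of_forall fun j => ?_
  by_cases h1 : j = a
  · subst h1; exact ⟨_, ha⟩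
  · by_cases h2 : j = b
    · subst h2; exact ⟨_, (stack _ _).trans ha (stack_right hx)⟩
    · exact ⟨_, zigzag_stack hab hbc hac hx j h1 h2⟩

/-- Straightening a zigzag creates no loop, so this gives left units without dividing by `δ`; the
price is a third vertex `c`. -/
theorem cupCap_mul_cupCap_mul {R : Type*} [CommRing R] {δ : R} :
    BrauerAlgebra.diagram R δ (cupCap a b) * (BrauerAlgebra.diagram R δ (cupCap b c) *
      BrauerAlgebra.diagram R δ x) = BrauerAlgebra.diagram R δ x := by
  rw [← mul_assoc, BrauerAlgebra.diagram_mul_diagram, loops_cupCap_cupCap hab hbc hac, pow_zero,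
    one_smul, BrauerAlgebra.diagram_mul_diagram, loops_zigzag hab hbc hac hx, pow_zero, one_smul,
    zigzag_comp hab hbc hac hx]

end Zigzag

theorem cupCap_mul_self {R : Type*} [CommRing R] {δ : R} {a b : Fin n} (hab : a ≠ b)
    {x : BrauerDiagram n} (hx : x.parts (.inl a) (.inl b)) :
    BrauerAlgebra.diagram R δ (cupCap a b) * BrauerAlgebra.diagram R δ x =
      δ • BrauerAlgebra.diagram R δ x := by
  rw [BrauerAlgebra.diagram_mul_diagram, loops_cupCap_self hab hx, pow_one, cupCap_comp_self hab hx]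

end BrauerDiagram

/-! ### Cyclic intervals and innermost edges of annular link states -/

theorem Fin.val_add_one_eq_ite {n : ℕ} [NeZero n] (a : Fin n) :
    (a + 1).val = if a.val + 1 = n then 0 else a.val + 1 := by
  rw [Fin.val_add, Fin.val_one', Nat.add_mod_mod]
  split_ifs with h
  · rw [h, Nat.mod_self]
  · exact Nat.mod_eq_of_lt (by omega)

theorem Fin.nsmul_one_eq {n : ℕ} [NeZero n] (k : Fin n) : k.val • (1 : Fin n) = k := by
  have h : ∀ m : ℕ, (m • (1 : Fin n)).val = m % n := by
    intro m
    induction m with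
    | zero => simp
    | succ m ih => rw [succ_nsmul, Fin.val_add, ih, Fin.val_one', ← Nat.add_mod]
  exact Fin.ext ((h _).trans (Nat.mod_eq_of_lt k.isLt))

theorem Fin.mem_cIoo_iff {n : ℕ} {i j x : Fin n} : x ∈ Set.cIoo i j ↔
    (i.val < x.val ∧ x.val < j.val) ∨ (x.val < j.val ∧ j.val < i.val) ∨
      (j.val < i.val ∧ i.val < x.val) := Iff.rfl

namespace Setoid

variable {n : ℕ}

theorem mem_defects {p : Setoid (Fin n)} {i : Fin n} : i ∈ p.defects ↔ ∀ j, p i j → j = i := by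
  simp [defects]

/-- Each class has at most two elements. -/
def IsLinkState (p : Setoid (Fin n)) : Prop :=
  ∀ i j k, p i j → p i k → j ≠ i → k ≠ i → j = k

/-- Choose the side of the edge that is free of defects. The vertex next to `i` on that side is
joined to another vertex of the same side, because edges do not cross; this edge spans a shorter
interval, and the descent ends with two neighbours. -/
theorem exists_adjacent [NeZero n] {p : Setoid (Fin n)} (hp : p.IsAnnular) (hl : p.IsLinkState)
    {i j : Fin n} (hij : i ≠ j) (h : p i j) : ∃ a, a ≠ a + 1 ∧ p a (a + 1) := by
  -- Here `m` is the cyclic distance from `i` to `j`, and the defects are required to avoid the open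
  -- interval from `i` to `j`.
  have key : ∀ m : ℕ, ∀ i j : Fin n,
      (if i.val < j.val then j.val - i.val else j.val + n - i.val) = m →
      i ≠ j → p i j → (p.defects : Set (Fin n)) ⊆ Set.cIoo j i → ∃ a, a ≠ a + 1 ∧ p a (a + 1) := by
    intro m
    induction m using Nat.strong_induction_on with
    | _ m ih =>
      intro i j hm hij h hd
      by_cases hj : j = i + 1
      · exact ⟨i, hj ▸ hij, hj ▸ h⟩
      obtain ⟨k, hk⟩ : ∃ k, k = i + 1 := ⟨_, rfl⟩
      have hkv := Fin.val_add_one_eq_ite i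
      rw [← hk] at hj hkv
      have hij' : i.val ≠ j.val := fun h' => hij (Fin.ext h')
      have hjk : j.val ≠ k.val := fun h' => hj (Fin.ext h')
      have hi := i.isLt
      have hj' := j.isLt
      have hkn := k.isLt
      have hkm : k ∈ Set.cIoo i j := by
        rw [Fin.mem_cIoo_iff]
        split_ifs at hkv <;> omega
      have hki : k ≠ i := by
        rintro rfl
        rw [Fin.mem_cIoo_iff] at hkm
        omega
      have hkd : k ∉ p.defects := fun h' => by
        have := hd h'
        rw [Fin.mem_cIoo_iff] at this hkm
        omega
      rw [mem_defects] at hkd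
      push Not at hkd
      obtain ⟨l, hkl, hlk⟩ := hkd
      have hli : l ≠ i := by
        rintro rfl
        exact hj (hl _ _ _ h (p.symm hkl) hij.symm hki)
      have hlj : l ≠ j := by
        rintro rfl
        exact hki (hl _ _ _ (p.symm hkl) (p.symm h) (Ne.symm hj) hij)
      have hlm : l ∈ Set.cIoo i j := by
        have h1 : ¬ l ∈ Set.cIoo j i := fun h' => (hp i j hij h).1 k hkm l h' hkl
        have hln := l.isLt
        have hli' : l.val ≠ i.val := fun h' => hli (Fin.ext h')
        have hlj' : l.val ≠ j.val := fun h' => hlj (Fin.ext h')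
        rw [Fin.mem_cIoo_iff] at h1 ⊢
        omega
      have hlk' : l.val ≠ k.val := fun h' => hlk (Fin.ext h')
      have hln := l.isLt
      refine ih _ ?_ k l rfl hlk.symm hkl ?_
      · rw [← hm]
        rw [Fin.mem_cIoo_iff] at hlm hkm
        split_ifs at hkv ⊢ <;> omega
      -- If the defects lay between `k` and `l`, they would lie both inside and outside the interval
      -- from `i` to `j`; so there are none and the inclusion holds vacuously.
      · rcases (hp k l hlk.symm hkl).2 with h' | h'
        · intro x hx
          have h1 := hd hx
          have h2 := h' hx
          rw [Fin.mem_cIoo_iff] at h1 h2 hlm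
          split_ifs at hkv <;> omega
        · exact h'
  rcases (hp i j hij h).2 with h' | h'
  · exact key _ j i rfl hij.symm (p.symm h) h'
  · exact key _ i j rfl hij h h'

end Setoid

theorem Finset.orderEmbOfFin_of_eq_univ {n : ℕ} {s : Finset (Fin n)} (hs : s = Finset.univ)
    (h : s.card = n) (i : Fin n) : s.orderEmbOfFin h i = i := by
  have := Finset.orderEmbOfFin_unique h (f := id) (by simp [hs]) strictMono_id
  exact (congrFun this i).symm

theorem Finset.orderEmbOfFin_congr {n t : ℕ} {s s' : Finset (Fin n)} (hs : s = s')
    (h : s.card = t) (h' : s'.card = t) (i : Fin t) :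
    s.orderEmbOfFin h i = s'.orderEmbOfFin h' i := by
  subst hs; rfl

theorem finRotate_zpow_apply (n : ℕ) [NeZero n] (z : ℤ) (i : Fin n) :
    (finRotate n ^ z) i = i + z • 1 := by
  induction z with
  | zero => simp
  | succ k ih =>
    rw [add_comm, zpow_one_add, Equiv.Perm.mul_apply, ih, finRotate_apply, add_zsmul, one_zsmul]
    abel
  | pred k ih =>
    rw [sub_eq_add_neg, add_comm, zpow_add, zpow_neg_one, Equiv.Perm.mul_apply, ih,
      Equiv.Perm.inv_eq_iff_eq, finRotate_apply, add_zsmul, neg_one_zsmul]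
    abel

/-! ### Rotations, and the dichotomy between rotations and cups -/

namespace BrauerDiagram

variable {n : ℕ}

theorem isLinkState_leftState (d : BrauerDiagram n) : d.leftState.IsLinkState :=
  fun _ _ _ h1 h2 h3 h4 => Sum.inl_injective (d.eq_of_parts h1 h2 (by simpa) (by simpa))

theorem isLinkState_rightState (d : BrauerDiagram n) : d.rightState.IsLinkState :=
  fun _ _ _ h1 h2 h3 h4 => Sum.inr_injective (d.eq_of_parts h1 h2 (by simpa) (by simpa))

/-- The unprimed vertices `a` and `a + 1` are joined. -/
def HasCup [NeZero n] (d : BrauerDiagram n) (a : Fin n) : Prop :=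
  a ≠ a + 1 ∧ d.parts (.inl a) (.inl (a + 1))

theorem HasCup.comp [NeZero n] {d : BrauerDiagram n} {a : Fin n} (h : d.HasCup a)
    (e : BrauerDiagram n) : (comp d e).HasCup a :=
  ⟨h.1, comp_left e h.2⟩

theorem HasCup.not_isThrough [NeZero n] {d : BrauerDiagram n} {a : Fin n} (h : d.HasCup a) :
    ¬ d.IsThrough := fun h' => by
  obtain ⟨j, hj⟩ := h' a
  have := d.eq_of_parts h.2 hj (by simpa using h.1.symm) (by simp)
  simp at this

/-- The diagram that joins each primed vertex `j` to the unprimed vertex `j + k`. -/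
def rotation [NeZero n] (k : Fin n) : BrauerDiagram n where
  parts := Setoid.ker (Sum.elim id (· + k))
  ncard_part x := by
    rw [Set.ncard_eq_two]
    refine ⟨.inl (Sum.elim id (· + k) x), .inr (Sum.elim id (· + k) x - k), by simp, ?_⟩
    ext y
    rcases x with x | x <;> rcases y with y | y <;>
      simp [Setoid.ker_def, eq_comm, eq_sub_iff_add_eq]

section Rotation

variable [NeZero n]

theorem rotation_through (k j : Fin n) : (rotation k).parts (.inl (j + k)) (.inr j) := rfl

theorem isThrough_rotation (k : Fin n) : (rotation k).IsThrough := fun i =>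
  ⟨i - k, by simpa using rotation_through k (i - k)⟩

theorem rotation_zero : rotation (0 : Fin n) = idDiagram n := by
  refine eq_of_le ?_
  change Setoid.ker _ ≤ Setoid.ker _
  exact le_of_eq (by simp; rfl)

theorem eq_rotation_of_forall {d : BrauerDiagram n} {k : Fin n}
    (h : ∀ j, d.parts (.inl (j + k)) (.inr j)) : d = rotation k := by
  symm
  apply eq_of_le
  rintro (i | i) (j | j) hij
  · obtain rfl : i = j := hij
    exact d.parts.refl _
  · obtain rfl : i = j + k := hij
    exact h j
  · obtain rfl : i + k = j := hij
    exact d.parts.symm (h i)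
  · obtain rfl : i = j := add_right_cancel (show i + k = j + k from hij)
    exact d.parts.refl _

theorem rotation_comp_rotation (k l : Fin n) :
    comp (rotation k) (rotation l) = rotation (k + l) :=
  eq_rotation_of_forall fun j => by
    rw [add_comm k l, ← add_assoc]
    exact comp_through (rotation_through k _) (rotation_through l j)

theorem rotation_injective : Function.Injective (rotation (n := n)) := by
  intro k l h
  have h1 := rotation_through k 0
  rw [h] at h1
  have h2 : 0 + k = 0 + l := h1
  simpa using h2

theorem loops_rotation_rotation (k l : Fin n) : loops (rotation k) (rotation l) = 0 :=
  loops_eq_zero _ (isThrough_rotation k) (isThrough_rotation l)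

theorem HasCup.rotation_comp {e : BrauerDiagram n} {a : Fin n} (h : e.HasCup a) (k : Fin n) :
    (BrauerDiagram.comp (rotation k) e).HasCup (a + k) := by
  have h1 : a + k + 1 = a + 1 + k := add_right_comm _ _ _
  refine ⟨fun h' => h.1 (add_right_cancel (h'.trans h1)), ?_⟩
  rw [h1]
  exact comp_left_of_through (rotation_through k a) (rotation_through k (a + 1)) h.2

theorem isAnnular_rotation (k : Fin n) : (rotation k).IsAnnular := by
  have hl : ∀ i j, (rotation k).leftState i j → i = j := fun i j h => h
  have hr : ∀ i j, (rotation k).rightState i j → i = j := fun i j h =>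
    add_right_cancel (show i + k = j + k from h)
  have hld : (rotation k).leftState.defects = Finset.univ := by
    ext i
    simp only [Setoid.mem_defects, Finset.mem_univ, iff_true]
    exact fun j h => (hl _ _ h).symm
  have hrd : (rotation k).rightState.defects = Finset.univ := by
    ext i
    simp only [Setoid.mem_defects, Finset.mem_univ, iff_true]
    exact fun j h => (hr _ _ h).symm
  refine ⟨fun i j hij h => absurd (hl _ _ h) hij, fun i j hij h => absurd (hr _ _ h) hij,
    n, by simp [hld], by simp [hrd], finRotate n ^ (k.val : ℤ), ⟨_, rfl⟩, fun i => ?_⟩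
  rw [Finset.orderEmbOfFin_of_eq_univ hld, Finset.orderEmbOfFin_of_eq_univ hrd,
    finRotate_zpow_apply]
  rw [natCast_zsmul, Fin.nsmul_one_eq]
  exact (rotation k).parts.symm (rotation_through k i)

/-- One of the two cyclic intervals between neighbours is empty, so nothing can cross the edge and
all defects lie on the other side. The two link states coincide and the defects are joined straight
across, so `σ = 1`. -/
theorem isAnnular_cupCap {a : Fin n} (ha : a ≠ a + 1) : (cupCap a (a + 1)).IsAnnular := by
  have hlr : (cupCap a (a + 1)).rightState = (cupCap a (a + 1)).leftState := by
    ext i j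
    change (_ ∨ _) ↔ (_ ∨ _)
    simp only [cupCapInvolution]
    split_ifs <;> simp
  have hl : ∀ i j, i ≠ j → (cupCap a (a + 1)).leftState i j →
      (i = a ∧ j = a + 1) ∨ (i = a + 1 ∧ j = a) := by
    intro i j hij h
    by_cases h1 : i = a
    · subst h1
      exact Or.inl ⟨rfl, Sum.inl_injective ((cupCap i (i + 1)).eq_of_parts h (cupCap_left ha)
        (by simpa using hij.symm) (by simpa using ha.symm))⟩
    · by_cases h2 : i = a + 1
      · subst h2
        exact Or.inr ⟨rfl, Sum.inl_injective ((cupCap a (a + 1)).eq_of_parts h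
          ((cupCap a (a + 1)).parts.symm (cupCap_left ha))
          (by simpa using hij.symm) (by simpa using ha))⟩
      · have := (cupCap a (a + 1)).eq_of_parts h (cupCap_through h1 h2)
          (by simpa using hij.symm) (by simp)
        simp at this
  have hd : ∀ i ∈ (cupCap a (a + 1)).leftState.defects, i ≠ a ∧ i ≠ a + 1 := by
    intro i hi
    rw [Setoid.mem_defects] at hi
    constructor
    · rintro rfl
      exact ha (hi _ (cupCap_left ha)).symm
    · rintro rfl
      exact ha (hi _ ((cupCap a (a + 1)).parts.symm (cupCap_left ha)))
  have hv := Fin.val_add_one_eq_ite a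
  have hav := a.isLt
  have hav' : a.val ≠ (a + 1).val := fun h => ha (Fin.ext h)
  have hempty : ∀ x, x ∉ Set.cIoo a (a + 1) := by
    intro x hx
    have := x.isLt
    rw [Fin.mem_cIoo_iff] at hx
    split_ifs at hv <;> omega
  have hsub : ((cupCap a (a + 1)).leftState.defects : Set (Fin n)) ⊆ Set.cIoo (a + 1) a := by
    intro x hx
    have := x.isLt
    have h1 : x.val ≠ a.val := fun h => (hd x hx).1 (Fin.ext h)
    have h2 : x.val ≠ (a + 1).val := fun h => (hd x hx).2 (Fin.ext h)
    rw [Fin.mem_cIoo_iff]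
    split_ifs at hv <;> omega
  have hann : (cupCap a (a + 1)).leftState.IsAnnular := by
    intro i j hij h
    rcases hl i j hij h with ⟨rfl, rfl⟩ | ⟨rfl, rfl⟩
    · exact ⟨fun k hk => absurd hk (hempty k), Or.inr hsub⟩
    · exact ⟨fun k _ l hl => absurd hl (hempty l), Or.inl hsub⟩
  refine ⟨hann, hlr ▸ hann, _, rfl, by rw [hlr], 1, one_mem _, fun i => ?_⟩
  have h1 := hd _ (Finset.orderEmbOfFin_mem (cupCap a (a + 1)).leftState.defects rfl i)
  rw [Finset.orderEmbOfFin_congr (congrArg Setoid.defects hlr) _ rfl i]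
  exact (cupCap a (a + 1)).parts.symm (cupCap_through h1.1 h1.2)

/-- An annular diagram is a rotation or joins two neighbouring unprimed vertices. -/
theorem IsAnnular.rotation_or_hasCup {d : BrauerDiagram n} (hd : d.IsAnnular) :
    (∃ k, d = rotation k) ∨ ∃ a, d.HasCup a := by
  obtain ⟨hl, -, t, htl, htr, σ, hσ, h⟩ := hd
  by_cases hedge : ∃ i j, i ≠ j ∧ d.leftState i j
  · obtain ⟨i, j, hij, h'⟩ := hedge
    exact Or.inr (Setoid.exists_adjacent hl d.isLinkState_leftState hij h')
  · push Not at hedge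
    have hlu : d.leftState.defects = Finset.univ := by
      ext i
      simp only [Setoid.mem_defects, Finset.mem_univ, iff_true]
      exact fun j hj => by_contra fun h' => hedge i j (Ne.symm h') hj
    obtain rfl : n = t := by rw [← htl, hlu, Finset.card_univ, Fintype.card_fin]
    have hru : d.rightState.defects = Finset.univ :=
      Finset.eq_univ_of_card _ (by rw [htr, Fintype.card_fin])
    obtain ⟨z, rfl⟩ := hσ
    refine Or.inl ⟨z • 1, eq_rotation_of_forall fun j => d.parts.symm ?_⟩
    have := h j
    simp only [Finset.orderEmbOfFin_of_eq_univ hlu, Finset.orderEmbOfFin_of_eq_univ hru,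
      finRotate_zpow_apply] at this
    exact this

end Rotation

end BrauerDiagram

/-! ### A crossing form modulo two -/

section Wedge

/-- The number modulo two of pairs `i < j` weighted by `u i * v j`. -/
def wedge {t : ℕ} (u v : Fin t → ZMod 2) : ZMod 2 := ∑ i, ∑ j, if i < j then u i * v j else 0

variable {t : ℕ}

/-- The two sides add up to the product of the total sums, since the diagonal terms vanish; evenness
of one factor makes this zero. -/
theorem wedge_comm {u v : Fin t → ZMod 2} (huv : ∀ i, u i * v i = 0) (hu : ∑ i, u i = 0) :
    wedge u v = wedge v u := by
  have h : wedge u v + wedge v u = (∑ i, u i) * ∑ j, v j := by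
    rw [wedge, wedge, Finset.sum_comm (f := fun i j => if i < j then v i * u j else 0),
      Finset.sum_mul_sum, ← Finset.sum_add_distrib]
    refine Finset.sum_congr rfl fun i _ => ?_
    rw [← Finset.sum_add_distrib]
    refine Finset.sum_congr rfl fun j _ => ?_
    rcases lt_trichotomy i j with h | rfl | h
    · rw [if_pos h, if_neg h.not_gt, add_zero]
    · simp [huv]
    · rw [if_pos h, if_neg h.not_gt, zero_add, mul_comm]
  rw [hu, zero_mul] at h
  exact CharTwo.add_eq_zero.1 h

/-- Rotation moves the entry with index `0` from the front to the back. By evenness its pairs with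
the rest contribute `u 0 * v 0` in either position. -/
theorem wedge_finRotate {u v : Fin t → ZMod 2} (hu : ∑ i, u i = 0) (hv : ∑ i, v i = 0) :
    wedge (u ∘ finRotate t) (v ∘ finRotate t) = wedge u v := by
  cases t with
  | zero => simp [wedge]
  | succ m =>
    have e1 : ∀ y : Fin m, finRotate (m + 1) y.castSucc = y.succ := fun y => by
      rw [finRotate_apply]; exact Fin.coeSucc_eq_succ
    have e2 : finRotate (m + 1) (Fin.last m) = 0 := by
      rw [finRotate_apply]; exact Fin.last_add_one m
    rw [Fin.sum_univ_succ] at hu hv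
    have hu' : ∑ i : Fin m, u i.succ = u 0 := (CharTwo.add_eq_zero.1 hu).symm
    have hv' : ∑ i : Fin m, v i.succ = v 0 := (CharTwo.add_eq_zero.1 hv).symm
    have l1 : wedge (u ∘ finRotate (m + 1)) (v ∘ finRotate (m + 1)) =
        wedge (fun y : Fin m => u y.succ) (fun y => v y.succ) + u 0 * v 0 := by
      simp only [wedge, Fin.sum_univ_castSucc, Function.comp, e1, e2]
      simp [Fin.castSucc_lt_last, Finset.sum_add_distrib, ← Finset.sum_mul, hu',
        (Fin.le_last _).not_gt]
    have l2 : wedge u v = wedge (fun y : Fin m => u y.succ) (fun y => v y.succ) + u 0 * v 0 := by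
      simp only [wedge, Fin.sum_univ_succ]
      simp [← Finset.mul_sum, hv', add_comm]
    rw [l1, l2]

theorem wedge_comp_of_mem_zpowers {σ : Equiv.Perm (Fin t)}
    (hσ : σ ∈ Subgroup.zpowers (finRotate t)) : ∀ {u v : Fin t → ZMod 2},
      ∑ i, u i = 0 → ∑ i, v i = 0 → wedge (u ∘ σ) (v ∘ σ) = wedge u v := by
  obtain ⟨z, rfl⟩ := hσ
  have hs : ∀ (u : Fin t → ZMod 2) (τ : Equiv.Perm (Fin t)), ∑ i, u (τ i) = ∑ i, u i :=
    fun u τ => Equiv.sum_comp τ u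
  change ∀ {u v : Fin t → ZMod 2}, ∑ i, u i = 0 → ∑ i, v i = 0 →
    wedge (u ∘ ⇑(finRotate t ^ z)) (v ∘ ⇑(finRotate t ^ z)) = wedge u v
  induction z with
  | zero => intros; rfl
  | succ k ih =>
    intro u v hu hv
    rw [← ih hu hv, zpow_add_one]
    exact wedge_finRotate (u := u ∘ ⇑(finRotate t ^ (k : ℤ))) (v := v ∘ ⇑(finRotate t ^ (k : ℤ)))
      ((hs _ _).trans hu) ((hs _ _).trans hv)
  | pred k ih =>
    intro u v hu hv
    rw [← ih hu hv, zpow_sub_one]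
    have := wedge_finRotate (u := u ∘ ⇑(finRotate t ^ (-k : ℤ) * (finRotate t)⁻¹))
      (v := v ∘ ⇑(finRotate t ^ (-k : ℤ) * (finRotate t)⁻¹)) ((hs _ _).trans hu)
      ((hs _ _).trans hv)
    have e : ∀ w : Fin t → ZMod 2,
        (w ∘ ⇑(finRotate t ^ (-k : ℤ) * (finRotate t)⁻¹)) ∘ finRotate t =
          w ∘ ⇑(finRotate t ^ (-k : ℤ)) := fun w => funext fun i =>
      congrArg (fun x => w ((finRotate t ^ (-k : ℤ)) x)) (Equiv.symm_apply_apply _ i)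
    rw [← this, e, e]

end Wedge

/-! ### The crossing form on annular link states reduces to the defects -/

namespace Setoid

variable {n : ℕ} {p : Setoid (Fin n)}

theorem IsLinkState.exists_partner (hl : p.IsLinkState) : ∃ τ : Fin n → Fin n,
    Function.Involutive τ ∧ (∀ i j, p i j ↔ j = i ∨ j = τ i) ∧ ∀ i, i ∈ p.defects ↔ τ i = i := by
  have h : ∀ i, ∃ z, (∀ j, p i j ↔ j = i ∨ j = z) := by
    intro i
    by_cases hi : ∃ j, p i j ∧ j ≠ i
    · obtain ⟨z, hz, hzi⟩ := hi
      refine ⟨z, fun j => ⟨fun h => ?_, ?_⟩⟩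
      · by_cases hj : j = i
        · exact Or.inl hj
        · exact Or.inr (hl i j z h hz hj hzi)
      · rintro (rfl | rfl)
        · exact p.refl _
        · exact hz
    · push Not at hi
      refine ⟨i, fun j => ⟨fun h => Or.inl (hi j h), ?_⟩⟩
      rintro (rfl | rfl) <;> exact p.refl _
  choose τ hτ using h
  refine ⟨τ, fun i => ?_, hτ, fun i => ?_⟩
  · by_cases hi : τ i = i
    · rw [hi, hi]
    · rcases (hτ _ _).1 (p.symm ((hτ i (τ i)).2 (Or.inr rfl))) with h | h
      · exact absurd h.symm hi
      · exact h.symm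
  · rw [mem_defects]
    constructor
    · exact fun h => h _ ((hτ _ _).2 (Or.inr rfl))
    · intro h j hj
      rcases (hτ _ _).1 hj with h' | h'
      · exact h'
      · exact h'.trans h

/-- A function that is constant on the parts of a link state sums to zero over any set of
nondefects that is closed under the link state. -/
theorem sum_eq_zero_of_stable {τ : Fin n → Fin n} (h1 : Function.Involutive τ)
    {v : Fin n → ZMod 2} (hv : ∀ i, v (τ i) = v i) (s : Finset (Fin n))
    (hs : ∀ i ∈ s, τ i ∈ s) (hd : ∀ i ∈ s, τ i ≠ i) : ∑ i ∈ s, v i = 0 :=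
  Finset.sum_involution (fun i _ => τ i) (fun i _ => by rw [hv]; exact CharTwo.add_self_eq_zero _)
    (fun i hi _ => hd i hi) (fun i hi => hs i hi) (fun i _ => h1 i)

/-- Both sides of the edge are closed under the matching, and one of them contains no defects. The
values on that side cancel in pairs; if it is the outer side, evenness of the total transfers the
conclusion to the inner one. -/
theorem sum_between_eq_zero (hp : p.IsAnnular) (hl : p.IsLinkState) {v : Fin n → ZMod 2}
    (hv : ∀ i j, p i j → v i = v j) (hs : ∑ i, v i = 0) {i j : Fin n} (hij : i < j) (h : p i j) :
    ∑ k with i < k ∧ k < j, v k = 0 := by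
  obtain ⟨τ, t1, t2, t3⟩ := hl.exists_partner
  have hv' : ∀ i, v (τ i) = v i := fun i => (hv _ _ ((t2 _ _).2 (Or.inr rfl))).symm
  have hτi : τ i = j := by
    rcases (t2 _ _).1 h with h' | h'
    · exact absurd h'.symm hij.ne
    · exact h'.symm
  have hτj : τ j = i := by rw [← hτi, t1]
  have hin : ∀ k, k ∈ Set.cIoo i j ↔ i < k ∧ k < j := fun k => by
    rw [Fin.mem_cIoo_iff, Fin.lt_def, Fin.lt_def]
    rw [Fin.lt_def] at hij
    omega
  have hout : ∀ k, k ∈ Set.cIoo j i ↔ k < i ∨ j < k := fun k => by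
    rw [Fin.mem_cIoo_iff, Fin.lt_def, Fin.lt_def]
    rw [Fin.lt_def] at hij
    omega
  have hcase : ∀ k, k = i ∨ k = j ∨ (i < k ∧ k < j) ∨ (k < i ∨ j < k) := fun k => by
    rw [Fin.ext_iff, Fin.ext_iff]
    simp only [Fin.lt_def] at *
    omega
  have hnoc : ∀ k, (i < k ∧ k < j) → ¬ (τ k < i ∨ j < τ k) := fun k hk hk' =>
    (hp i j hij.ne h).1 k ((hin k).2 hk) _ ((hout _).2 hk') ((t2 _ _).2 (Or.inr rfl))
  have hinτ : ∀ k, (i < k ∧ k < j) → i < τ k ∧ τ k < j := fun k hk => by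
    rcases hcase (τ k) with h' | h' | h' | h'
    · have : k = j := by rw [← t1 k, h', hτi]
      exact absurd hk.2 (by rw [this]; exact lt_irrefl _)
    · have : k = i := by rw [← t1 k, h', hτj]
      exact absurd hk.1 (by rw [this]; exact lt_irrefl _)
    · exact h'
    · exact absurd h' (hnoc k hk)
  have houtτ : ∀ k, (k < i ∨ j < k) → τ k < i ∨ j < τ k := fun k hk => by
    rcases hcase (τ k) with h' | h' | h' | h'
    · have : k = j := by rw [← t1 k, h', hτi]
      subst this
      exact absurd hk (by simp [hij.le])
    · have : k = i := by rw [← t1 k, h', hτj]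
      subst this
      exact absurd hk (by simp [hij.le])
    · have := hinτ _ h'
      rw [t1] at this
      exact absurd hk (by simp [this.1.le, this.2.le])
    · exact h'
  rcases (hp i j hij.ne h).2 with hd | hd
  · have h0 : ∑ k with k < i ∨ j < k, v k = 0 := by
      refine sum_eq_zero_of_stable t1 hv' _ (by simpa using houtτ) fun k hk hk' => ?_
      have h1 := (hin k).1 (hd ((t3 k).2 hk'))
      simp only [Finset.mem_filter, Finset.mem_univ, true_and] at hk
      exact absurd hk (by simp [h1.1.le, h1.2.le])
    -- The total splits into the inside, the outside and the two ends of the edge; the ends cancel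
    -- because `v` agrees on them.
    have hdec : ∑ k, v k = (∑ k with i < k ∧ k < j, v k) + ((∑ k with k < i ∨ j < k, v k) +
        (v i + v j)) := by
      rw [← Finset.sum_pair hij.ne, Finset.sum_filter, Finset.sum_filter,
        ← Finset.sum_filter_add_sum_filter_not
        Finset.univ (fun k => k = i ∨ k = j) v, add_comm, ← add_assoc,  ← Finset.sum_add_distrib]
      congr 1
      · rw [Finset.sum_filter]
        refine Finset.sum_congr rfl fun k _ => ?_
        by_cases h1 : i < k ∧ k < j
        · have h2 : ¬ (k < i ∨ j < k) := by simp [h1.1.le, h1.2.le]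
          have h3 : ¬ (k = i ∨ k = j) := by simp [h1.1.ne', h1.2.ne]
          rw [if_pos h1, if_neg h2, if_pos h3, add_zero]
        · by_cases h2 : k < i ∨ j < k
          · have h3 : ¬ (k = i ∨ k = j) := by
              rintro (rfl | rfl)
              · exact hij.not_gt (by simpa using h2)
              · exact hij.not_gt (by simpa using h2)
            rw [if_neg h1, if_pos h2, if_pos h3, zero_add]
          · have h3 : ¬ ¬ (k = i ∨ k = j) := by
              have := hcase k
              tauto
            rw [if_neg h1, if_neg h2, if_neg h3, zero_add]
      · refine Finset.sum_congr ?_ fun _ _ => rfl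
        ext k
        simp
    rw [hs, h0, hv i j h, CharTwo.add_self_eq_zero, add_zero, add_zero] at hdec
    exact hdec.symm
  · refine sum_eq_zero_of_stable t1 hv' _ (by simpa using hinτ) fun k hk hk' => ?_
    have h1 := (hout k).1 (hd ((t3 k).2 hk'))
    simp only [Finset.mem_filter, Finset.mem_univ, true_and] at hk
    exact absurd h1 (by simp [hk.1.le, hk.2.le])

end Setoid

namespace Setoid

variable {n : ℕ} {p : Setoid (Fin n)}

/-- The restriction of a function to the defects, extended by zero. -/
noncomputable def onDefects (p : Setoid (Fin n)) (u : Fin n → ZMod 2) (i : Fin n) : ZMod 2 :=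
  if i ∈ p.defects then u i else 0

theorem onDefects_congr (u : Fin n → ZMod 2) (i j : Fin n)
    (h : p i j) (hu : u i = u j) : p.onDefects u i = p.onDefects u j := by
  have key : ∀ i j, p i j → i ∈ p.defects → j ∈ p.defects := fun i j h hi => by
    rw [mem_defects.1 hi j h]; exact hi
  have : i ∈ p.defects ↔ j ∈ p.defects := ⟨key i j h, key j i (p.symm h)⟩
  simp only [onDefects, this, hu]

theorem sum_onDefects (hl : p.IsLinkState) {u : Fin n → ZMod 2} (hu : ∀ i j, p i j → u i = u j) :
    ∑ i, p.onDefects u i = ∑ i, u i := by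
  obtain ⟨τ, t1, t2, t3⟩ := hl.exists_partner
  rw [← Finset.sum_filter_add_sum_filter_not Finset.univ (fun i => i ∈ p.defects) u]
  simp only [onDefects]
  rw [← Finset.sum_filter, left_eq_add]
  refine sum_eq_zero_of_stable t1 (fun i => (hu _ _ ((t2 _ _).2 (Or.inr rfl))).symm) _ ?_ ?_
  · intro i hi
    simp only [Finset.mem_filter, Finset.mem_univ, true_and, t3, t1 i] at hi ⊢
    exact fun h => hi h.symm
  · intro i hi
    simpa only [Finset.mem_filter, Finset.mem_univ, true_and, t3] using hi

/-- The two ends of an edge contribute equally: the `v`-weights to their right differ by the weight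
strictly between them, which is zero, and by the weight of an end, which is invisible to `u`. -/
theorem wedge_onDefects_left (hp : p.IsAnnular) (hl : p.IsLinkState) {u v : Fin n → ZMod 2}
    (hu : ∀ i j, p i j → u i = u j) (hv : ∀ i j, p i j → v i = v j)
    (huv : ∀ i, u i * v i = 0) (hs : ∑ i, v i = 0) : wedge u v = wedge (p.onDefects u) v := by
  obtain ⟨τ, t1, t2, t3⟩ := hl.exists_partner
  have hτ : ∀ i, p i (τ i) := fun i => (t2 _ _).2 (Or.inr rfl)
  let ψ : Fin n → ZMod 2 := fun i => ∑ j, if i < j then v j else 0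
  have hw : ∀ u : Fin n → ZMod 2, wedge u v = ∑ i, u i * ψ i := fun u => by
    simp only [wedge, ψ, Finset.mul_sum, mul_ite, mul_zero]
  have key : ∀ i j, i < j → p i j → u i * ψ i + u i * ψ j = 0 := by
    intro i j hij h
    have h1 : ψ i = (∑ k with i < k ∧ k < j, v k) + v j + ψ j := by
      simp only [ψ]
      have h2 : v j = ∑ k, if k = j then v k else 0 := by simp
      rw [Finset.sum_filter, h2, ← Finset.sum_add_distrib, ← Finset.sum_add_distrib]
      refine Finset.sum_congr rfl fun k _ => ?_
      rcases lt_trichotomy k j with h | rfl | h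
      · simp [h, h.ne, h.not_gt]
      · simp [hij]
      · simp [h, h.ne', h.not_gt, hij.trans h]
    rw [h1, sum_between_eq_zero hp hl hv hs hij h, ← hv i j h, zero_add, mul_add, huv, zero_add]
    exact CharTwo.add_self_eq_zero _
  have key' : ∀ i, i ∉ p.defects → u i * ψ i + u (τ i) * ψ (τ i) = 0 := by
    intro i hi
    rw [t3] at hi
    rcases lt_or_gt_of_ne hi with h | h
    · rw [add_comm, hu _ _ (hτ i)]
      exact key _ _ h (p.symm (hτ i))
    · rw [← hu _ _ (hτ i)]
      exact key _ _ h (hτ i)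
  rw [hw, hw, ← Finset.sum_filter_add_sum_filter_not Finset.univ (fun i => i ∈ p.defects)
    (fun i => u i * ψ i)]
  have h0 : ∑ i with ¬ i ∈ p.defects, u i * ψ i = 0 := by
    refine Finset.sum_involution (fun i _ => τ i) ?_ ?_ ?_ (fun i _ => t1 i)
    · intro i hi
      exact key' i (by simpa using hi)
    · intro i hi _
      simpa [t3] using hi
    · intro i hi
      simp only [Finset.mem_filter, Finset.mem_univ, true_and, t3, t1 i] at hi ⊢
      exact fun h => hi h.symm
  rw [h0, add_zero, Finset.sum_filter]
  refine Finset.sum_congr rfl fun i _ => ?_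
  simp only [onDefects]
  split_ifs <;> simp

/-- Restrict the first argument, interchange the arguments by symmetry, and restrict the other.
Restriction keeps the total sum, so the evenness hypotheses survive. -/
theorem wedge_onDefects (hp : p.IsAnnular) (hl : p.IsLinkState) {u v : Fin n → ZMod 2}
    (hu : ∀ i j, p i j → u i = u j) (hv : ∀ i j, p i j → v i = v j)
    (huv : ∀ i, u i * v i = 0) (hsu : ∑ i, u i = 0) (hsv : ∑ i, v i = 0) :
    wedge u v = wedge (p.onDefects u) (p.onDefects v) := by
  have h1 : ∀ i, p.onDefects u i * v i = 0 := fun i => by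
    simp only [onDefects]; split_ifs <;> simp [huv]
  have h2 : ∀ i, p.onDefects u i * p.onDefects v i = 0 := fun i => by
    simp only [onDefects]; split_ifs <;> simp [huv]
  have hsu' := (sum_onDefects hl hu).trans hsu
  rw [wedge_onDefects_left hp hl hu hv huv hsv, wedge_comm h1 hsu',
    wedge_onDefects_left hp hl hv (fun i j h => onDefects_congr u i j h (hu i j h))
      (fun i => by rw [mul_comm, h1]) hsu', wedge_comm h2 hsu']

theorem sum_onDefects_eq {t : ℕ} (ht : p.defects.card = t) (f : Fin n → ZMod 2) :
    (∑ i, if i ∈ p.defects then f i else 0) = ∑ a, f (p.defects.orderEmbOfFin ht a) := by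
  rw [← Finset.sum_filter, Finset.filter_mem_eq_inter, Finset.univ_inter]
  conv_lhs => rw [← Finset.map_orderEmbOfFin_univ p.defects ht, Finset.sum_map]
  rfl

theorem wedge_onDefects_eq {t : ℕ} (ht : p.defects.card = t) (u v : Fin n → ZMod 2) :
    wedge (p.onDefects u) (p.onDefects v) =
      wedge (u ∘ p.defects.orderEmbOfFin ht) (v ∘ p.defects.orderEmbOfFin ht) := by
  have h : ∀ i, (∑ j, if i < j then p.onDefects u i * p.onDefects v j else 0) =
      if i ∈ p.defects then ∑ j, (if j ∈ p.defects then (if i < j then u i * v j else 0) else 0)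
      else 0 := by
    intro i
    simp only [onDefects]
    split_ifs with hi
    · refine Finset.sum_congr rfl fun j _ => ?_
      split_ifs <;> simp
    · simp
  simp only [wedge, h]
  rw [sum_onDefects_eq ht]
  refine Finset.sum_congr rfl fun a _ => ?_
  rw [sum_onDefects_eq ht]
  simp [OrderEmbedding.lt_iff_lt]

end Setoid

/-! ### Parity planarity and its relation to annularity -/

namespace BrauerDiagram

variable {n : ℕ}

/-- A condition on a diagram which expresses that unions of parts with evenly many unprimed vertices
cross evenly often; in contrast to annularity it is clearly preserved under composition. -/
def IsParityPlanar (d : BrauerDiagram n) : Prop :=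
  ∀ u v : Fin n ⊕ Fin n → ZMod 2, (∀ x y, d.parts x y → u x = u y) →
    (∀ x y, d.parts x y → v x = v y) → (∀ x, u x * v x = 0) →
    ∑ i, u (.inl i) = 0 → ∑ i, v (.inl i) = 0 →
    wedge (u ∘ Sum.inl) (v ∘ Sum.inl) = wedge (u ∘ Sum.inr) (v ∘ Sum.inr)

theorem sum_eq_zero_of_forall_parts (d : BrauerDiagram n) {u : Fin n ⊕ Fin n → ZMod 2}
    (hu : ∀ x y, d.parts x y → u x = u y) : ∑ i, u (.inl i) + ∑ i, u (.inr i) = 0 := by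
  obtain ⟨τ, t1, t2, t3⟩ := d.exists_partner
  rw [← Fintype.sum_sum_type]
  refine Finset.sum_involution (fun x _ => τ x) (fun x _ => ?_) (fun x _ _ => t2 x)
    (fun _ _ => Finset.mem_univ _) (fun x _ => t1 x)
  rw [hu _ _ ((t3 x (τ x)).2 (Or.inr rfl))]
  exact CharTwo.add_self_eq_zero _

/-- On each side the form depends only on the defects. The through strands identify the restrictions
to the two sets of defects up to a power of the rotation, under which the form is invariant. -/
theorem IsAnnular.isParityPlanar {d : BrauerDiagram n} (hd : d.IsAnnular) : d.IsParityPlanar := by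
  intro u v hu hv huv hsu hsv
  have hsu' : ∑ i, u (.inr i) = 0 := by
    have := d.sum_eq_zero_of_forall_parts hu
    rwa [hsu, zero_add] at this
  have hsv' : ∑ i, v (.inr i) = 0 := by
    have := d.sum_eq_zero_of_forall_parts hv
    rwa [hsv, zero_add] at this
  obtain ⟨hl, hr, t, htl, htr, σ, hσ, h⟩ := hd
  have lu : ∀ i j, d.leftState i j → (u ∘ Sum.inl) i = (u ∘ Sum.inl) j := fun i j h => hu _ _ h
  have lv : ∀ i j, d.leftState i j → (v ∘ Sum.inl) i = (v ∘ Sum.inl) j := fun i j h => hv _ _ h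
  have ru : ∀ i j, d.rightState i j → (u ∘ Sum.inr) i = (u ∘ Sum.inr) j := fun i j h => hu _ _ h
  have rv : ∀ i j, d.rightState i j → (v ∘ Sum.inr) i = (v ∘ Sum.inr) j := fun i j h => hv _ _ h
  have cs : ∀ w : Fin n ⊕ Fin n → ZMod 2, (∀ x y, d.parts x y → w x = w y) →
      (w ∘ Sum.inr) ∘ d.rightState.defects.orderEmbOfFin htr =
        ((w ∘ Sum.inl) ∘ d.leftState.defects.orderEmbOfFin htl) ∘ σ :=
    fun w hw => funext fun i => hw _ _ (h i)
  have ss : ∀ w : Fin n ⊕ Fin n → ZMod 2, (∀ x y, d.parts x y → w x = w y) →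
      ∑ i, w (.inl i) = 0 → ∑ a, ((w ∘ Sum.inl) ∘ d.leftState.defects.orderEmbOfFin htl) a = 0 :=
    fun w hw hs => by
      rw [← hs]
      refine Eq.trans ?_ (Setoid.sum_onDefects (u := w ∘ Sum.inl) d.isLinkState_leftState
        fun i j h => hw _ _ h)
      exact (Setoid.sum_onDefects_eq htl (w ∘ Sum.inl)).symm
  rw [Setoid.wedge_onDefects hl d.isLinkState_leftState lu lv (fun i => huv _) hsu hsv,
    Setoid.wedge_onDefects hr d.isLinkState_rightState ru rv (fun i => huv _) hsu' hsv',
    Setoid.wedge_onDefects_eq htl, Setoid.wedge_onDefects_eq htr, cs u hu, cs v hv,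
    wedge_comp_of_mem_zpowers hσ (ss u hu hsu) (ss v hv hsv)]

open scoped Classical in
/-- A function on the outer vertices of a concatenation that is constant on components extends to
all components. -/
theorem exists_extension {d e : BrauerDiagram n} {u : Fin n ⊕ Fin n → ZMod 2}
    (hu : ∀ x y, (comp d e).parts x y → u x = u y) :
    ∃ f : Fin n ⊕ (Fin n ⊕ Fin n) → ZMod 2, (∀ x y, stack d e x y → f x = f y) ∧
      (∀ x, f (outerIncl x) = u x) ∧ ∀ y, f y ≠ 0 → ∃ x, stack d e (outerIncl x) y := by
  refine ⟨fun y => if h : ∃ x, stack d e (outerIncl x) y then u h.choose else 0, ?_, ?_, ?_⟩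
  · intro x y hxy
    by_cases h : ∃ z, stack d e (outerIncl z) x
    · have h' : ∃ z, stack d e (outerIncl z) y := ⟨_, (stack d e).trans h.choose_spec hxy⟩
      simp only [dif_pos h, dif_pos h']
      exact hu _ _ ((stack d e).trans h.choose_spec
        ((stack d e).trans hxy ((stack d e).symm h'.choose_spec)))
    · have h' : ¬ ∃ z, stack d e (outerIncl z) y := fun ⟨z, hz⟩ =>
        h ⟨z, (stack d e).trans hz ((stack d e).symm hxy)⟩
      simp only [dif_neg h, dif_neg h']
  · intro x
    have h : ∃ z, stack d e (outerIncl z) (outerIncl x) := ⟨x, (stack d e).refl _⟩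
    simp only [dif_pos h]
    exact hu _ _ h.choose_spec
  · intro y hy
    by_contra h
    exact hy (dif_neg h)

/-- Extend both functions to the middle column by zero on loops, which keeps them disjoint. They are
even there since parts have two elements, so the conditions for `d` and `e` can be chained through
the middle. -/
theorem IsParityPlanar.comp {d e : BrauerDiagram n} (hd : d.IsParityPlanar)
    (he : e.IsParityPlanar) : (comp d e).IsParityPlanar := by
  intro u v hu hv huv hsu hsv
  obtain ⟨f, f1, f2, f3⟩ := exists_extension hu
  obtain ⟨g, g1, g2, g3⟩ := exists_extension hv
  have hfg : ∀ y, f y * g y = 0 := by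
    intro y
    by_contra h
    obtain ⟨x, hx⟩ := f3 y (left_ne_zero_of_mul h)
    rw [← f1 _ _ hx, ← g1 _ _ hx, f2, g2] at h
    exact h (huv x)
  have mid : ∀ {w : Fin n ⊕ Fin n → ZMod 2} {f : Fin n ⊕ (Fin n ⊕ Fin n) → ZMod 2},
      (∀ x y, stack d e x y → f x = f y) → (∀ x, f (outerIncl x) = w x) → ∑ i, w (.inl i) = 0 →
      ∑ i, f (.inr (.inl i)) = 0 := by
    intro w f f1 f2 hs
    have := d.sum_eq_zero_of_forall_parts (u := f ∘ leftIncl) fun x y h => f1 _ _ (stack_left h)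
    simp only [← f2] at hs
    rwa [show ∑ i, (f ∘ leftIncl) (.inl i) = 0 from hs, zero_add] at this
  have h1 := hd (f ∘ leftIncl) (g ∘ leftIncl) (fun x y h => f1 _ _ (stack_left h))
    (fun x y h => g1 _ _ (stack_left h)) (fun x => hfg _)
    ((Finset.sum_congr rfl fun i _ => f2 (.inl i)).trans hsu)
    ((Finset.sum_congr rfl fun i _ => g2 (.inl i)).trans hsv)
  have h2 := he (f ∘ rightIncl) (g ∘ rightIncl) (fun x y h => f1 _ _ (stack_right h))
    (fun x y h => g1 _ _ (stack_right h)) (fun x => hfg _) (mid f1 f2 hsu) (mid g1 g2 hsv)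
  obtain rfl : f ∘ outerIncl = u := funext f2
  obtain rfl : g ∘ outerIncl = v := funext g2
  exact h1.trans h2

theorem wedge_pair {i j k l : Fin n} (hij : i ≠ j) (hk : k ∈ Set.cIoo i j) (hl : l ∈ Set.cIoo j i) :
    wedge (fun x => if x = i ∨ x = j then 1 else 0) (fun x => if x = k ∨ x = l then 1 else 0) =
      1 := by
  have hkl : k ≠ l := by
    rintro rfl
    rw [Fin.mem_cIoo_iff] at hk hl
    omega
  have h : ∀ (a b : Fin n) (hab : a ≠ b) (f : Fin n → ZMod 2),
      (∑ x, if x = a ∨ x = b then f x else 0) = f a + f b := by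
    intro a b hab f
    rw [← Finset.sum_filter, ← Finset.sum_pair hab]
    refine Finset.sum_congr ?_ fun _ _ => rfl
    ext; simp
  have h' : wedge (fun x => if x = i ∨ x = j then 1 else 0)
      (fun x => if x = k ∨ x = l then 1 else 0) =
      ∑ x, if x = i ∨ x = j then (∑ y, if y = k ∨ y = l then
        (if x < y then (1 : ZMod 2) else 0) else 0) else 0 := by
    refine Finset.sum_congr rfl fun x _ => ?_
    by_cases hx : x = i ∨ x = j
    · simp only [hx, if_true, one_mul]
      refine Finset.sum_congr rfl fun y _ => ?_
      by_cases hy : y = k ∨ y = l <;> simp [hy]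
    · simp only [hx, if_false, zero_mul, ite_self, Finset.sum_const_zero]
  rw [h', h i j hij, h k l hkl, h k l hkl]
  rw [Fin.mem_cIoo_iff] at hk hl
  simp only [Fin.lt_def]
  split_ifs <;> first | (exfalso; omega) | decide

/-- The indicator functions of two crossing edges on one side have crossing number one there and
vanish on the other side, which contradicts parity planarity. Without through strands there are no
defects, so the remaining conditions are empty. -/
theorem IsParityPlanar.isAnnular {d : BrauerDiagram n} (hd : d.IsParityPlanar)
    (h0 : d.HasNoThrough) : d.IsAnnular := by
  have hdl : d.leftState.defects = ∅ := by
    refine Finset.eq_empty_of_forall_notMem fun i hi => ?_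
    rw [Setoid.mem_defects] at hi
    obtain ⟨τ, _, t2, t3⟩ := d.exists_partner
    have hp : d.parts (.inl i) (τ (.inl i)) := (t3 _ _).2 (Or.inr rfl)
    rcases hq : τ (.inl i) with j | j
    · rw [hq] at hp
      exact t2 (.inl i) (by rw [hq, hi j hp])
    · exact h0 i j (hq ▸ hp)
  have hdr : d.rightState.defects = ∅ := by
    refine Finset.eq_empty_of_forall_notMem fun i hi => ?_
    rw [Setoid.mem_defects] at hi
    obtain ⟨τ, _, t2, t3⟩ := d.exists_partner
    have hp : d.parts (.inr i) (τ (.inr i)) := (t3 _ _).2 (Or.inr rfl)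
    rcases hq : τ (.inr i) with j | j
    · exact h0 j i (d.parts.symm (hq ▸ hp))
    · rw [hq] at hp
      exact t2 (.inr i) (by rw [hq, hi j hp])
  have hpair : ∀ {x y : Fin n ⊕ Fin n}, x ≠ y → d.parts x y → ∀ z w, d.parts z w →
      (if z = x ∨ z = y then (1 : ZMod 2) else 0) = if w = x ∨ w = y then 1 else 0 := by
    intro x y hxy hp z w hzw
    have key : ∀ z w, d.parts z w → (z = x ∨ z = y) → (w = x ∨ w = y) := by
      rintro z w hzw (rfl | rfl)
      · by_cases h : w = z
        · exact Or.inl h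
        · exact Or.inr (d.eq_of_parts hzw hp h hxy.symm)
      · by_cases h : w = z
        · exact Or.inr h
        · exact Or.inl (d.eq_of_parts hzw (d.parts.symm hp) h hxy)
    exact if_congr ⟨key z w hzw, key w z (d.parts.symm hzw)⟩ rfl rfl
  have hdisj : ∀ {x y z w : Fin n ⊕ Fin n}, x ≠ z → x ≠ w → y ≠ z → y ≠ w → ∀ v,
      (if v = x ∨ v = y then (1 : ZMod 2) else 0) * (if v = z ∨ v = w then 1 else 0) = 0 := by
    intro x y z w h1 h2 h3 h4 v
    split_ifs with h5 h6
    · rcases h5 with rfl | rfl <;> rcases h6 with h6 | h6 <;> contradiction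
    all_goals simp
  have hsum : ∀ {i j : Fin n}, i ≠ j →
      ∑ x : Fin n, (if x = i ∨ x = j then (1 : ZMod 2) else 0) = 0 := by
    intro i j hij
    rw [← Finset.sum_filter, show (Finset.univ.filter fun x => x = i ∨ x = j) = {i, j} by
      ext; simp, Finset.sum_pair hij]
    decide
  have hw0 : wedge (fun _ : Fin n => 0) (fun _ : Fin n => 0) = 0 := by simp [wedge]
  have hne : ∀ {i j k l : Fin n}, k ∈ Set.cIoo i j → l ∈ Set.cIoo j i →
      i ≠ k ∧ i ≠ l ∧ j ≠ k ∧ j ≠ l ∧ k ≠ l := by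
    intro i j k l hk hl
    rw [Fin.mem_cIoo_iff] at hk hl
    refine ⟨?_, ?_, ?_, ?_, ?_⟩ <;> rintro rfl <;> omega
  refine ⟨fun i j hij h => ⟨fun k hk l hl hkl => ?_, Or.inl (by simp [hdl])⟩,
    fun i j hij h => ⟨fun k hk l hl hkl => ?_, Or.inl (by simp [hdr])⟩,
    0, by simp [hdl], by simp [hdr], 1, one_mem _, fun i => i.elim0⟩
  · obtain ⟨n1, n2, n3, n4, n5⟩ := hne hk hl
    have := hd (fun x => if x = .inl i ∨ x = .inl j then 1 else 0)
      (fun x => if x = .inl k ∨ x = .inl l then 1 else 0) (hpair (by simpa using hij) h)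
      (hpair (by simpa using n5) hkl) (hdisj (by simpa) (by simpa) (by simpa) (by simpa))
      (by simpa using hsum hij) (by simpa using hsum n5)
    simp only [Function.comp_def, Sum.inl.injEq, reduceCtorEq, or_self, if_false] at this
    rw [wedge_pair hij hk hl, hw0] at this
    exact one_ne_zero this
  · obtain ⟨n1, n2, n3, n4, n5⟩ := hne hk hl
    have := hd (fun x => if x = .inr i ∨ x = .inr j then 1 else 0)
      (fun x => if x = .inr k ∨ x = .inr l then 1 else 0) (hpair (by simpa using hij) h)
      (hpair (by simpa using n5) hkl) (hdisj (by simpa) (by simpa) (by simpa) (by simpa))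
      (by simp) (by simp)
    simp only [Function.comp_def, Sum.inr.injEq, reduceCtorEq, or_self, if_false] at this
    rw [wedge_pair hij hk hl, hw0] at this
    exact one_ne_zero this.symm

end BrauerDiagram

namespace BrauerDiagram

variable {n : ℕ}

theorem HasNoThrough.defects_leftState {d : BrauerDiagram n} (h0 : d.HasNoThrough) :
    d.leftState.defects = ∅ := by
  refine Finset.eq_empty_of_forall_notMem fun i hi => ?_
  rw [Setoid.mem_defects] at hi
  obtain ⟨τ, _, t2, t3⟩ := d.exists_partner
  have hp : d.parts (.inl i) (τ (.inl i)) := (t3 _ _).2 (Or.inr rfl)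
  rcases hq : τ (.inl i) with j | j
  · rw [hq] at hp
    exact t2 (.inl i) (by rw [hq, hi j hp])
  · exact h0 i j (hq ▸ hp)

/-- The unprimed vertices are matched among themselves, so the sum of the constant function `1` over
them vanishes modulo two. -/
theorem HasNoThrough.even {d : BrauerDiagram n} (h0 : d.HasNoThrough) : Even n := by
  obtain ⟨τ, t1, _, t3⟩ := d.isLinkState_leftState.exists_partner
  have := Setoid.sum_eq_zero_of_stable t1 (v := fun _ => 1) (fun _ => rfl) Finset.univ
    (fun _ _ => Finset.mem_univ _) fun i _ hi => by
      have h := (t3 i).2 hi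
      rw [h0.defects_leftState] at h
      exact absurd h (Finset.notMem_empty i)
  rw [Finset.sum_const, Finset.card_univ, Fintype.card_fin, nsmul_one] at this
  exact (ZMod.natCast_eq_zero_iff_even).1 this

theorem HasNoThrough.not_isThrough [NeZero n] {d : BrauerDiagram n} (h0 : d.HasNoThrough) :
    ¬ d.IsThrough := fun h => by
  obtain ⟨j, hj⟩ := h 0
  exact h0 0 j hj

/-- The properties of annular diagrams that are inherited by their products. -/
def IsJones [NeZero n] (d : BrauerDiagram n) : Prop :=
  ((∃ k, d = rotation k) ∨ ∃ a, d.HasCup a) ∧ d.IsParityPlanar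

/-- A cup of the left factor persists; a rotation on the left merely moves a cup of the right
factor. -/
theorem IsJones.comp [NeZero n] {d e : BrauerDiagram n} (hd : d.IsJones) (he : e.IsJones) :
    (BrauerDiagram.comp d e).IsJones := by
  refine ⟨?_, hd.2.comp he.2⟩
  rcases hd.1 with ⟨k, rfl⟩ | ⟨a, ha⟩
  · rcases he.1 with ⟨l, rfl⟩ | ⟨a, ha⟩
    · exact Or.inl ⟨_, rotation_comp_rotation k l⟩
    · exact Or.inr ⟨_, ha.rotation_comp k⟩
  · exact Or.inr ⟨a, ha.comp e⟩

theorem IsAnnular.isJones [NeZero n] {d : BrauerDiagram n} (hd : d.IsAnnular) : d.IsJones :=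
  ⟨hd.rotation_or_hasCup, hd.isParityPlanar⟩

end BrauerDiagram

/-! ### Spans of sets of diagrams and projections onto them -/

namespace BrauerAlgebra

variable (R : Type*) [CommRing R] {n : ℕ} (δ : R)

/-- The span of a set of diagrams. -/
noncomputable def supported (Q : Set (BrauerDiagram n)) : Submodule R (BrauerAlgebra R n δ) :=
  Submodule.span R (diagram R δ '' Q)

variable {R δ}

theorem mem_supported {Q : Set (BrauerDiagram n)} {x : BrauerAlgebra R n δ} :
    x ∈ supported R δ Q ↔ ∀ d, (basis R δ).repr x d ≠ 0 → d ∈ Q := by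
  refine (basis R δ).mem_span_image.trans ⟨fun h d hd => h (by simpa using hd), fun h d hd => ?_⟩
  exact h d (by simpa using hd)

theorem diagram_mem_supported {Q : Set (BrauerDiagram n)} {d : BrauerDiagram n} (hd : d ∈ Q) :
    diagram R δ d ∈ supported R δ Q :=
  Submodule.subset_span ⟨d, hd, rfl⟩

theorem supported_mono {Q Q' : Set (BrauerDiagram n)} (h : Q ⊆ Q') :
    supported R δ Q ≤ supported R δ Q' :=
  Submodule.span_mono (Set.image_mono h)

theorem mem_supported_univ (x : BrauerAlgebra R n δ) : x ∈ supported R δ Set.univ :=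
  mem_supported.2 fun _ _ => trivial

theorem eq_zero_of_mem_supported_empty {x : BrauerAlgebra R n δ} (h : x ∈ supported R δ ∅) :
    x = 0 := by
  simpa [supported] using h

theorem supported_le_ker {Q : Set (BrauerDiagram n)} {M : Type*} [AddCommGroup M] [Module R M]
    (f : BrauerAlgebra R n δ →ₗ[R] M) (h : ∀ d ∈ Q, f (diagram R δ d) = 0)
    {x : BrauerAlgebra R n δ} (hx : x ∈ supported R δ Q) : f x = 0 := by
  have : supported R δ Q ≤ LinearMap.ker f := by
    rw [supported, Submodule.span_le]
    rintro _ ⟨d, hd, rfl⟩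
    exact h d hd
  exact this hx

theorem diagram_mul_mem_supported {Q Q' : Set (BrauerDiagram n)} (u : BrauerDiagram n)
    (h : ∀ d ∈ Q, BrauerDiagram.comp u d ∈ Q') {x : BrauerAlgebra R n δ}
    (hx : x ∈ supported R δ Q) : diagram R δ u * x ∈ supported R δ Q' := by
  induction hx using Submodule.span_induction with
  | mem x hx =>
    obtain ⟨d, hd, rfl⟩ := hx
    rw [diagram_mul_diagram]
    exact Submodule.smul_mem _ _ (diagram_mem_supported (h d hd))
  | zero => rw [mul_zero]; exact zero_mem _
  | add x y _ _ h1 h2 => rw [mul_add]; exact add_mem h1 h2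
  | smul r x _ h => rw [mul_smul_comm]; exact Submodule.smul_mem _ _ h

theorem mul_diagram_mem_supported {Q Q' : Set (BrauerDiagram n)} (u : BrauerDiagram n)
    (h : ∀ d ∈ Q, BrauerDiagram.comp d u ∈ Q') {x : BrauerAlgebra R n δ}
    (hx : x ∈ supported R δ Q) : x * diagram R δ u ∈ supported R δ Q' := by
  induction hx using Submodule.span_induction with
  | mem x hx =>
    obtain ⟨d, hd, rfl⟩ := hx
    rw [diagram_mul_diagram]
    exact Submodule.smul_mem _ _ (diagram_mem_supported (h d hd))
  | zero => rw [zero_mul]; exact zero_mem _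
  | add x y _ _ h1 h2 => rw [add_mul]; exact add_mem h1 h2
  | smul r x _ h => rw [smul_mul_assoc]; exact Submodule.smul_mem _ _ h

theorem mul_mem_supported {Q : Set (BrauerDiagram n)}
    (h : ∀ d ∈ Q, ∀ e, BrauerDiagram.comp d e ∈ Q) {x : BrauerAlgebra R n δ}
    (hx : x ∈ supported R δ Q) (y : BrauerAlgebra R n δ) : x * y ∈ supported R δ Q := by
  induction y using diagram_induction with
  | hd e => exact mul_diagram_mem_supported e (fun d hd => h d hd e) hx
  | ha a b h1 h2 => rw [mul_add]; exact add_mem h1 h2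
  | hs r a h => rw [mul_smul_comm]; exact Submodule.smul_mem _ _ h

theorem mul_mem_supported_right {Q : Set (BrauerDiagram n)}
    (h : ∀ d ∈ Q, ∀ e, BrauerDiagram.comp e d ∈ Q) {x : BrauerAlgebra R n δ}
    (hx : x ∈ supported R δ Q) (y : BrauerAlgebra R n δ) : y * x ∈ supported R δ Q := by
  induction y using diagram_induction with
  | hd e => exact diagram_mul_mem_supported e (fun d hd => h d hd e) hx
  | ha a b h1 h2 => rw [add_mul]; exact add_mem h1 h2
  | hs r a h => rw [smul_mul_assoc]; exact Submodule.smul_mem _ _ h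

open scoped Classical in
/-- The projection onto the span of a set of diagrams. -/
noncomputable def restrict (Q : Set (BrauerDiagram n)) :
    BrauerAlgebra R n δ →ₗ[R] BrauerAlgebra R n δ :=
  (basis R δ).constr R fun d => if d ∈ Q then diagram R δ d else 0

theorem restrict_of_mem {Q : Set (BrauerDiagram n)} {d : BrauerDiagram n} (h : d ∈ Q) :
    restrict Q (diagram R δ d) = diagram R δ d := by
  rw [restrict, diagram, Module.Basis.constr_basis, if_pos h]; rfl

theorem restrict_of_notMem {Q : Set (BrauerDiagram n)} {d : BrauerDiagram n} (h : d ∉ Q) :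
    restrict Q (diagram R δ d) = 0 := by
  rw [restrict, diagram, Module.Basis.constr_basis, if_neg h]

theorem restrict_mem (Q : Set (BrauerDiagram n)) (x : BrauerAlgebra R n δ) :
    restrict Q x ∈ supported R δ Q := by
  induction x using diagram_induction with
  | hd d =>
    by_cases h : d ∈ Q
    · rw [restrict_of_mem h]; exact diagram_mem_supported h
    · rw [restrict_of_notMem h]; exact zero_mem _
  | ha a b h1 h2 => rw [map_add]; exact add_mem h1 h2
  | hs r a h => rw [map_smul]; exact Submodule.smul_mem _ _ h

theorem restrict_eq_self {Q : Set (BrauerDiagram n)} {x : BrauerAlgebra R n δ}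
    (hx : x ∈ supported R δ Q) : restrict Q x = x := by
  rw [← sub_eq_zero]
  exact supported_le_ker (restrict Q - LinearMap.id) (fun d hd => by
    rw [LinearMap.sub_apply, restrict_of_mem hd]; exact sub_self _) hx

theorem sub_restrict_mem {Q Q' : Set (BrauerDiagram n)} {x : BrauerAlgebra R n δ}
    (hx : x ∈ supported R δ (Q ∪ Q')) : x - restrict Q x ∈ supported R δ Q' := by
  induction hx using Submodule.span_induction with
  | mem x hx =>
    obtain ⟨d, hd, rfl⟩ := hx
    by_cases h : d ∈ Q
    · rw [restrict_of_mem h, sub_self]; exact zero_mem _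
    · rw [restrict_of_notMem h, sub_zero]
      exact diagram_mem_supported (hd.resolve_left h)
  | zero => rw [map_zero, sub_zero]; exact zero_mem _
  | add x y _ _ h1 h2 => rw [map_add, add_sub_add_comm]; exact add_mem h1 h2
  | smul r x _ h => rw [map_smul, ← smul_sub]; exact Submodule.smul_mem _ _ h

end BrauerAlgebra

/-! ### Diagrammatic description of the Jones algebra and of its ideal -/

section JonesSpan

open BrauerAlgebra

variable {R : Type*} [CommRing R] {n : ℕ} {δ : R}

theorem diagram_mem_jones {d : BrauerDiagram n} (h : d.IsAnnular) :
    diagram R δ d ∈ JonesAnnularAlgebra R n δ :=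
  Algebra.subset_adjoin ⟨d, h, rfl⟩

variable [NeZero n]

/-- Products of annular diagrams are diagrams times powers of `δ`. The power is kept because it is
not shown here that `d` itself belongs to the subalgebra. -/
theorem jones_eq_span {x : BrauerAlgebra R n δ} (hx : x ∈ JonesAnnularAlgebra R n δ) :
    x ∈ Submodule.span R {y | ∃ (k : ℕ) (d : BrauerDiagram n), d.IsJones ∧
      y ∈ JonesAnnularAlgebra R n δ ∧ y = δ ^ k • diagram R δ d} := by
  have h : x ∈ Subalgebra.toSubmodule (JonesAnnularAlgebra R n δ) := hx
  rw [JonesAnnularAlgebra, Algebra.adjoin_eq_span] at h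
  refine Submodule.span_mono (fun y hy => ?_) h
  have hy' : y ∈ JonesAnnularAlgebra R n δ := by
    have : y ∈ Subalgebra.toSubmodule (JonesAnnularAlgebra R n δ) := by
      rw [JonesAnnularAlgebra, Algebra.adjoin_eq_span]
      exact Submodule.subset_span hy
    exact this
  have key : ∃ (k : ℕ) (d : BrauerDiagram n), d.IsJones ∧ y = δ ^ k • diagram R δ d := by
    clear hy' h
    induction hy using Submonoid.closure_induction with
    | mem y hy =>
      obtain ⟨d, hd, rfl⟩ := hy
      exact ⟨0, d, hd.isJones, by rw [pow_zero, one_smul]⟩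
    | one =>
      refine ⟨0, _, (BrauerDiagram.isAnnular_rotation 0).isJones, ?_⟩
      rw [pow_zero, one_smul, BrauerDiagram.rotation_zero, one_def]
    | mul a b ha hb h1 h2 =>
      obtain ⟨k, d, hd, rfl⟩ := h1
      obtain ⟨l, e, he, rfl⟩ := h2
      refine ⟨k + l + BrauerDiagram.loops d e, _, hd.comp he, ?_⟩
      rw [smul_mul_smul_comm, diagram_mul_diagram, smul_smul, ← pow_add, ← pow_add]
  obtain ⟨k, d, hd, he⟩ := key
  exact ⟨k, d, hd, hy', he⟩

/-- The spanning elements are multiples of single diagrams, so a projection either keeps or kills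
each of them. This lets elements of the subalgebra be split according to their support. -/
theorem restrict_mem_jones (Q : Set (BrauerDiagram n)) {x : BrauerAlgebra R n δ}
    (hx : x ∈ JonesAnnularAlgebra R n δ) : restrict Q x ∈ JonesAnnularAlgebra R n δ := by
  have h := jones_eq_span hx
  clear hx
  induction h using Submodule.span_induction with
  | mem y hy =>
    obtain ⟨k, d, -, hy, rfl⟩ := hy
    rw [map_smul]
    by_cases h : d ∈ Q
    · rwa [restrict_of_mem h]
    · rw [restrict_of_notMem h, smul_zero]; exact zero_mem _
  | zero => rw [map_zero]; exact zero_mem _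
  | add x y _ _ h1 h2 => rw [map_add]; exact add_mem h1 h2
  | smul r x _ h => rw [map_smul]; exact Subalgebra.smul_mem _ h r

/-- An element of `J_n(δ)` supported on a set of diagrams is a combination of multiples of diagrams
in this set. -/
theorem jones_induction {Q : Set (BrauerDiagram n)} {p : BrauerAlgebra R n δ → Prop}
    (hd : ∀ k, ∀ d ∈ Q, d.IsJones → δ ^ k • diagram R δ d ∈ JonesAnnularAlgebra R n δ →
      p (δ ^ k • diagram R δ d))
    (h0 : p 0) (ha : ∀ a b, p a → p b → p (a + b)) (hs : ∀ (r : R) a, p a → p (r • a))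
    {x : BrauerAlgebra R n δ} (hx : x ∈ JonesAnnularAlgebra R n δ) (hQ : x ∈ supported R δ Q) :
    p x := by
  rw [← restrict_eq_self hQ]
  have := jones_eq_span hx
  clear hx hQ
  induction this using Submodule.span_induction with
  | mem y hy =>
    obtain ⟨k, d, hj, hy, rfl⟩ := hy
    rw [map_smul]
    by_cases h : d ∈ Q
    · rw [restrict_of_mem h]; exact hd k d h hj hy
    · rw [restrict_of_notMem h, smul_zero]; exact h0
  | zero => rw [map_zero]; exact h0
  | add x y _ _ h1 h2 => rw [map_add]; exact ha _ _ h1 h2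
  | smul r x _ h => rw [map_smul]; exact hs r _ h

/-- Absence of through strands is inherited by composites on either side. Conversely, a diagram
without through strands that occurs in the subalgebra is parity planar, hence annular, hence a
generator of the ideal; this is where the crossing form pays off. -/
theorem mem_jonesIdeal_iff {x : JonesAnnularAlgebra R n δ} : x ∈ jonesIdeal R n δ ↔
    (x : BrauerAlgebra R n δ) ∈ supported R δ {d : BrauerDiagram n | d.HasNoThrough} := by
  constructor
  · intro hx
    have hx' := TwoSidedIdeal.mem_asIdeal.1 hx
    clear hx
    refine TwoSidedIdeal.span_induction
      (p := fun (y : JonesAnnularAlgebra R n δ) _ => (y : BrauerAlgebra R n δ) ∈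
        supported R δ {d : BrauerDiagram n | d.HasNoThrough})
      ?_ (zero_mem _) (fun x y _ _ h1 h2 => add_mem h1 h2) (fun x _ h => neg_mem h)
      (fun a x _ h => mul_mem_supported_right
        (Q := {d : BrauerDiagram n | d.HasNoThrough}) (fun d hd e => hd.comp_right e) h _)
      (fun b x _ h => mul_mem_supported
        (Q := {d : BrauerDiagram n | d.HasNoThrough}) (fun d hd e => hd.comp_left e) h _) hx'
    rintro x ⟨d, -, hd, hx⟩
    rw [hx]
    exact diagram_mem_supported hd
  · intro hx
    have key : ∃ h : (x : BrauerAlgebra R n δ) ∈ JonesAnnularAlgebra R n δ,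
        (⟨x, h⟩ : JonesAnnularAlgebra R n δ) ∈ jonesIdeal R n δ := by
      refine jones_induction (Q := {d : BrauerDiagram n | d.HasNoThrough})
        (p := fun x => ∃ h : x ∈ JonesAnnularAlgebra R n δ,
          (⟨x, h⟩ : JonesAnnularAlgebra R n δ) ∈ jonesIdeal R n δ) ?_ ?_ ?_ ?_ x.2 hx
      · intro k d hd hj hy
        have hann := hj.2.isAnnular hd
        refine ⟨hy, ?_⟩
        have h1 : (⟨diagram R δ d, diagram_mem_jones hann⟩ : JonesAnnularAlgebra R n δ) ∈
            jonesIdeal R n δ :=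
          TwoSidedIdeal.mem_asIdeal.2 (TwoSidedIdeal.subset_span ⟨d, hann, hd, rfl⟩)
        have h2 := (jonesIdeal R n δ).mul_mem_left (algebraMap R _ (δ ^ k)) h1
        rwa [← Algebra.smul_def] at h2
      · exact ⟨zero_mem _, zero_mem _⟩
      · rintro a b ⟨h1, h2⟩ ⟨h3, h4⟩
        exact ⟨add_mem h1 h3, add_mem h2 h4⟩
      · rintro r a ⟨h1, h2⟩
        have h3 := (jonesIdeal R n δ).mul_mem_left (algebraMap R _ r) h2
        rw [← Algebra.smul_def] at h3
        exact ⟨Subalgebra.smul_mem _ h1 r, h3⟩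
    exact key.2

end JonesSpan

open BrauerAlgebra

/-! ### Right ideals of quotients spanned by diagrams -/

section JonesRightIdeal

variable {R : Type u} [CommRing R] {n : ℕ} {δ : R} {A : Type u} [Ring A] [Algebra R A]
  (p : JonesAnnularAlgebra R n δ →ₐ[R] A)

/-- The right ideal of a quotient of `J_n(δ)` generated by the images of the elements supported on
a set of diagrams. -/
def jonesRightIdeal (Q : Set (BrauerDiagram n)) : Submodule Aᵐᵒᵖ A :=
  Submodule.span Aᵐᵒᵖ {a | ∃ y, p y = a ∧ (y : BrauerAlgebra R n δ) ∈ supported R δ Q}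

/-- A set of diagrams is closed under composition with diagrams on the right. -/
def IsRightClosed (Q : Set (BrauerDiagram n)) : Prop :=
  ∀ d ∈ Q, ∀ e, BrauerDiagram.comp d e ∈ Q

theorem IsRightClosed.union {Q Q' : Set (BrauerDiagram n)} (h : IsRightClosed Q)
    (h' : IsRightClosed Q') : IsRightClosed (Q ∪ Q') :=
  fun d hd e => hd.imp (h d · e) (h' d · e)

theorem IsRightClosed.inter {Q Q' : Set (BrauerDiagram n)} (h : IsRightClosed Q)
    (h' : IsRightClosed Q') : IsRightClosed (Q ∩ Q') :=
  fun d hd e => ⟨h d hd.1 e, h' d hd.2 e⟩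

variable {p} (hp : Function.Surjective p)

include hp

theorem mem_jonesRightIdeal {Q : Set (BrauerDiagram n)} (hQ : IsRightClosed Q) {a : A} :
    a ∈ jonesRightIdeal p Q ↔ ∃ y, p y = a ∧ (y : BrauerAlgebra R n δ) ∈ supported R δ Q := by
  refine ⟨fun h => ?_, fun h => Submodule.subset_span h⟩
  induction h using Submodule.span_induction with
  | mem x hx => exact hx
  | zero => exact ⟨0, map_zero p, zero_mem _⟩
  | add x y _ _ h1 h2 =>
    obtain ⟨a, rfl, ha⟩ := h1
    obtain ⟨b, rfl, hb⟩ := h2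
    exact ⟨a + b, map_add p a b, add_mem ha hb⟩
  | smul c x _ h =>
    obtain ⟨y, rfl, hy⟩ := h
    obtain ⟨z, hz⟩ := hp c.unop
    refine ⟨y * z, ?_, mul_mem_supported hQ hy _⟩
    rw [map_mul, hz]
    rfl

theorem jonesRightIdeal_union [NeZero n] {Q Q' : Set (BrauerDiagram n)} (hQ : IsRightClosed Q)
    (hQ' : IsRightClosed Q') :
    jonesRightIdeal p (Q ∪ Q') = jonesRightIdeal p Q ⊔ jonesRightIdeal p Q' := by
  ext a
  rw [Submodule.mem_sup, mem_jonesRightIdeal hp (hQ.union hQ')]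
  constructor
  · rintro ⟨y, rfl, hy⟩
    let z : JonesAnnularAlgebra R n δ := ⟨restrict Q y.1, restrict_mem_jones Q y.2⟩
    refine ⟨p z, (mem_jonesRightIdeal hp hQ).2 ⟨z, rfl, restrict_mem Q _⟩, p (y - z),
      (mem_jonesRightIdeal hp hQ').2 ⟨y - z, rfl, sub_restrict_mem hy⟩, ?_⟩
    rw [← map_add, add_sub_cancel]
  · rintro ⟨b, hb, c, hc, rfl⟩
    obtain ⟨y, rfl, hy⟩ := (mem_jonesRightIdeal hp hQ).1 hb
    obtain ⟨z, rfl, hz⟩ := (mem_jonesRightIdeal hp hQ').1 hc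
    exact ⟨y + z, map_add p y z, add_mem (supported_mono Set.subset_union_left hy)
      (supported_mono Set.subset_union_right hz)⟩

variable {Z : Set (BrauerDiagram n)}
  (hZ : ∀ y, p y = 0 ↔ (y : BrauerAlgebra R n δ) ∈ supported R δ Z)

include hZ

/-- Two lifts of a common element differ by something supported on `Z`, which lies in `Q'`; so the
lift supported on `Q` is supported on `Q'` too. This is why `Z` is added to the sets of diagrams
below. -/
theorem jonesRightIdeal_inter {Q Q' : Set (BrauerDiagram n)} (hQ : IsRightClosed Q)
    (hQ' : IsRightClosed Q') (hZQ' : Z ⊆ Q') :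
    jonesRightIdeal p (Q ∩ Q') = jonesRightIdeal p Q ⊓ jonesRightIdeal p Q' := by
  ext a
  rw [Submodule.mem_inf, mem_jonesRightIdeal hp (hQ.inter hQ'), mem_jonesRightIdeal hp hQ,
    mem_jonesRightIdeal hp hQ']
  constructor
  · rintro ⟨y, rfl, hy⟩
    exact ⟨⟨y, rfl, supported_mono Set.inter_subset_left hy⟩,
      ⟨y, rfl, supported_mono Set.inter_subset_right hy⟩⟩
  · rintro ⟨⟨y, rfl, hy⟩, ⟨z, hzy, hz⟩⟩
    have h1 : p (y - z) = 0 := by rw [map_sub, hzy, sub_self]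
    have h2 : (y : BrauerAlgebra R n δ) ∈ supported R δ Q' := by
      have := add_mem (supported_mono hZQ' ((hZ _).1 h1)) hz
      rwa [AddSubgroupClass.coe_sub, sub_add_cancel] at this
    exact ⟨y, rfl, mem_supported.2 fun d hd => ⟨mem_supported.1 hy d hd, mem_supported.1 h2 d hd⟩⟩

theorem isExcisive_jonesRightIdeal_of_mul_eq [NeZero n] {ε : A →ₐ[R] R} {Q : Set (BrauerDiagram n)}
    (hQ : IsRightClosed Q) (hZr : IsRightClosed Z) (e : JonesAnnularAlgebra R n δ)
    (he : (e : BrauerAlgebra R n δ) ∈ supported R δ Q)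
    (h : ∀ d ∈ Q, (e : BrauerAlgebra R n δ) * diagram R δ d = diagram R δ d) :
    IsExcisive ε (jonesRightIdeal p (Q ∪ Z)) := by
  refine .of_idempotent (p e) ?_ fun x hx => ?_
  · exact Submodule.subset_span ⟨e, rfl, supported_mono Set.subset_union_left he⟩
  · obtain ⟨y, rfl, hy⟩ := (mem_jonesRightIdeal hp (hQ.union hZr)).1 hx
    let r : JonesAnnularAlgebra R n δ := ⟨restrict Q y.1, restrict_mem_jones Q y.2⟩
    have hr : p y = p r := by
      rw [← sub_eq_zero, ← map_sub]
      exact (hZ _).2 (sub_restrict_mem hy)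
    have her : e * r = r := Subtype.ext <| sub_eq_zero.1 <|
      supported_le_ker (LinearMap.mulLeft R (e : BrauerAlgebra R n δ) - LinearMap.id)
        (fun d hd => sub_eq_zero.2 (h d hd)) (restrict_mem Q y.1)
    rw [hr, ← map_mul, her]

end JonesRightIdeal

/-! ### Diagrams with prescribed cups -/

namespace BrauerDiagram

variable {n : ℕ} [NeZero n]

/-- The diagrams in which `a` and `a + 1` are joined for all `a` in a given set. -/
def withCups (S : Finset (Fin n)) : Set (BrauerDiagram n) := {d | ∀ a ∈ S, d.HasCup a}

theorem isRightClosed_withCups (S : Finset (Fin n)) : IsRightClosed (withCups S) :=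
  fun _ hd e a ha => (hd a ha).comp e

theorem withCups_insert [DecidableEq (Fin n)] (a : Fin n) (S : Finset (Fin n)) :
    withCups (insert a S) = {d | d.HasCup a} ∩ withCups S := by
  ext d
  simp [withCups]

/-- Two cups of a diagram are equal or disjoint. -/
theorem HasCup.eq_or {d : BrauerDiagram n} {a b : Fin n} (ha : d.HasCup a) (hb : d.HasCup b) :
    b = a ∨ (b = a + 1 ∧ b + 1 = a) ∨ (b ≠ a ∧ b ≠ a + 1 ∧ b + 1 ≠ a ∧ b + 1 ≠ a + 1) := by
  by_cases h1 : b = a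
  · exact Or.inl h1
  refine Or.inr ?_
  by_cases h2 : b = a + 1
  · refine Or.inl ⟨h2, ?_⟩
    have h3 : d.parts (.inl b) (.inl a) := h2 ▸ d.parts.symm ha.2
    exact Sum.inl_injective (d.eq_of_parts hb.2 h3 (by simpa using hb.1.symm)
      (by simpa using Ne.symm h1))
  · by_cases h3 : b + 1 = a
    · exfalso
      have h4 : d.parts (.inl a) (.inl b) := h3 ▸ d.parts.symm hb.2
      exact h2 (Sum.inl_injective (d.eq_of_parts h4 ha.2 (by simpa using h1)
        (by simpa using ha.1.symm)))
    · exact Or.inr ⟨h1, h2, h3, fun h => h1 (add_right_cancel h)⟩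

theorem HasCup.cupCap_comp {d : BrauerDiagram n} {a b c : Fin n} (hb : d.HasCup b)
    (h1 : b ≠ a ∧ b ≠ c) (h2 : b + 1 ≠ a ∧ b + 1 ≠ c) :
    (BrauerDiagram.comp (cupCap a c) d).HasCup b :=
  ⟨hb.1, cupCap_comp_left hb.2 h1 h2⟩

end BrauerDiagram

/-! ### Left units for prescribed cups -/

section Units

open BrauerDiagram

variable {R : Type u} [CommRing R] {n : ℕ} [NeZero n] {δ : R}

/-- The unit is the product of the elements `δ⁻¹ U_a` over `a` in `S`. The cups of a single diagram
are equal or disjoint, so a further factor does not destroy the earlier cups. -/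
theorem exists_left_unit_of_isUnit (hδ : IsUnit δ) (S : Finset (Fin n)) :
    (∃ e ∈ JonesAnnularAlgebra R n δ, e ∈ supported R δ (withCups S) ∧
      ∀ d ∈ withCups S, e * diagram R δ d = diagram R δ d) ∨ withCups S = ∅ := by
  induction S using Finset.induction with
  | empty =>
    refine Or.inl ⟨1, one_mem _, ?_, fun d _ => one_mul _⟩
    exact diagram_mem_supported (by simp [withCups])
  | insert a S _ ih =>
    refine or_iff_not_imp_right.2 fun hne => ?_
    obtain ⟨d₀, h₀⟩ := Set.nonempty_iff_ne_empty.2 hne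
    have ha : d₀.HasCup a := h₀ a (Finset.mem_insert_self _ _)
    obtain ⟨e, he, heS, hed⟩ := ih.resolve_right
      (Set.nonempty_iff_ne_empty.1 ⟨d₀, fun b hb => h₀ b (Finset.mem_insert_of_mem hb)⟩)
    refine ⟨(↑hδ.unit⁻¹ : R) • (diagram R δ (cupCap a (a + 1)) * e), ?_, ?_, fun d hd => ?_⟩
    · exact Subalgebra.smul_mem _ (mul_mem (diagram_mem_jones (isAnnular_cupCap ha.1)) he) _
    · refine Submodule.smul_mem _ _ (diagram_mul_mem_supported _ (fun d hd b hb => ?_) heS)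
      have hca : (comp (cupCap a (a + 1)) d).HasCup a := ⟨ha.1, comp_left _ (cupCap_left ha.1)⟩
      rcases ha.eq_or (h₀ b hb) with h | ⟨h1, h2⟩ | ⟨h1, h2, h3, h4⟩
      · exact h ▸ hca
      -- This case occurs only for `n = 2`, where the cups at `a` and at `a + 1` are the same edge.
      · refine ⟨(h₀ b hb).1, ?_⟩
        rw [h2, h1]
        exact (comp _ d).parts.symm hca.2
      · exact (hd b (Finset.mem_of_mem_insert_of_ne hb h1)).cupCap_comp ⟨h1, h2⟩ ⟨h3, h4⟩
    · rw [smul_mul_assoc, mul_assoc, hed d fun b hb => hd b (Finset.mem_insert_of_mem hb),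
        cupCap_mul_self ha.1 (hd a (Finset.mem_insert_self _ _)).2, smul_smul,
        IsUnit.val_inv_mul, one_smul]

/-- If all the elements of `S` are the left ends of cups of a diagram with a through strand, then
some such cup is followed by a vertex that lies on none of these cups. -/
theorem BrauerDiagram.exists_add_two_notMem {d : BrauerDiagram n} {S : Finset (Fin n)}
    (hS : S.Nonempty) (hd : d ∈ withCups S) (h : ¬ d.HasNoThrough) :
    ∃ a ∈ S, ∀ b ∈ S, b ≠ a + 1 + 1 ∧ b + 1 ≠ a + 1 + 1 := by
  by_contra! hcon
  apply h
  obtain ⟨a₀, ha₀⟩ := hS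
  -- If every cup of `S` is followed by another, then, going around the circle from `a₀`, all
  -- vertices lie on cups and no through strand is left.
  have key : ∀ k : ℕ, ∃ a ∈ S, a₀ + k • 1 = a ∨ a₀ + k • 1 = a + 1 := by
    intro k
    induction k using Nat.strong_induction_on with
    | _ k ih =>
      match k with
      | 0 => exact ⟨a₀, ha₀, Or.inl (by simp)⟩
      | 1 => exact ⟨a₀, ha₀, Or.inr (by simp)⟩
      | k + 2 =>
        obtain ⟨a, ha, h1 | h1⟩ := ih k (by omega)
        · obtain ⟨b, hb, h2⟩ := hcon a ha
          have h3 : a₀ + (k + 2) • 1 = a + 1 + 1 := by rw [← h1, add_smul, two_smul]; abel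
          rw [h3]
          by_cases h4 : b = a + 1 + 1
          · exact ⟨b, hb, Or.inl h4.symm⟩
          · exact ⟨b, hb, Or.inr (h2 h4).symm⟩
        · obtain ⟨b, hb, h2⟩ := hcon a ha
          have h3 : a₀ + (k + 2) • 1 = a + 1 + 1 + 1 := by
            rw [add_assoc (a + 1), ← h1, add_smul, two_smul]; abel
          by_cases h4 : b = a + 1 + 1
          · exact ⟨b, hb, Or.inr (by rw [h3, h4])⟩
          -- Again only possible for `n = 2`: the cup following `a` is the same edge as the cup at
          -- `a`, so `a + 1 + 1 = a`.
          · have h5 : b = a + 1 := add_right_cancel (h2 h4)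
            refine ⟨a, ha, Or.inr ?_⟩
            rcases (hd a ha).eq_or (hd b hb) with h6 | ⟨-, h6⟩ | ⟨-, h6, -⟩
            · exact absurd (h6.symm.trans h5) (hd a ha).1
            · rw [h3, ← h5, h6, h5]
            · exact absurd h5 h6
  intro i j hij
  obtain ⟨a, ha, h1⟩ := key (i - a₀).val
  rw [Fin.nsmul_one_eq, add_sub_cancel] at h1
  rcases h1 with rfl | rfl
  · have := d.eq_of_parts (hd i ha).2 hij (by simpa using (hd i ha).1.symm) (by simp)
    simp at this
  · have := d.eq_of_parts (d.parts.symm (hd a ha).2) hij (by simpa using (hd a ha).1) (by simp)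
    simp at this

/-- Choose a cup `a` of `S` followed by a vertex on no cup of `S`. If `e` is a left unit for the
other cups, then `U_a U_{a+1} e` is one for `S`: the zigzag acts as the identity on diagrams with a
cup at `a`, and `U_{a+1}` touches none of the other cups. -/
theorem exists_left_unit_of_zigzag (S : Finset (Fin n)) :
    (∃ e ∈ JonesAnnularAlgebra R n δ, e ∈ supported R δ (withCups S) ∧
      ∀ d ∈ withCups S, e * diagram R δ d = diagram R δ d) ∨
      withCups S ⊆ {d | d.HasNoThrough} := by
  induction hm : S.card generalizing S with
  | zero =>
    rw [Finset.card_eq_zero] at hm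
    subst hm
    refine Or.inl ⟨1, one_mem _, ?_, fun d _ => one_mul _⟩
    exact diagram_mem_supported (by simp [withCups])
  | succ m ih =>
    refine or_iff_not_imp_right.2 fun hne => ?_
    obtain ⟨d₀, h₀, hd₀⟩ := Set.not_subset.1 hne
    obtain ⟨a, haS, ha2⟩ := exists_add_two_notMem (Finset.card_pos.1 (by omega)) h₀ hd₀
    have ha := h₀ a haS
    have h12 : a + 1 ≠ a + 1 + 1 := fun h => ha.1 (add_right_cancel h)
    have h02 : a ≠ a + 1 + 1 := (ha2 a haS).1
    have herase : ∀ {d : BrauerDiagram n}, d ∈ withCups S → d ∈ withCups (S.erase a) :=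
      fun hd b hb => hd b (Finset.mem_of_mem_erase hb)
    obtain ⟨e, he, heS, hed⟩ := (ih (S.erase a) (by rw [Finset.card_erase_of_mem haS, hm]; rfl)
      ).resolve_right fun h => hd₀ (h (herase h₀))
    refine ⟨diagram R δ (cupCap a (a + 1)) * (diagram R δ (cupCap (a + 1) (a + 1 + 1)) * e),
      ?_, ?_, fun d hd => ?_⟩
    · exact mul_mem (diagram_mem_jones (isAnnular_cupCap ha.1))
        (mul_mem (diagram_mem_jones (isAnnular_cupCap h12)) he)
    -- The exceptional case `b = a + 1` of coinciding edges is excluded, since then `b + 1 = a + 1 +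
    -- 1` would lie on a cup of `S`.
    · have hdisj : ∀ b ∈ S.erase a,
          b ≠ a ∧ b ≠ a + 1 ∧ b + 1 ≠ a ∧ b + 1 ≠ a + 1 := fun b hb => by
        obtain ⟨hba, hbS⟩ := Finset.mem_erase.1 hb
        rcases ha.eq_or (h₀ b hbS) with h | ⟨h, -⟩ | h
        · exact absurd h hba
        · exact absurd (congrArg (· + 1) h) (ha2 b hbS).2
        · exact h
      refine diagram_mul_mem_supported (Q := withCups (S.erase a)) _ (fun d hd => ?_)
        (diagram_mul_mem_supported (Q := withCups (S.erase a)) (Q' := withCups (S.erase a)) _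
          (fun d hd => ?_) heS) <;> intro b hb
      · by_cases hba : b = a
        · subst hba
          exact ⟨ha.1, comp_left _ (cupCap_left ha.1)⟩
        · have hb' := Finset.mem_erase.2 ⟨hba, hb⟩
          obtain ⟨h1, h2, h3, h4⟩ := hdisj b hb'
          exact (hd b hb').cupCap_comp ⟨h1, h2⟩ ⟨h3, h4⟩
      · obtain ⟨h1, h2, h3, h4⟩ := hdisj b hb
        have h5 := ha2 b (Finset.mem_of_mem_erase hb)
        exact (hd b hb).cupCap_comp ⟨h2, h5.1⟩ ⟨h4, h5.2⟩
    · rw [mul_assoc, mul_assoc, hed d (herase hd),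
        cupCap_mul_cupCap_mul ha.1 h12 h02 (hd a haS).2]

end Units

/-! ### Inclusion–exclusion over the positions of cups -/

section Cups

open BrauerDiagram

variable {R : Type u} [CommRing R] {n : ℕ} [NeZero n] {δ : R} {A : Type u} [Ring A] [Algebra R A]
  {p : JonesAnnularAlgebra R n δ →ₐ[R] A} {ε : A →ₐ[R] R}

omit [NeZero n] in
theorem augmentation_eq_zero_of_mem_supported {Q : Set (BrauerDiagram n)}
    (hQ : ∀ d ∈ Q, ¬ d.IsThrough) {y : JonesAnnularAlgebra R n δ}
    (hy : (y : BrauerAlgebra R n δ) ∈ supported R δ Q) : jonesAugmentation R n δ y = 0 :=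
  supported_le_ker augmentationMap
    (fun d hd => augmentationMap_diagram_of_not_isThrough (hQ d hd)) hy

/-- A right ideal spanned by diagrams with prescribed cups is excisive, provided that it is
generated by a left unit whenever it is not zero. -/
theorem isExcisive_cups (hp : Function.Surjective p) (hε : ε.comp p = jonesAugmentation R n δ)
    {Z : Set (BrauerDiagram n)} (hZ : ∀ y, p y = 0 ↔ (y : BrauerAlgebra R n δ) ∈ supported R δ Z)
    (hZr : IsRightClosed Z) (hZt : ∀ d ∈ Z, ¬ d.IsThrough)
    (hunit : ∀ S : Finset (Fin n), (∃ e ∈ JonesAnnularAlgebra R n δ,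
      e ∈ supported R δ (withCups S) ∧
        ∀ d ∈ withCups S, e * diagram R δ d = diagram R δ d) ∨ withCups S ⊆ Z) :
    IsExcisive ε (jonesRightIdeal p ({d | ∃ a, d.HasCup a} ∪ Z)) := by
  have hbot : jonesRightIdeal p Z = ⊥ := by
    rw [eq_bot_iff]
    intro x hx
    obtain ⟨y, rfl, hy⟩ := (mem_jonesRightIdeal hp hZr).1 hx
    exact (hZ y).2 hy
  have hS : ∀ S : Finset (Fin n), IsExcisive ε (jonesRightIdeal p (withCups S ∪ Z)) := by
    intro S
    rcases hunit S with ⟨e, he, heS, hed⟩ | h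
    · exact isExcisive_jonesRightIdeal_of_mul_eq hp hZ (isRightClosed_withCups S) hZr ⟨e, he⟩
        heS hed
    · rw [Set.union_eq_right.2 h, hbot]
      exact .bot
  have hr : ∀ T : Finset (Fin n), IsRightClosed {d : BrauerDiagram n | ∃ b ∈ T, d.HasCup b} :=
    fun T d ⟨b, hb, h⟩ e => ⟨b, hb, h.comp e⟩
  -- The cups in `S` are prescribed and at least one cup in `T` is required. The statement covers
  -- all `S` because the intersection in the Mayer–Vietoris step moves `a` from `T` to `S`.
  have key : ∀ T S : Finset (Fin n),
      IsExcisive ε (jonesRightIdeal p (withCups S ∩ {d | ∃ b ∈ T, d.HasCup b} ∪ Z)) := by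
    intro T
    induction T using Finset.induction with
    | empty =>
      intro S
      have : withCups S ∩ {d : BrauerDiagram n | ∃ b ∈ (∅ : Finset (Fin n)), d.HasCup b} ∪ Z =
          Z := by
        simp
      rw [this, hbot]
      exact .bot
    | insert a T _ ih =>
      intro S
      have h1 : withCups S ∩ {d : BrauerDiagram n | ∃ b ∈ insert a T, d.HasCup b} ∪ Z =
          (withCups (insert a S) ∪ Z) ∪ (withCups S ∩ {d | ∃ b ∈ T, d.HasCup b} ∪ Z) := by
        rw [withCups_insert]
        ext d
        simp only [Set.mem_union, Set.mem_inter_iff, Set.mem_ofPred_eq, Finset.exists_mem_insert]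
        grind
      have h2 : withCups (insert a S) ∩ {d : BrauerDiagram n | ∃ b ∈ T, d.HasCup b} ∪ Z =
          (withCups (insert a S) ∪ Z) ∩ (withCups S ∩ {d | ∃ b ∈ T, d.HasCup b} ∪ Z) := by
        rw [withCups_insert]
        ext d
        simp only [Set.mem_union, Set.mem_inter_iff, Set.mem_ofPred_eq]
        grind
      have hr1 := (isRightClosed_withCups (insert a S)).union hZr
      have hr2 := ((isRightClosed_withCups S).inter (hr T)).union hZr
      rw [h1, jonesRightIdeal_union hp hr1 hr2]
      refine (hS _).sup (ih S) ?_ fun x hx => ?_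
      · rw [← jonesRightIdeal_inter hp hZ hr1 hr2 Set.subset_union_right, ← h2]
        exact ih _
      · obtain ⟨y, rfl, hy⟩ := (mem_jonesRightIdeal hp hr1).1 hx
        rw [← AlgHom.comp_apply, hε]
        exact augmentation_eq_zero_of_mem_supported (fun d hd => hd.elim
          (fun h => (h a (Finset.mem_insert_self _ _)).not_isThrough) (hZt d)) hy
  have := key Finset.univ ∅
  simpa [withCups] using this

end Cups

open BrauerDiagram

/-! ### The projection to the group algebra of the cyclic group -/

section Rotation

variable {R : Type u} [CommRing R] {n : ℕ} [NeZero n] {δ : R}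

theorem BrauerDiagram.HasCup.ne_rotation {d : BrauerDiagram n} {a : Fin n} (h : d.HasCup a)
    (k : Fin n) : d ≠ BrauerDiagram.rotation k :=
  fun h' => h.not_isThrough (h' ▸ isThrough_rotation k)

open scoped Classical in
/-- The linear map to the group algebra of the cyclic group that is zero on all diagrams other than
the rotations. -/
noncomputable def rotationMap :
    BrauerAlgebra R n δ →ₗ[R] MonoidAlgebra R (Multiplicative (ZMod n)) :=
  (basis R δ).constr R fun d => if h : ∃ k, d = BrauerDiagram.rotation k then
    MonoidAlgebra.single (Multiplicative.ofAdd ((h.choose.val : ℕ) : ZMod n)) 1 else 0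

theorem rotationMap_rotation (k : Fin n) : rotationMap (diagram R δ (BrauerDiagram.rotation k)) =
    MonoidAlgebra.single (Multiplicative.ofAdd ((k.val : ℕ) : ZMod n)) 1 := by
  have h : ∃ l, BrauerDiagram.rotation k = BrauerDiagram.rotation l := ⟨k, rfl⟩
  rw [rotationMap, diagram, Module.Basis.constr_basis, dif_pos h,
    ← rotation_injective h.choose_spec]

theorem rotationMap_of_forall_ne {d : BrauerDiagram n} (h : ∀ k, d ≠ BrauerDiagram.rotation k) :
    rotationMap (diagram R δ d) = 0 := by
  rw [rotationMap, diagram, Module.Basis.constr_basis, dif_neg (by simpa using h)]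

theorem BrauerDiagram.HasCup.rotationMap_eq_zero {d : BrauerDiagram n} {a : Fin n}
    (h : d.HasCup a) : rotationMap (diagram R δ d) = 0 :=
  rotationMap_of_forall_ne h.ne_rotation

/-- In the whole Brauer algebra a product of two permutations that are not rotations can be a
rotation, so membership in the subalgebra matters: there every diagram other than a rotation has a
cup, and a composite with such a factor has a cup again. -/
theorem rotationMap_mul {x y : BrauerAlgebra R n δ} (hx : x ∈ JonesAnnularAlgebra R n δ)
    (hy : y ∈ JonesAnnularAlgebra R n δ) :
    rotationMap (x * y) = rotationMap x * rotationMap y := by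
  refine jones_induction (p := fun x => rotationMap (x * y) = rotationMap x * rotationMap y)
    ?_ ?_ ?_ ?_ hx (mem_supported_univ x)
  · intro r d _ hd _
    simp only [smul_mul_assoc, map_smul]
    congr 1
    refine jones_induction (p := fun y => rotationMap (diagram R δ d * y) =
      rotationMap (diagram R δ d) * rotationMap y) ?_ ?_ ?_ ?_ hy (mem_supported_univ y)
    · intro s e _ he _
      simp only [mul_smul_comm, map_smul]
      congr 1
      rw [diagram_mul_diagram, map_smul]
      rcases hd.1 with ⟨k, rfl⟩ | ⟨a, ha⟩
      · rcases he.1 with ⟨l, rfl⟩ | ⟨a, ha⟩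
        · rw [loops_rotation_rotation, pow_zero, one_smul, rotation_comp_rotation,
            rotationMap_rotation, rotationMap_rotation, rotationMap_rotation,
            MonoidAlgebra.single_mul_single, one_mul, ← ofAdd_add, Fin.val_add,
            ZMod.natCast_mod, Nat.cast_add]
        · rw [(ha.rotation_comp k).rotationMap_eq_zero, ha.rotationMap_eq_zero, smul_zero,
            mul_zero]
      · rw [(ha.comp e).rotationMap_eq_zero, ha.rotationMap_eq_zero, smul_zero, zero_mul]
    · rw [mul_zero, map_zero, mul_zero]
    · intro a b h1 h2
      rw [mul_add, map_add, map_add, h1, h2, mul_add]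
    · intro s a h
      rw [mul_smul_comm, map_smul, map_smul, h, mul_smul_comm]
  · rw [zero_mul, map_zero, zero_mul]
  · intro a b h1 h2
    rw [add_mul, map_add, map_add, h1, h2, add_mul]
  · intro s a h
    rw [smul_mul_assoc, map_smul, map_smul, h, smul_mul_assoc]

variable (R n δ) in
/-- The homomorphism from `J_n(δ)` to the group algebra of the cyclic group. -/
noncomputable def rotationHom :
    JonesAnnularAlgebra R n δ →ₐ[R] MonoidAlgebra R (Multiplicative (ZMod n)) :=
  AlgHom.ofLinearMap (rotationMap ∘ₗ (JonesAnnularAlgebra R n δ).val.toLinearMap)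
    (by
      change rotationMap (1 : BrauerAlgebra R n δ) = 1
      rw [one_def, ← rotation_zero, rotationMap_rotation]
      simp [MonoidAlgebra.one_def])
    fun x y => rotationMap_mul x.2 y.2

theorem rotationHom_apply (x : JonesAnnularAlgebra R n δ) :
    rotationHom R n δ x = rotationMap (x : BrauerAlgebra R n δ) := rfl

theorem rotationHom_surjective : Function.Surjective (rotationHom R n δ) := by
  intro x
  induction x using MonoidAlgebra.induction_linear with
  | zero => exact ⟨0, map_zero _⟩
  | add x y h1 h2 =>
    obtain ⟨a, rfl⟩ := h1
    obtain ⟨b, rfl⟩ := h2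
    exact ⟨a + b, map_add _ _ _⟩
  | single g r =>
    let k : Fin n := ⟨g.toAdd.val, ZMod.val_lt _⟩
    refine ⟨r • ⟨_, diagram_mem_jones (isAnnular_rotation k)⟩, ?_⟩
    rw [map_smul, rotationHom_apply, rotationMap_rotation, ZMod.natCast_val, ZMod.cast_id]
    simp

theorem groupAugmentation_comp_rotationHom :
    (groupAugmentation R (Multiplicative (ZMod n))).comp (rotationHom R n δ) =
      jonesAugmentation R n δ := by
  ext x
  refine jones_induction (p := fun x => groupAugmentation R (Multiplicative (ZMod n))
    (rotationMap x) = augmentationMap x) ?_ ?_ ?_ ?_ x.2 (mem_supported_univ _)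
  · intro k d _ hd _
    rw [map_smul, map_smul, map_smul]
    congr 1
    rcases hd.1 with ⟨l, rfl⟩ | ⟨a, ha⟩
    · rw [rotationMap_rotation, augmentationMap_diagram_of_isThrough (isThrough_rotation l)]
      simp [groupAugmentation]
    · rw [ha.rotationMap_eq_zero, map_zero,
        augmentationMap_diagram_of_not_isThrough ha.not_isThrough]
  · rw [map_zero, map_zero, map_zero]
  · intro a b h1 h2
    rw [map_add, map_add, map_add, h1, h2]
  · intro r a h
    rw [map_smul, map_smul, map_smul, h]

theorem rotationMap_apply (x : BrauerAlgebra R n δ) (k : Fin n) :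
    (rotationMap x).coeff (Multiplicative.ofAdd ((k.val : ℕ) : ZMod n)) =
      (basis R δ).repr x (BrauerDiagram.rotation k) := by
  induction x using diagram_induction with
  | hd d =>
    have hrepr : (basis R δ).repr (diagram R δ d) = Finsupp.single d 1 := (basis R δ).repr_self d
    rw [hrepr]
    by_cases h : ∃ l, d = BrauerDiagram.rotation l
    · obtain ⟨l, rfl⟩ := h
      rw [rotationMap_rotation]
      by_cases hkl : l = k
      · subst hkl; simp
      · rw [Finsupp.single_eq_of_ne fun h => hkl (rotation_injective h.symm)]
        rw [MonoidAlgebra.coeff_single, Finsupp.single_apply, if_neg]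
        intro h
        refine hkl (Fin.ext ?_)
        have := congrArg ZMod.val (Multiplicative.ofAdd.injective h)
        rwa [ZMod.val_cast_of_lt l.isLt, ZMod.val_cast_of_lt k.isLt] at this
    · push Not at h
      rw [rotationMap_of_forall_ne h, Finsupp.single_eq_of_ne (h k).symm]
      rfl
  | ha a b h1 h2 =>
    rw [map_add, map_add, Finsupp.add_apply, ← h1, ← h2]
    rfl
  | hs r a h =>
    rw [map_smul, map_smul, Finsupp.smul_apply, ← h]
    rfl

/-- The coefficients of the image are the coefficients of `x` at the rotations, and every other
diagram in the support of `x` has a cup. -/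
theorem rotationHom_eq_zero_iff (x : JonesAnnularAlgebra R n δ) : rotationHom R n δ x = 0 ↔
    (x : BrauerAlgebra R n δ) ∈ supported R δ {d : BrauerDiagram n | ∃ a, d.HasCup a} := by
  refine ⟨fun h => mem_supported.2 fun d hd => ?_,
    supported_le_ker rotationMap fun d hd => hd.elim fun a ha => ha.rotationMap_eq_zero⟩
  have hJ : (x : BrauerAlgebra R n δ) ∈ supported R δ {d : BrauerDiagram n | d.IsJones} :=
    jones_induction (p := fun x => x ∈ supported R δ {d : BrauerDiagram n | d.IsJones})
      (fun k d _ hd _ => Submodule.smul_mem _ _ (diagram_mem_supported hd)) (zero_mem _)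
      (fun _ _ => add_mem) (fun r _ => Submodule.smul_mem _ r) x.2 (mem_supported_univ _)
  rcases (mem_supported.1 hJ d hd).1 with ⟨k, rfl⟩ | h'
  · rw [← rotationMap_apply, ← rotationHom_apply, h] at hd
    exact absurd rfl hd
  · exact h'

variable {A : Type u} [Ring A] [Algebra R A] {p : JonesAnnularAlgebra R n δ →ₐ[R] A}
  {ε : A →ₐ[R] R} {π : A →ₐ[R] MonoidAlgebra R (Multiplicative (ZMod n))}

theorem rightKer_eq_jonesRightIdeal (hp : Function.Surjective p)
    (hπ : π.comp p = rotationHom R n δ) {Z : Set (BrauerDiagram n)} (hZr : IsRightClosed Z)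
    (hZ : ∀ y, p y = 0 ↔ (y : BrauerAlgebra R n δ) ∈ supported R δ Z) :
    rightKer π = jonesRightIdeal p ({d | ∃ a, d.HasCup a} ∪ Z) := by
  have hr : IsRightClosed {d : BrauerDiagram n | ∃ a, d.HasCup a} :=
    fun d ⟨a, ha⟩ e => ⟨a, ha.comp e⟩
  have hπ' : ∀ y, π (p y) = rotationHom R n δ y := fun y => DFunLike.congr_fun hπ y
  ext a
  rw [mem_rightKer, jonesRightIdeal_union hp hr hZr, Submodule.mem_sup]
  constructor
  · obtain ⟨y, rfl⟩ := hp a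
    intro h
    rw [hπ', rotationHom_eq_zero_iff] at h
    exact ⟨p y, (mem_jonesRightIdeal hp hr).2 ⟨y, rfl, h⟩, 0, zero_mem _, add_zero _⟩
  · rintro ⟨b, hb, c, hc, rfl⟩
    obtain ⟨y, rfl, hy⟩ := (mem_jonesRightIdeal hp hr).1 hb
    obtain ⟨z, rfl, hz⟩ := (mem_jonesRightIdeal hp hZr).1 hc
    rw [(hZ z).2 hz, add_zero, hπ', rotationHom_eq_zero_iff]
    exact hy

/-- A quotient of `J_n(δ)` whose right ideals spanned by diagrams with given cups have left units
has the homology of the cyclic group. -/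
theorem nonempty_algebraHomology_iso_cyclic (hp : Function.Surjective p)
    (hε : ε.comp p = jonesAugmentation R n δ) (hπ : π.comp p = rotationHom R n δ)
    {Z : Set (BrauerDiagram n)} (hZr : IsRightClosed Z)
    (hZ : ∀ y, p y = 0 ↔ (y : BrauerAlgebra R n δ) ∈ supported R δ Z)
    (hZt : ∀ d ∈ Z, ¬ d.IsThrough)
    (hunit : ∀ S : Finset (Fin n), (∃ e ∈ JonesAnnularAlgebra R n δ,
      e ∈ supported R δ (withCups S) ∧
        ∀ d ∈ withCups S, e * diagram R δ d = diagram R δ d) ∨ withCups S ⊆ Z) (q : ℕ) :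
    Nonempty (algebraHomology ε q ≅
      algebraHomology (groupAugmentation R (Multiplicative (ZMod n))) q) := by
  refine nonempty_algebraHomology_iso (π := π) ?_ ?_ ?_ q
  · refine Function.Surjective.of_comp (g := p) ?_
    rw [← AlgHom.coe_comp, hπ]
    exact rotationHom_surjective
  · rw [← AlgHom.cancel_right hp, AlgHom.comp_assoc, hπ, hε, groupAugmentation_comp_rotationHom]
  · rw [rightKer_eq_jonesRightIdeal hp hπ hZr hZ]
    exact isExcisive_cups hp hε hZ hZr hZt hunit

end Rotation

/-! ### The two comparisons -/

theorem jonesQuotientAugmentation_comp {R : Type u} [CommRing R] (n : ℕ) [NeZero n] (δ : R) :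
    (jonesQuotientAugmentation R n δ).comp (Ideal.Quotient.mkₐ R (jonesIdeal R n δ)) =
      jonesAugmentation R n δ :=
  AlgHom.ext fun _ => rfl

theorem mkₐ_jonesIdeal_eq_zero_iff {R : Type u} [CommRing R] {n : ℕ} [NeZero n] {δ : R}
    (y : JonesAnnularAlgebra R n δ) : Ideal.Quotient.mkₐ R (jonesIdeal R n δ) y = 0 ↔
      (y : BrauerAlgebra R n δ) ∈ supported R δ {d : BrauerDiagram n | d.HasNoThrough} :=
  Ideal.Quotient.eq_zero_iff_mem.trans mem_jonesIdeal_iff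

theorem mainTheorem3 {R : Type*} [CommRing R] (n : ℕ) [NeZero n] (δ : R) :
    (∀ q : ℕ, Nonempty
      (algebraHomology (jonesQuotientAugmentation R n δ) q ≅
        algebraHomology (groupAugmentation R (Multiplicative (ZMod n))) q)) ∧
    (IsUnit δ ∨ Odd n → ∀ q : ℕ, Nonempty
      (algebraHomology (jonesAugmentation R n δ) q ≅
        algebraHomology (jonesQuotientAugmentation R n δ) q)) := by
  have hquot : ∀ q : ℕ, Nonempty (algebraHomology (jonesQuotientAugmentation R n δ) q ≅
      algebraHomology (groupAugmentation R (Multiplicative (ZMod n))) q) := by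
    refine nonempty_algebraHomology_iso_cyclic (p := Ideal.Quotient.mkₐ R (jonesIdeal R n δ))
      (π := Ideal.Quotient.liftₐ (jonesIdeal R n δ) (rotationHom R n δ) fun y hy => ?_)
      (Ideal.Quotient.mkₐ_surjective _ _) (jonesQuotientAugmentation_comp n δ)
      (AlgHom.ext fun _ => rfl) (Z := {d | d.HasNoThrough}) (fun _ hd e => hd.comp_left e)
      mkₐ_jonesIdeal_eq_zero_iff (fun _ hd => hd.not_isThrough) exists_left_unit_of_zigzag
    rw [rotationHom_apply]
    exact supported_le_ker rotationMap (fun d hd => rotationMap_of_forall_ne fun k hk =>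
      hd.not_isThrough (hk ▸ isThrough_rotation k)) (mem_jonesIdeal_iff.1 hy)
  refine ⟨hquot, fun h q => ?_⟩
  rcases h with hδ | hn
  -- With `δ` invertible the comparison with the cyclic group works for the algebra itself, without
  -- any quotient, so `Z` is empty; it is then combined with the comparison for the quotient.
  · obtain ⟨f⟩ := nonempty_algebraHomology_iso_cyclic (p := AlgHom.id R _)
      (π := rotationHom R n δ)
      (ε := jonesAugmentation R n δ) Function.surjective_id rfl rfl (Z := ∅)
      (fun _ h => h.elim)
      (fun y => ⟨fun h => by rw [show y = 0 from h]; exact zero_mem _,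
        fun h => Subtype.ext (eq_zero_of_mem_supported_empty h)⟩)
      (fun _ h => h.elim)
      (fun S => (exists_left_unit_of_isUnit hδ S).imp_right fun h => h.subset) q
    obtain ⟨g⟩ := hquot q
    exact ⟨f ≪≫ g.symm⟩
  -- For odd `n` the ideal `I_0` vanishes, so excision for the quotient map is trivial.
  · refine nonempty_algebraHomology_iso (Ideal.Quotient.mkₐ_surjective R (jonesIdeal R n δ))
      (jonesQuotientAugmentation_comp n δ) ?_ q
    have : rightKer (Ideal.Quotient.mkₐ R (jonesIdeal R n δ)) = ⊥ := by
      rw [eq_bot_iff]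
      intro x hx
      have h := (mkₐ_jonesIdeal_eq_zero_iff x).1 (mem_rightKer.1 hx)
      have h0 : {d : BrauerDiagram n | d.HasNoThrough} = ∅ :=
        Set.eq_empty_of_forall_notMem fun d hd =>
          (Nat.not_even_iff_odd.2 hn) (HasNoThrough.even hd)
      rw [h0] at h
      exact Subtype.ext (eq_zero_of_mem_supported_empty h)
    rw [this]
    exact .bot
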